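/- Let $d\ge 0$, $T\ge 1$, and let $q(x_0)$ be a probability distribution on $\mathbb{R}^d$ with $\|x_0\|\le D$ almost surely (Euclidean norm). Let $\beta_1,\dots,\beta_T\in(0,1)$ and let $q$ be the law of the Markov chain $x_0,x_1,\dots,x_T$ with $x_0\sim q(x_0)$ and $q(x_t\mid x_{t-1})=\mathcal N(\sqrt{1-\beta_t}\,x_{t-1},\beta_t I)$. Put $\bar\alpha_t=\prod_{s=1}^t(1-\beta_s)$, $\mathrm{SNR}_t=\bar\alpha_t/(1-\bar\alpha_t)$ and $\gamma_t=\mathrm{SNR}_t-\mathrm{SNR}_{t+1}$, and assume that $\gamma_t\le C/T$ for $t=1,\dots,T-1$, where $C>0$ is a constant. A Gaussian reverse process $p_\theta$ is given by a mean function $\mu_\theta(x,t)\in\mathbb{R}^d$ and a covariance function $\Sigma_\theta(x,t)$ with values in the positive semidefinite $d\times d$ matrices, both measurable in $x$: under $p_\theta$, $x_T\sim\mathcal N(0,I)$ and $p_\theta(x_{t-1}\mid x_t)=\mathcal N(\mu_\theta(x_t,t),\Sigma_\theta(x_t,t))$ for $t=T,\dots,2$. Define $$\mathcal L(\theta)=\sum_{t=2}^T\mathbb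 E_{q(x_t,x_0)}\big[\mathrm{KL}\big(q(x_{t-1}\mid x_t,x_0)\,\|\,p_\theta(x_{t-1}\mid x_t)\big)\big],\qquad \mathcal L^*=\sum_{t=2}^T\mathbb E_{q(x_t,x_0)}\big[\mathrm{KL}\big(q(x_{t-1}\mid x_t,x_0)\,\|\,q(x_{t-1}\mid x_t)\big)\big].$$ Then $\mathcal L$ attains its minimum over all such pairs $(\mu_\theta,\Sigma_\theta)$, and for every minimizer $\theta^*$ the quantities $\mathcal L(\theta^*)$, $\mathcal L^*$, $\mathrm{KL}(q(x_{1:T})\|p_{\theta^*}(x_{1:T}))$ and $\mathrm{KL}(q(x_T)\|\mathcal N(0,I))$ are finite, and $$\mathrm{KL}\big(q(x_{1:T})\,\|\,p_{\theta^*}(x_{1:T})\big)-\mathrm{KL}\big(q(x_T)\,\|\,\mathcal N(0,I)\big)=\mathcal L(\theta^*)-\mathcal L^*\le\frac{C^3D^6}{2T^2}.$$ -/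

import Mathlib

open MeasureTheory ProbabilityTheory
open scoped ENNReal

noncomputable section

namespace DDPM

/-- The data space `ℝ^d` with its Euclidean norm. -/
abbrev E (d : ℕ) : Type := EuclideanSpace ℝ (Fin d)

section Gaussian

open scoped MatrixOrder Matrix.Norms.L2Operator in
lemma continuousOn_sqrt_posSemidef (d : ℕ) :
    ContinuousOn (fun M : Matrix (Fin d) (Fin d) ℝ => CFC.sqrt M) {M | M.PosSemidef} := by
  have h := CFC.continuousOn_sqrt (A := Matrix (Fin d) (Fin d) ℝ)
  refine h.mono ?_
  intro M hM
  exact Matrix.PosSemidef.nonneg hM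

open scoped MatrixOrder in
lemma sqrt_of_not_posSemidef {d : ℕ} {M : Matrix (Fin d) (Fin d) ℝ} (hM : ¬ M.PosSemidef) :
    CFC.sqrt M = 0 := by
  rw [CFC.sqrt, cfcₙ_apply_of_not_predicate]
  change ¬ (M - 0).PosSemidef
  simpa

lemma isClosed_posSemidef (d : ℕ) : IsClosed {M : Matrix (Fin d) (Fin d) ℝ | M.PosSemidef} := by
  have h : {M : Matrix (Fin d) (Fin d) ℝ | M.PosSemidef} =
      {M | M.conjTranspose = M} ∩ ⋂ x : Fin d → ℝ, {M | 0 ≤ star x ⬝ᵥ (M.mulVec x)} := by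
    ext M
    simp [Matrix.posSemidef_iff_dotProduct_mulVec, Matrix.IsHermitian]
  rw [h]
  refine (isClosed_eq (by fun_prop) continuous_id).inter (isClosed_iInter fun x => ?_)
  exact isClosed_le continuous_const (by fun_prop)

open scoped MatrixOrder in
lemma measurable_sqrt_entry (d : ℕ) (i j : Fin d) :
    Measurable (fun M : Fin d → Fin d → ℝ => (CFC.sqrt (Matrix.of M)) i j) := by
  classical
  have hc : IsClosed {M : Fin d → Fin d → ℝ | (Matrix.of M).PosSemidef} := isClosed_posSemidef d
  have hs : MeasurableSet {M : Fin d → Fin d → ℝ | (Matrix.of M).PosSemidef} := hc.measurableSet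
  refine measurable_of_restrict_of_restrict_compl hs ?_ ?_
  · refine Continuous.measurable ?_
    have h := (continuousOn_sqrt_posSemidef d).domRestrict
    exact (continuous_apply_apply i j).comp h
  · have : (({M : Fin d → Fin d → ℝ | (Matrix.of M).PosSemidef}ᶜ).domRestrict
        fun M : Fin d → Fin d → ℝ => (CFC.sqrt (Matrix.of M)) i j) = fun _ => 0 := by
      funext M
      have := sqrt_of_not_posSemidef (M := Matrix.of M.1) M.2
      simp [Set.domRestrict, this]
    exact this ▸ measurable_const

open scoped MatrixOrder in
lemma measurable_multivariateGaussian {α : Type*} [MeasurableSpace α] {d : ℕ} {m : α → E d}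
    {S : α → Matrix (Fin d) (Fin d) ℝ} (hm : Measurable m)
    (hS : ∀ i j, Measurable fun a => S a i j) :
    Measurable fun a => multivariateGaussian (m a) (S a) := by
  have hent : ∀ i j, Measurable fun a => (CFC.sqrt (S a)) i j := fun i j =>
    (measurable_sqrt_entry d i j).comp
      (measurable_pi_lambda _ fun i => measurable_pi_lambda _ fun j => hS i j)
  have hjoint : Measurable fun p : α × E d =>
      m p.1 + Matrix.toEuclideanCLM (𝕜 := ℝ) (CFC.sqrt (S p.1)) p.2 := by
    refine (hm.comp measurable_fst).add ?_
    have : (fun p : α × E d => Matrix.toEuclideanCLM (𝕜 := ℝ) (CFC.sqrt (S p.1)) p.2) =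
        fun p => WithLp.toLp 2 fun i => ∑ j, (CFC.sqrt (S p.1)) i j * p.2 j := by
      funext p
      ext i
      simp [Matrix.mulVec, dotProduct]
    rw [this]
    refine (WithLp.measurable_toLp 2 _).comp (measurable_pi_lambda _ fun i => ?_)
    refine Finset.measurable_sum _ fun j _ => ?_
    exact ((hent i j).comp measurable_fst).mul (by fun_prop)
  have h2 : (fun a => multivariateGaussian (m a) (S a)) = fun a =>
      ((stdGaussian (E d)).map (Prod.mk a)).map fun p : α × E d =>
        m p.1 + Matrix.toEuclideanCLM (𝕜 := ℝ) (CFC.sqrt (S p.1)) p.2 := by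
    funext a
    rw [Measure.map_map hjoint measurable_prodMk_left]
    rfl
  rw [h2]
  exact (Measure.measurable_map _ hjoint).comp Measurable.map_prodMk_left

/-- The Markov kernel `x ↦ N(m x, S x)`. -/
def gaussianKernel {d : ℕ} (m : E d → E d) (S : E d → Matrix (Fin d) (Fin d) ℝ)
    (hm : Measurable m) (hS : ∀ i j, Measurable fun x => S x i j) : Kernel (E d) (E d) where
  toFun x := multivariateGaussian (m x) (S x)
  measurable' := measurable_multivariateGaussian hm hS

instance {d : ℕ} (m : E d → E d) (S : E d → Matrix (Fin d) (Fin d) ℝ)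
    (hm : Measurable m) (hS : ∀ i j, Measurable fun x => S x i j) :
    IsMarkovKernel (gaussianKernel m S hm hS) :=
  ⟨fun x => inferInstanceAs (IsProbabilityMeasure (multivariateGaussian (m x) (S x)))⟩

end Gaussian

section Chain

/-- A transition kernel applied to the last point of a path `(y 0, …, y n)`. -/
def lastStep {d : ℕ} (K : Kernel (E d) (E d)) (n : ℕ) :
    Kernel (Π _ : Finset.Iic n, E d) (E d) :=
  K.comap (fun y => y ⟨n, Finset.mem_Iic.2 le_rfl⟩) (measurable_pi_apply _)

instance {d : ℕ} (K : Kernel (E d) (E d)) [IsMarkovKernel K] (n : ℕ) :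
    IsMarkovKernel (lastStep K n) := by
  unfold lastStep; infer_instance

/-- The law on paths `(y 0, y 1, …)` of the Markov chain with initial law `ν` and transition
kernel `K n` from `y n` to `y (n + 1)`. -/
def chainLaw {d : ℕ} (ν : Measure (E d)) (K : ℕ → Kernel (E d) (E d))
    [∀ n, IsMarkovKernel (K n)] : Measure (ℕ → E d) :=
  Kernel.trajMeasure (X := fun _ => E d) ν (fun n => lastStep (K n) n)

instance {d : ℕ} (ν : Measure (E d)) [IsProbabilityMeasure ν] (K : ℕ → Kernel (E d) (E d))
    [∀ n, IsMarkovKernel (K n)] : IsProbabilityMeasure (chainLaw ν K) := by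
  unfold chainLaw; infer_instance

end Chain

section Forward

/-- The forward kernel `q(x_t | x_{t-1}) = N(√(1 - b) x_{t-1}, b I)` with step size `b = β_t`. -/
def forwardKernel (d : ℕ) (b : ℝ) : Kernel (E d) (E d) :=
  gaussianKernel (fun x => √(1 - b) • x) (fun _ => b • (1 : Matrix (Fin d) (Fin d) ℝ))
    (by fun_prop) (fun _ _ => measurable_const)

instance (d : ℕ) (b : ℝ) : IsMarkovKernel (forwardKernel d b) := by
  unfold forwardKernel; infer_instance

/-- The joint law `q` of `(x_0, x_1, …)`: `x_0 ∼ q₀` and `q(x_t | x_{t-1})` is the forward kernel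
with step size `β t`. The coordinates `x_0, …, x_T` only involve `β 1, …, β T`. -/
def forwardLaw {d : ℕ} (q₀ : Measure (E d)) (β : ℕ → ℝ) : Measure (ℕ → E d) :=
  chainLaw q₀ (fun n => forwardKernel d (β (n + 1)))

instance {d : ℕ} (q₀ : Measure (E d)) [IsProbabilityMeasure q₀] (β : ℕ → ℝ) :
    IsProbabilityMeasure (forwardLaw q₀ β) := by
  unfold forwardLaw; infer_instance

/-- The target path law `q(x_{1:T})`. -/
def forwardPathLaw {d : ℕ} (q₀ : Measure (E d)) (β : ℕ → ℝ) (T : ℕ) :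
    Measure (Finset.Icc 1 T → E d) :=
  (forwardLaw q₀ β).map (fun x t => x t)

/-- The posterior `q(x_{t-1} | x_t, x_0)`, as a kernel in the pair `(x_t, x_0)`. -/
def posteriorGivenData {d : ℕ} (q₀ : Measure (E d)) [IsProbabilityMeasure q₀] (β : ℕ → ℝ)
    (t : ℕ) : Kernel (E d × E d) (E d) :=
  condDistrib (fun x : ℕ → E d => x (t - 1)) (fun x => (x t, x 0)) (forwardLaw q₀ β)

/-- The exact reverse kernel `q(x_{t-1} | x_t)`. -/
def exactReverse {d : ℕ} (q₀ : Measure (E d)) [IsProbabilityMeasure q₀] (β : ℕ → ℝ)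
    (t : ℕ) : Kernel (E d) (E d) :=
  condDistrib (fun x : ℕ → E d => x (t - 1)) (fun x => x t) (forwardLaw q₀ β)

/-- `ᾱ_t = ∏_{s=1}^t (1 - β_s)`. -/
def alphaBar (β : ℕ → ℝ) (t : ℕ) : ℝ := ∏ s ∈ Finset.Icc 1 t, (1 - β s)

/-- The signal-to-noise ratio of `x_t`. -/
def snr (β : ℕ → ℝ) (t : ℕ) : ℝ := alphaBar β t / (1 - alphaBar β t)

/-- The decrement `γ_t = SNR_t - SNR_{t+1}`. -/
def snrStep (β : ℕ → ℝ) (t : ℕ) : ℝ := snr β t - snr β (t + 1)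

end Forward

section Reverse

/-- A Gaussian reverse process: a mean function `μ(x_t, t)` and a positive semidefinite
covariance function `Σ(x_t, t)`, both measurable in `x_t`. -/
structure ReverseModel (d : ℕ) where
  /-- the mean `μ(x_t, t)` -/
  mean : E d → ℕ → E d
  /-- the covariance `Σ(x_t, t)` -/
  cov : E d → ℕ → Matrix (Fin d) (Fin d) ℝ
  measurable_mean : ∀ t, Measurable fun x => mean x t
  measurable_cov : ∀ t i j, Measurable fun x => cov x t i j
  posSemidef_cov : ∀ x t, (cov x t).PosSemidef

namespace ReverseModel

variable {d : ℕ}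

/-- `p(x_{t-1} | x_t) = N(μ(x_t, t), Σ(x_t, t))`. -/
def kernel (p : ReverseModel d) (t : ℕ) : Kernel (E d) (E d) :=
  gaussianKernel (fun x => p.mean x t) (fun x => p.cov x t) (p.measurable_mean t)
    (p.measurable_cov t)

instance (p : ReverseModel d) (t : ℕ) : IsMarkovKernel (p.kernel t) := by
  unfold kernel; infer_instance

/-- The path law `p(x_{1:T})`: `x_T ∼ N(0, I)`, then `x_{t-1} ∼ p(· | x_t)` for `t = T, …, 2`.
It is read off from the chain `y k = x_{T-k}`. -/
def pathLaw (p : ReverseModel d) (T : ℕ) : Measure (Finset.Icc 1 T → E d) :=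
  (chainLaw (multivariateGaussian 0 1) (fun k => p.kernel (T - k))).map
    (fun y t => y (T - t))

/-- The diffusion loss
`𝓛 = ∑_{t=2}^T E_{q(x_t,x_0)} KL(q(x_{t-1} | x_t, x_0) ‖ p(x_{t-1} | x_t))`. -/
def loss (p : ReverseModel d) (q₀ : Measure (E d)) [IsProbabilityMeasure q₀] (β : ℕ → ℝ)
    (T : ℕ) : ℝ≥0∞ :=
  ∑ t ∈ Finset.Icc 2 T, ∫⁻ x, InformationTheory.klDiv
    (posteriorGivenData q₀ β t (x t, x 0)) (p.kernel t (x t)) ∂(forwardLaw q₀ β)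

/-- The mean and covariance functions minimize the loss over all measurable mean functions and all
measurable positive semidefinite covariance functions. -/
def IsOptimal (p : ReverseModel d) (q₀ : Measure (E d)) [IsProbabilityMeasure q₀] (β : ℕ → ℝ)
    (T : ℕ) : Prop :=
  ∀ p' : ReverseModel d, p.loss q₀ β T ≤ p'.loss q₀ β T

end ReverseModel

/-- The optimal diffusion loss
`𝓛* = ∑_{t=2}^T E_{q(x_t,x_0)} KL(q(x_{t-1} | x_t, x_0) ‖ q(x_{t-1} | x_t))`. -/
def exactLoss {d : ℕ} (q₀ : Measure (E d)) [IsProbabilityMeasure q₀] (β : ℕ → ℝ)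
    (T : ℕ) : ℝ≥0∞ :=
  ∑ t ∈ Finset.Icc 2 T, ∫⁻ x, InformationTheory.klDiv
    (posteriorGivenData q₀ β t (x t, x 0)) (exactReverse q₀ β t (x t)) ∂(forwardLaw q₀ β)

/-- The unconditional path KL, `KL(q(x_{1:T}) ‖ p(x_{1:T}))`. -/
def pathKL {d : ℕ} (q₀ : Measure (E d)) (β : ℕ → ℝ) (T : ℕ) (p : ReverseModel d) : ℝ≥0∞ :=
  InformationTheory.klDiv (forwardPathLaw q₀ β T) (p.pathLaw T)

/-- The terminal mismatch `KL(q(x_T) ‖ N(0, I))`. -/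
def terminalKL {d : ℕ} (q₀ : Measure (E d)) (β : ℕ → ℝ) (T : ℕ) : ℝ≥0∞ :=
  InformationTheory.klDiv ((forwardLaw q₀ β).map (fun x => x T)) (multivariateGaussian 0 1)

end Reverse

end DDPM

end

/-!
The chain rule along reversed paths, together with the reverse Markov property of the forward
process, gives `pathKL = terminalKL + G` (`pathKL_eq`), where `G` is the sum over `2 ≤ t ≤ T` of the
mean divergences of the exact reverse kernels `q(x_{t-1} | x_t)` from the model. The compensation
identity `lintegral_klDiv_eq_add` for the mixture
`q(x_{t-1} | x_t) = E[q(x_{t-1} | x_t, x_0) | x_t]` gives `loss = exactLoss + G` (`loss_eq_add`). So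
both differences in the theorem are `G`, and a minimizer of the loss is a minimizer of `G`, provided
that everything is finite.

By Bayes' rule (`gaussian_bayes`), `q(x_{t-1} | x_t, x_0) = N(a x_t + b x_0, σ² I)` with
`b² / σ² = γ_{t-1}`. Its mean divergence from a Gaussian law, given `x_t`, only involves the first two
moments of `x_0` given `x_t`, and it is minimal when mean and covariance of the Gaussian law match
those of the mixture (`lintegral_klDiv_momentMatch_le`). This is the minimizer `momentModel`. After
an affine change of variables, everything is reduced to a bound for the divergence of a Gaussian
mixture `X + Z`, with `Z` standard Gaussian and `‖X‖ ≤ R = √γ_{t-1} D`, from the Gaussian law with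
the same mean and covariance: `klDiv_mixture_le` bounds it by `R⁶ / 2`. The sum of `T - 1` such terms
with `γ ≤ C / T` is at most `C³ D⁶ / (2 T²)`.

For this bound, let `X` have mean `0` and covariance `M`. By the compensation identity, the
divergence is `KL(X + Z ‖ Z) - tr M / 2 + log det (1 + M) / 2`, and the third order expansion of
`log det` (`log_det_one_add_le`) leaves to show `KL(X + Z ‖ Z) ≤ tr M² / 4 + R⁶ / 3`
(`signalKL_one_le`). Consider the observation `√s X + Z` for `s ∈ [0, 1]`. In the signal-to-noise
ratio `s`, the derivative of the divergence `K` is half of `m = E‖E[X | obs]‖²`; the derivative of `m`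
is `E‖cov(X | obs)‖² ≤ u = E‖E[X ⊗ X | obs]‖²`; and the derivative of `u` is the mean squared norm of
the posterior covariance of `X ⊗ X` and `X`, which is at most `4 R⁶`. Integrating three times from
`K(0) = m(0) = 0` and `u(0) = tr M²` gives the claim. Instead of differentiating, the proof
estimates finite increments of `s` up to an error of order `h^(3/2)`: independent Gaussian
increments turn the posterior law at `s` into the prior law of the next increment, so that it
suffices to expand at `s = 0`.
-/

namespace DDPM

/-! ### Conditional Kullback-Leibler divergences -/

section KullbackLeibler

open InformationTheory

variable {α β : Type*} {mα : MeasurableSpace α} {mβ : MeasurableSpace β}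

lemma klDiv_map_equiv (e : α ≃ᵐ β) (μ ν : Measure α) [IsFiniteMeasure μ] [IsFiniteMeasure ν] :
    klDiv (μ.map e) (ν.map e) = klDiv μ ν := by
  refine le_antisymm (klDiv_map_le μ ν e.measurable) ?_
  have h := klDiv_map_le (μ.map e) (ν.map e) e.symm.measurable
  rwa [Measure.map_map e.symm.measurable e.measurable,
    Measure.map_map e.symm.measurable e.measurable, e.symm_comp_self, Measure.map_id,
    Measure.map_id] at h

section Kernel

variable [MeasurableSpace.CountableOrCountablyGenerated α β]

open scoped Classical in
lemma klDiv_kernel_eq (κ η : Kernel α β) [IsFiniteKernel κ] [IsFiniteKernel η] (a : α) :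
    klDiv (κ a) (η a) = if κ a ≪ η a then
      ∫⁻ b, ENNReal.ofReal (klFun (κ.rnDeriv η a b).toReal) ∂(η a) else ∞ := by
  rw [klDiv_eq_lintegral_klFun]
  refine if_congr Iff.rfl (lintegral_congr_ae ?_) rfl
  filter_upwards [Kernel.rnDeriv_eq_rnDeriv_measure (κ := κ) (η := η) (a := a)] with b hb
  rw [hb]

lemma measurable_ofReal_klFun_rnDeriv (κ η : Kernel α β) :
    Measurable fun p : α × β => ENNReal.ofReal (klFun (κ.rnDeriv η p.1 p.2).toReal) :=
  (measurable_klFun.comp (Kernel.measurable_rnDeriv κ η).ennreal_toReal).ennreal_ofReal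

lemma measurable_klDiv (κ η : Kernel α β) [IsFiniteKernel κ] [IsFiniteKernel η] :
    Measurable fun a => klDiv (κ a) (η a) := by
  classical
  simp_rw [klDiv_kernel_eq κ η]
  refine Measurable.ite (Kernel.measurableSet_absolutelyContinuous κ η) ?_ measurable_const
  exact (measurable_ofReal_klFun_rnDeriv κ η).lintegral_kernel_prod_right'

/-- The conditional divergence `klDiv (μ ⊗ₘ κ) (μ ⊗ₘ η)`, which appears in Mathlib's chain rule, is
the average of the fibrewise divergences. -/
lemma klDiv_compProd_eq_lintegral (μ : Measure α) [IsFiniteMeasure μ] (κ η : Kernel α β)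
    [IsMarkovKernel κ] [IsMarkovKernel η] :
    klDiv (μ ⊗ₘ κ) (μ ⊗ₘ η) = ∫⁻ a, klDiv (κ a) (η a) ∂μ := by
  by_cases hac : ∀ᵐ a ∂μ, κ a ≪ η a
  · have hac' : μ ⊗ₘ κ ≪ μ ⊗ₘ η := Measure.absolutelyContinuous_compProd_right_iff.2 hac
    have hd : μ ⊗ₘ κ = (μ ⊗ₘ η).withDensity fun p => κ.rnDeriv η p.1 p.2 := by
      rw [← Measure.compProd_withDensity (Kernel.measurable_rnDeriv κ η)]
      refine Measure.compProd_congr ?_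
      filter_upwards [hac] with a ha
      exact (Kernel.withDensity_rnDeriv_eq ha).symm
    have hr : (μ ⊗ₘ κ).rnDeriv (μ ⊗ₘ η) =ᵐ[μ ⊗ₘ η] fun p => κ.rnDeriv η p.1 p.2 := by
      nth_rw 1 [hd]
      exact Measure.rnDeriv_withDensity _ (Kernel.measurable_rnDeriv κ η)
    rw [klDiv_eq_lintegral_klFun_of_ac hac', lintegral_congr_ae
      (g := fun p => ENNReal.ofReal (klFun (κ.rnDeriv η p.1 p.2).toReal))
      (by filter_upwards [hr] with p hp; rw [hp]),
      Measure.lintegral_compProd (measurable_ofReal_klFun_rnDeriv κ η)]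
    refine lintegral_congr_ae ?_
    filter_upwards [hac] with a ha
    rw [klDiv_kernel_eq κ η, if_pos ha]
  -- otherwise both sides are infinite
  · have hac' : ¬ μ ⊗ₘ κ ≪ μ ⊗ₘ η := fun h =>
      hac (Measure.absolutelyContinuous_compProd_right_iff.1 h)
    rw [klDiv_of_not_ac hac']
    symm
    by_contra hne
    refine hac ?_
    filter_upwards [ae_lt_top (measurable_klDiv κ η) hne] with a ha
    exact (klDiv_ne_top_iff.1 ha.ne).1

end Kernel

/-- The compensation identity: the mean divergence of the fibres `κ a` from a fixed law `p` is
their mean divergence from the mixture `κ ∘ₘ μ`, plus the divergence of the mixture from `p`.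
Both sides are the divergence of the joint law from `μ × p`, disintegrated along either factor. -/
lemma lintegral_klDiv_eq_add [StandardBorelSpace α] [Nonempty α]
    [MeasurableSpace.CountableOrCountablyGenerated α β]
    [MeasurableSpace.CountableOrCountablyGenerated β α]
    (μ : Measure α) [IsProbabilityMeasure μ] (κ : Kernel α β) [IsMarkovKernel κ]
    (p : Measure β) [IsProbabilityMeasure p] :
    ∫⁻ a, klDiv (κ a) p ∂μ = ∫⁻ a, klDiv (κ a) (κ ∘ₘ μ) ∂μ + klDiv (κ ∘ₘ μ) p := by
  have key : ∀ p' : Measure β, IsProbabilityMeasure p' → ∫⁻ a, klDiv (κ a) p' ∂μ =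
      klDiv (κ ∘ₘ μ) p' + klDiv ((κ ∘ₘ μ) ⊗ₘ (κ†μ)) ((κ ∘ₘ μ) ⊗ₘ Kernel.const β μ) := by
    intro p' hp'
    have h1 := klDiv_compProd_eq_lintegral μ κ (Kernel.const α p')
    simp only [Kernel.const_apply] at h1
    rw [← h1, ← klDiv_compProd_eq_add, compProd_posterior_eq_map_swap, Measure.compProd_const,
      Measure.compProd_const, ← Measure.prod_swap (μ := μ) (ν := p')]
    exact (klDiv_map_equiv MeasurableEquiv.prodComm _ _).symm
  rw [key p inferInstance, key (κ ∘ₘ μ) inferInstance, klDiv_self, zero_add, add_comm]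

/-- If `μ` has density `exp ∘ g` with respect to `ν`, then `klDiv μ ν = ∫ g dμ`. -/
lemma klDiv_withDensity_exp (μ ν : Measure α) [IsProbabilityMeasure μ] [IsProbabilityMeasure ν]
    {g : α → ℝ} (hg : Measurable g)
    (h : μ = ν.withDensity fun x => ENNReal.ofReal (Real.exp (g x))) (hi : Integrable g μ) :
    klDiv μ ν = ENNReal.ofReal (∫ x, g x ∂μ) := by
  have hac : μ ≪ ν := by rw [h]; exact withDensity_absolutelyContinuous _ _
  have hr : llr μ ν =ᵐ[μ] g := by
    refine hac.ae_le ?_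
    have := Measure.rnDeriv_withDensity ν (f := fun x => ENNReal.ofReal (Real.exp (g x)))
      (by fun_prop)
    rw [← h] at this
    filter_upwards [this] with x hx
    rw [llr, hx, ENNReal.toReal_ofReal (Real.exp_pos _).le, Real.log_exp]
  rw [klDiv_of_ac_of_integrable hac ((integrable_congr hr).2 hi), integral_congr_ae hr]
  simp

end KullbackLeibler

/-! ### Densities of Gaussian measures -/

section GaussianDensity

open scoped MatrixOrder

variable {d : ℕ}

/-- The normalising constant `(2π)^(-d/2)` of the standard Gaussian density. -/
noncomputable def gaussConst (d : ℕ) : ℝ := (2 * Real.pi) ^ (-(d : ℝ) / 2)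

lemma gaussConst_pos (d : ℕ) : 0 < gaussConst d := by unfold gaussConst; positivity

lemma stdGaussian_eq_withDensity (d : ℕ) : stdGaussian (E d) =
    volume.withDensity fun z => ENNReal.ofReal (gaussConst d * Real.exp (-‖z‖ ^ 2 / 2)) := by
  have hm : Measurable fun z : E d => ENNReal.ofReal (gaussConst d * Real.exp (-‖z‖ ^ 2 / 2)) := by
    fun_prop
  have hint : Integrable (fun z : E d => gaussConst d * Real.exp (-‖z‖ ^ 2 / 2)) := by
    have := GaussianFourier.integrable_cexp_neg_mul_sq_norm_add (V := E d) (b := 1 / 2)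
      (by norm_num) 0 0
    refine (this.norm.const_mul (gaussConst d)).congr (ae_of_all _ fun z => ?_)
    simp only [Complex.norm_exp]
    congr 2
    simp [← Complex.ofReal_pow]
    ring
  have : IsFiniteMeasure (volume.withDensity fun z : E d =>
      ENNReal.ofReal (gaussConst d * Real.exp (-‖z‖ ^ 2 / 2))) :=
    isFiniteMeasure_withDensity_ofReal hint.2
  refine Measure.ext_of_charFun ?_
  ext t
  rw [charFun_stdGaussian, charFun_apply, integral_withDensity_eq_integral_toReal_smul hm
    (ae_of_all _ fun _ => ENNReal.ofReal_lt_top)]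
  have hpos := gaussConst_pos d
  have h := GaussianFourier.integral_cexp_neg_mul_sq_norm_add (V := E d) (b := 1 / 2)
    (by norm_num) Complex.I t
  have e : ∀ z : E d, (ENNReal.ofReal (gaussConst d * Real.exp (-‖z‖ ^ 2 / 2))).toReal •
      Complex.exp (inner ℝ z t * Complex.I) = (gaussConst d : ℂ) *
        Complex.exp (-(1 / 2) * ‖z‖ ^ 2 + Complex.I * inner ℝ t z) := by
    intro z
    rw [ENNReal.toReal_ofReal (by positivity), real_inner_comm z t, Complex.real_smul,
      Complex.ofReal_mul, Complex.ofReal_exp, mul_assoc, ← Complex.exp_add]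
    push_cast
    congr 2
    ring
  simp_rw [e]
  rw [integral_const_mul, h, ← mul_assoc]
  have hc : (gaussConst d : ℂ) *
      ((Real.pi : ℂ) / (1 / 2)) ^ ((Module.finrank ℝ (E d) : ℂ) / 2) = 1 := by
    have : ((Real.pi : ℂ) / (1 / 2)) = ((2 * Real.pi : ℝ) : ℂ) := by push_cast; ring
    rw [this, finrank_euclideanSpace_fin]
    have h2 : ((d : ℂ) / 2) = (((d : ℝ) / 2 : ℝ) : ℂ) := by push_cast; ring
    rw [h2, ← Complex.ofReal_cpow (by positivity), ← Complex.ofReal_mul, gaussConst,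
      ← Real.rpow_add (by positivity)]
    simp [neg_div]
  rw [hc, one_mul]
  congr 1
  rw [Complex.I_sq]
  ring

lemma map_withDensity_equiv {α β : Type*} [MeasurableSpace α] [MeasurableSpace β] (e : α ≃ᵐ β)
    (μ : Measure α) (f : α → ℝ≥0∞) :
    (μ.withDensity f).map e = (μ.map e).withDensity (f ∘ e.symm) := by
  ext s hs
  rw [e.map_apply, withDensity_apply _ (e.measurable hs), withDensity_apply _ hs,
    e.restrict_map, lintegral_map_equiv]
  simp

/-- The quadratic form `wᵀ P w`. -/
noncomputable def quad (P : Matrix (Fin d) (Fin d) ℝ) (w : E d) : ℝ :=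
  inner ℝ w (Matrix.toEuclideanCLM (𝕜 := ℝ) P w)

@[fun_prop]
lemma continuous_quad (P : Matrix (Fin d) (Fin d) ℝ) : Continuous (quad P) := by
  unfold quad; fun_prop

lemma quad_eq_sum (P : Matrix (Fin d) (Fin d) ℝ) (w : E d) :
    quad P w = ∑ i, ∑ j, P i j * (w i * w j) := by
  rw [quad, Matrix.inner_toEuclideanCLM]
  simp only [dotProduct, Matrix.mulVec, Finset.mul_sum]
  exact Finset.sum_congr rfl fun i _ => Finset.sum_congr rfl fun j _ => by ring

lemma quad_one (w : E d) : quad 1 w = ‖w‖ ^ 2 := by simp [quad]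

lemma quad_nonneg {P : Matrix (Fin d) (Fin d) ℝ} (hP : P.PosSemidef) (w : E d) :
    0 ≤ quad P w := by
  rw [quad, Matrix.inner_toEuclideanCLM]
  simpa using hP.dotProduct_mulVec_nonneg w.ofLp

lemma det_toEuclideanCLM (A : Matrix (Fin d) (Fin d) ℝ) :
    LinearMap.det (Matrix.toEuclideanCLM (𝕜 := ℝ) A : E d →ₗ[ℝ] E d) = A.det := by
  rw [Matrix.coe_toEuclideanCLM_eq_toEuclideanLin, Matrix.toEuclideanLin, Matrix.toLpLin_eq_toLin,
    LinearMap.det_toLin]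

lemma isUnit_sqrt {S : Matrix (Fin d) (Fin d) ℝ} (hS : S.PosDef) : IsUnit (CFC.sqrt S) :=
  (CFC.isUnit_sqrt_iff S hS.posSemidef.nonneg).2 hS.isUnit

/-- The density of a nondegenerate Gaussian measure. -/
lemma multivariateGaussian_eq_withDensity (m : E d) {S : Matrix (Fin d) (Fin d) ℝ}
    (hS : S.PosDef) : multivariateGaussian m S = volume.withDensity fun y =>
      ENNReal.ofReal (gaussConst d * Real.exp (-(quad S⁻¹ (y - m) + Real.log S.det) / 2)) := by
  set A := CFC.sqrt S with hA
  have hAA : A * A = S := CFC.sqrt_mul_sqrt_self S hS.posSemidef.nonneg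
  have hAu : IsUnit A.det := (Matrix.isUnit_iff_isUnit_det A).1 (isUnit_sqrt hS)
  have h1 : A * A⁻¹ = 1 := Matrix.mul_nonsing_inv A hAu
  have h2 : A⁻¹ * A = 1 := Matrix.nonsing_inv_mul A hAu
  have hinv : ∀ x, Matrix.toEuclideanCLM (𝕜 := ℝ) A (Matrix.toEuclideanCLM (𝕜 := ℝ) A⁻¹ x) = x := by
    intro x
    rw [← mul_apply_eq_comp, ← map_mul, h1, map_one, one_apply_eq_self]
  have hinv' : ∀ x,
      Matrix.toEuclideanCLM (𝕜 := ℝ) A⁻¹ (Matrix.toEuclideanCLM (𝕜 := ℝ) A x) = x := by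
    intro x
    rw [← mul_apply_eq_comp, ← map_mul, h2, map_one, one_apply_eq_self]
  let e : E d ≃ᵐ E d :=
    { toFun := fun z => m + Matrix.toEuclideanCLM (𝕜 := ℝ) A z
      invFun := fun y => Matrix.toEuclideanCLM (𝕜 := ℝ) A⁻¹ (y - m)
      left_inv := fun z => by simp [hinv']
      right_inv := fun y => by simp [hinv]
      measurable_toFun := by simp only [Equiv.coe_fn_mk]; fun_prop
      measurable_invFun := by simp only [Equiv.coe_fn_symm_mk]; fun_prop }
  have hvol : (volume : Measure (E d)).map e = ENNReal.ofReal |A.det⁻¹| • volume := by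
    have hL := Measure.map_linearMap_addHaar_eq_smul_addHaar (volume : Measure (E d))
      (f := (Matrix.toEuclideanCLM (𝕜 := ℝ) A : E d →ₗ[ℝ] E d))
      (by rw [det_toEuclideanCLM]; exact hAu.ne_zero)
    rw [det_toEuclideanCLM] at hL
    have hcomp : volume.map e = (volume.map
        (Matrix.toEuclideanCLM (𝕜 := ℝ) A : E d →ₗ[ℝ] E d)).map fun y => m + y :=
      (Measure.map_map (measurable_const_add m)
        (Matrix.toEuclideanCLM (𝕜 := ℝ) A).continuous.measurable).symm
    rw [hcomp, hL, Measure.map_smul,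
      (measurePreserving_add_left volume m).map_eq]
  have hAT : A.transpose = A := by
    have h : A.conjTranspose = A := (CFC.sqrt_nonneg S).isSelfAdjoint
    rwa [Matrix.conjTranspose_eq_transpose_of_trivial] at h
  have hdet : S.det = A.det ^ 2 := by rw [← hAA, Matrix.det_mul, sq]
  calc multivariateGaussian m S = (stdGaussian (E d)).map e := rfl
    _ = _ := by
      rw [stdGaussian_eq_withDensity, map_withDensity_equiv, hvol, withDensity_smul_measure,
        ← withDensity_smul _ (by fun_prop)]
      congr 1
      ext y
      simp only [Pi.smul_apply, smul_eq_mul, Function.comp_apply]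
      rw [← ENNReal.ofReal_mul (abs_nonneg _)]
      congr 1
      have hsq : ‖e.symm y‖ ^ 2 = quad S⁻¹ (y - m) := by
        change ‖Matrix.toEuclideanCLM (𝕜 := ℝ) A⁻¹ (y - m)‖ ^ 2 = _
        rw [← real_inner_self_eq_norm_sq, Matrix.inner_toEuclideanCLM, Matrix.ofLp_toEuclideanCLM,
          quad, Matrix.inner_toEuclideanCLM, Matrix.dotProduct_mulVec, Matrix.vecMul_mulVec,
          ← Matrix.dotProduct_mulVec, ← hAA, Matrix.mul_inv_rev]
        rw [Matrix.transpose_nonsing_inv, hAT]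
      have hd0 : 0 < |A.det| := abs_pos.2 hAu.ne_zero
      rw [hsq, hdet, neg_add, add_div, Real.exp_add, ← sq_abs A.det, Real.log_pow]
      have : -((2 : ℕ) * Real.log |A.det|) / 2 = -Real.log |A.det| := by push_cast; ring
      rw [this, Real.exp_neg, Real.exp_log hd0, abs_inv]
      ring

lemma posDef_one : (1 : Matrix (Fin d) (Fin d) ℝ).PosDef := Matrix.PosDef.one

/-- A nondegenerate Gaussian measure as an exponential tilt of another one. -/
lemma multivariateGaussian_eq_withDensity_multivariateGaussian (x m : E d)
    {S : Matrix (Fin d) (Fin d) ℝ} (hS : S.PosDef) :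
    multivariateGaussian x 1 = (multivariateGaussian m S).withDensity fun y =>
      ENNReal.ofReal (Real.exp ((quad S⁻¹ (y - m) + Real.log S.det - ‖y - x‖ ^ 2) / 2)) := by
  have hc := gaussConst_pos d
  rw [multivariateGaussian_eq_withDensity m hS, multivariateGaussian_eq_withDensity x posDef_one,
    ← withDensity_mul _ (by fun_prop) (by fun_prop)]
  congr 1
  ext y
  rw [Pi.mul_apply, ← ENNReal.ofReal_mul (by positivity), mul_assoc, ← Real.exp_add, inv_one,
    quad_one, Matrix.det_one, Real.log_one]
  congr 3
  ring

lemma integrable_norm_sq_stdGaussian (d : ℕ) :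
    Integrable (fun z : E d => ‖z‖ ^ 2) (stdGaussian (E d)) := by
  simpa using (IsGaussian.memLp_two_id (μ := stdGaussian (E d))).integrable_norm_pow two_ne_zero

lemma integrable_inner_mul_inner (u v : E d) :
    Integrable (fun z : E d => inner ℝ u z * inner ℝ v z) (stdGaussian (E d)) := by
  refine ((integrable_norm_sq_stdGaussian d).const_mul (‖u‖ * ‖v‖)).mono' (by fun_prop)
    (ae_of_all _ fun z => ?_)
  rw [norm_mul]
  calc ‖inner ℝ u z‖ * ‖inner ℝ v z‖ ≤ (‖u‖ * ‖z‖) * (‖v‖ * ‖z‖) := by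
        gcongr <;> exact norm_inner_le_norm _ _
    _ = _ := by ring

lemma integral_inner_mul_inner (u v : E d) :
    ∫ z, inner ℝ u z * inner ℝ v z ∂(stdGaussian (E d)) = inner ℝ u v := by
  have h := covarianceBilin_apply (μ := stdGaussian (E d)) IsGaussian.memLp_two_id u v
  rw [covarianceBilin_stdGaussian] at h
  simp only [id_eq, integral_id_stdGaussian, sub_zero] at h
  exact h.symm

lemma integrable_inner_stdGaussian (u : E d) :
    Integrable (fun z : E d => inner ℝ u z) (stdGaussian (E d)) :=
  (IsGaussian.integrable_id (μ := stdGaussian (E d))).const_inner u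

lemma integral_inner_stdGaussian (u : E d) : ∫ z, inner ℝ u z ∂(stdGaussian (E d)) = 0 := by
  have := integral_inner (𝕜 := ℝ) (IsGaussian.integrable_id (μ := stdGaussian (E d))) u
  simp only [id_eq, integral_id_stdGaussian, inner_zero_right] at this
  exact this

lemma integrable_coord_mul (w : E d) (i j : Fin d) :
    Integrable (fun z : E d => (z i + w i) * (z j + w j)) (stdGaussian (E d)) := by
  have hi := integrable_inner_stdGaussian (EuclideanSpace.single i (1 : ℝ))
  have hj := integrable_inner_stdGaussian (EuclideanSpace.single j (1 : ℝ))
  have hij := integrable_inner_mul_inner (EuclideanSpace.single i (1 : ℝ))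
    (EuclideanSpace.single j (1 : ℝ))
  simp only [EuclideanSpace.inner_single_left, map_one, one_mul] at hi hj hij
  refine (((hij.add (hi.mul_const (w j))).add (hj.const_mul (w i))).add
    (integrable_const (w i * w j))).congr (ae_of_all _ fun z => ?_)
  simp only [Pi.add_apply]
  ring

lemma integral_coord_mul (w : E d) (i j : Fin d) :
    ∫ z : E d, (z i + w i) * (z j + w j) ∂(stdGaussian (E d)) =
      (1 : Matrix (Fin d) (Fin d) ℝ) i j + w i * w j := by
  have hi := integrable_inner_stdGaussian (EuclideanSpace.single i (1 : ℝ))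
  have hj := integrable_inner_stdGaussian (EuclideanSpace.single j (1 : ℝ))
  have hij := integrable_inner_mul_inner (EuclideanSpace.single i (1 : ℝ))
    (EuclideanSpace.single j (1 : ℝ))
  have ei := integral_inner_stdGaussian (EuclideanSpace.single i (1 : ℝ))
  have ej := integral_inner_stdGaussian (EuclideanSpace.single j (1 : ℝ))
  have eij := integral_inner_mul_inner (EuclideanSpace.single i (1 : ℝ))
    (EuclideanSpace.single j (1 : ℝ))
  simp only [EuclideanSpace.inner_single_left, map_one, one_mul] at hi hj hij ei ej eij
  have e : ∀ z : E d, (z i + w i) * (z j + w j) =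
      z i * z j + z i * w j + w i * z j + w i * w j := fun z => by ring
  simp_rw [e]
  rw [integral_add ((hij.fun_add (hi.mul_const _)).fun_add (hj.const_mul _)) (integrable_const _),
    integral_add (hij.fun_add (hi.mul_const _)) (hj.const_mul _), integral_add hij (hi.mul_const _),
    integral_mul_const, integral_const_mul, ei, ej, eij]
  simp [Matrix.one_apply]

lemma integrable_quad (P : Matrix (Fin d) (Fin d) ℝ) (w : E d) :
    Integrable (fun z => quad P (z + w)) (stdGaussian (E d)) := by
  simp_rw [quad_eq_sum]
  exact integrable_finsetSum _ fun i _ => integrable_finsetSum _ fun j _ =>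
    (integrable_coord_mul w i j).const_mul _

lemma integral_quad (P : Matrix (Fin d) (Fin d) ℝ) (w : E d) :
    ∫ z, quad P (z + w) ∂(stdGaussian (E d)) = P.trace + quad P w := by
  simp_rw [quad_eq_sum]
  have hI : ∀ i j, Integrable (fun z : E d => P i j * ((z + w) i * (z + w) j))
      (stdGaussian (E d)) := fun i j => (integrable_coord_mul w i j).const_mul _
  rw [integral_finsetSum _ fun i _ => integrable_finsetSum _ fun j _ => hI i j]
  simp_rw [integral_finsetSum _ fun j _ => hI _ j, integral_const_mul, PiLp.add_apply,
    integral_coord_mul, mul_add, Finset.sum_add_distrib]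
  simp [Matrix.one_apply, Matrix.trace]

lemma multivariateGaussian_one (x : E d) :
    multivariateGaussian x 1 = (stdGaussian (E d)).map fun z => z + x := by
  unfold multivariateGaussian
  simp [add_comm x]

/-- The divergence between an isotropic Gaussian law and a nondegenerate Gaussian law. -/
lemma klDiv_multivariateGaussian (x m : E d) {S : Matrix (Fin d) (Fin d) ℝ} (hS : S.PosDef) :
    InformationTheory.klDiv (multivariateGaussian x 1) (multivariateGaussian m S) =
      ENNReal.ofReal ((S⁻¹.trace + quad S⁻¹ (x - m) + Real.log S.det - d) / 2) := by
  have hq : ∀ z : E d, quad S⁻¹ (z + x - m) = quad S⁻¹ (z + (x - m)) := fun z => by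
    rw [add_sub_assoc]
  have hI : Integrable (fun z => (quad S⁻¹ (z + x - m) + Real.log S.det - ‖z + x - x‖ ^ 2) / 2)
      (stdGaussian (E d)) := by
    simp_rw [hq, add_sub_cancel_right]
    exact (((integrable_quad _ _).add (integrable_const _)).sub
      (integrable_norm_sq_stdGaussian d)).div_const _
  rw [klDiv_withDensity_exp _ _ (by fun_prop)
    (multivariateGaussian_eq_withDensity_multivariateGaussian x m hS)]
  · congr 1
    rw [multivariateGaussian_one, integral_map (by fun_prop) (by fun_prop)]
    have h1 : ∫ z : E d, ‖z‖ ^ 2 ∂(stdGaussian (E d)) = d := by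
      have := integral_quad (1 : Matrix (Fin d) (Fin d) ℝ) (0 : E d)
      simpa [quad_one] using this
    simp_rw [hq, add_sub_cancel_right]
    rw [integral_div, integral_sub ((integrable_quad _ _).fun_add (integrable_const _))
      (integrable_norm_sq_stdGaussian d), integral_add (integrable_quad _ _) (integrable_const _),
      integral_quad, h1]
    simp
  · rw [multivariateGaussian_one, integrable_map_measure (by fun_prop) (by fun_prop)]
    exact hI

/-- A degenerate Gaussian law is carried by a proper affine subspace, which is a null set of any
nondegenerate one. -/
lemma klDiv_multivariateGaussian_of_not_posDef (x m : E d) {S : Matrix (Fin d) (Fin d) ℝ}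
    (hS : S.PosSemidef) (hS' : ¬ S.PosDef) :
    InformationTheory.klDiv (multivariateGaussian x 1) (multivariateGaussian m S) = ∞ := by
  refine InformationTheory.klDiv_of_not_ac fun hac => ?_
  set A := Matrix.toEuclideanCLM (𝕜 := ℝ) (CFC.sqrt S) with hA
  let W : Submodule ℝ (E d) := LinearMap.range (A : E d →ₗ[ℝ] E d)
  have hW : W ≠ ⊤ := by
    intro h
    have hu : ¬ IsUnit (CFC.sqrt S) := by
      rwa [CFC.isUnit_sqrt_iff S hS.nonneg, ← hS.posDef_iff_isUnit]
    apply hu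
    rw [Matrix.isUnit_iff_isUnit_det, ← det_toEuclideanCLM]
    exact LinearEquiv.isUnit_det' (LinearEquiv.ofBijective (A : E d →ₗ[ℝ] E d)
      ⟨LinearMap.injective_iff_surjective.2 (LinearMap.range_eq_top.1 h),
        LinearMap.range_eq_top.1 h⟩)
  have hWm : MeasurableSet {y : E d | y - m ∈ W} :=
    (W.closed_of_finiteDimensional.preimage (by fun_prop : Continuous fun y : E d => y - m)
      ).measurableSet
  have h0 : volume {y : E d | y - m ∈ W} = 0 := by
    have h := (measurePreserving_sub_right (volume : Measure (E d)) m).measure_preimage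
      W.closed_of_finiteDimensional.measurableSet.nullMeasurableSet
    exact h.trans (Measure.addHaar_submodule volume W hW)
  have h1 : multivariateGaussian x 1 {y : E d | y - m ∈ W} = 0 := by
    rw [multivariateGaussian_eq_withDensity x posDef_one]
    exact withDensity_absolutelyContinuous _ _ h0
  have h2 : multivariateGaussian m S {y : E d | y - m ∈ W}ᶜ = 0 := by
    unfold multivariateGaussian
    rw [Measure.map_apply (by fun_prop) hWm.compl]
    convert measure_empty (μ := stdGaussian (E d))
    ext z
    simp only [Set.mem_preimage, Set.mem_compl_iff, Set.mem_ofPred_eq, add_sub_cancel_left,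
      Set.mem_empty_iff_false, iff_false, not_not]
    exact ⟨z, rfl⟩
  have h3 := hac h2
  have h4 := measure_add_measure_compl (μ := multivariateGaussian x 1) hWm
  rw [h1, h3, measure_univ] at h4
  simp at h4

/-- Gaussian laws are stable under similarities. -/
lemma map_affine_multivariateGaussian (c m : E d) {r : ℝ} (hr : 0 ≤ r)
    {S : Matrix (Fin d) (Fin d) ℝ} (hS : S.PosSemidef) :
    (multivariateGaussian m S).map (fun y => c + r • y) =
      multivariateGaussian (c + r • m) (r ^ 2 • S) := by
  have hs : CFC.sqrt (r ^ 2 • S) = r • CFC.sqrt S := by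
    refine CFC.sqrt_unique ?_ (smul_nonneg hr (CFC.sqrt_nonneg S))
    rw [smul_mul_smul_comm, CFC.sqrt_mul_sqrt_self S hS.nonneg, sq]
  unfold multivariateGaussian
  rw [Measure.map_map (by fun_prop) (by fun_prop), hs]
  congr 1
  ext z
  simp [smul_add, add_assoc]

end GaussianDensity

/-! ### Log-determinant inequalities -/

section LogDet

open scoped MatrixOrder

variable {d : ℕ}

lemma log_one_add_le {x : ℝ} (hx : 0 ≤ x) : Real.log (1 + x) ≤ x - x ^ 2 / 2 + x ^ 3 / 3 := by
  have hd : ∀ y ∈ interior (Set.Ici (0 : ℝ)), HasDerivWithinAt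
      (fun y => y - y ^ 2 / 2 + y ^ 3 / 3 - Real.log (1 + y)) (1 - y + y ^ 2 - 1 / (1 + y))
      (interior (Set.Ici 0)) y := by
    intro y hy
    rw [interior_Ici, Set.mem_Ioi] at hy
    have h1 : HasDerivAt (fun y : ℝ => y - y ^ 2 / 2 + y ^ 3 / 3)
        (1 - (2 : ℕ) * y ^ 1 * 1 / 2 + (3 : ℕ) * y ^ 2 * 1 / 3) y :=
      ((hasDerivAt_id' y).sub (((hasDerivAt_id' y).pow 2).div_const 2)).add
        (((hasDerivAt_id' y).pow 3).div_const 3)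
    have h2 : HasDerivAt (fun y : ℝ => Real.log (1 + y)) (1 / (1 + y)) y :=
      ((hasDerivAt_id' y).const_add 1).log (by positivity)
    refine ((h1.sub h2).congr_deriv ?_).hasDerivWithinAt
    push_cast
    ring
  have hm : MonotoneOn (fun y => y - y ^ 2 / 2 + y ^ 3 / 3 - Real.log (1 + y)) (Set.Ici (0 : ℝ)) := by
    refine monotoneOn_of_hasDerivWithinAt_nonneg (convex_Ici 0) ?_ hd ?_
    · refine ContinuousOn.sub (by fun_prop) (ContinuousOn.log (by fun_prop) fun y hy => ?_)
      have : (0 : ℝ) ≤ y := hy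
      positivity
    · intro y hy
      rw [interior_Ici, Set.mem_Ioi] at hy
      have : 1 - y + y ^ 2 - 1 / (1 + y) = y ^ 3 / (1 + y) := by field_simp; ring
      rw [this]
      positivity
  have := hm (Set.self_mem_Ici) (Set.mem_Ici.2 hx) hx
  simp only [ne_eq, OfNat.ofNat_ne_zero, not_false_eq_true, zero_pow, zero_div, sub_zero, add_zero,
    Real.log_one] at this
  linarith

lemma log_det_le_trace_sub {N : Matrix (Fin d) (Fin d) ℝ} (hN : N.PosDef) :
    Real.log N.det ≤ N.trace - d := by
  rw [hN.isHermitian.det_eq_prod_eigenvalues, hN.isHermitian.trace_eq_sum_eigenvalues]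
  simp only [RCLike.ofReal_real_eq_id, id_eq]
  rw [Real.log_prod fun i _ => (hN.eigenvalues_pos i).ne']
  calc ∑ i, Real.log (hN.isHermitian.eigenvalues i)
      ≤ ∑ i, (hN.isHermitian.eigenvalues i - 1) :=
        Finset.sum_le_sum fun i _ => Real.log_le_sub_one_of_pos (hN.eigenvalues_pos i)
    _ = _ := by simp

/-- Among all covariance matrices `S`, the Gaussian cross entropy `tr (S⁻¹ V) + log det S` is
minimal at `S = V`. -/
lemma log_det_le_trace_inv_mul {S V : Matrix (Fin d) (Fin d) ℝ} (hS : S.PosDef) (hV : V.PosDef) :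
    Real.log V.det ≤ (S⁻¹ * V).trace + Real.log S.det - d := by
  set B := CFC.sqrt S⁻¹
  have hBB : B * B = S⁻¹ := CFC.sqrt_mul_sqrt_self _ hS.inv.posSemidef.nonneg
  have hBu : IsUnit B := isUnit_sqrt hS.inv
  have hBH : B.conjTranspose = B := (CFC.sqrt_nonneg S⁻¹).isSelfAdjoint
  have hN : (B * V * B).PosDef := by
    have := hV.conjTranspose_mul_mul_same (B := B) (Matrix.mulVec_injective_of_isUnit hBu)
    rwa [hBH] at this
  have h := log_det_le_trace_sub hN
  have ht : (B * V * B).trace = (S⁻¹ * V).trace := by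
    rw [Matrix.trace_mul_comm, ← mul_assoc, hBB]
  have hdet : (B * V * B).det = S.det⁻¹ * V.det := by
    have : (B * V * B).det = (B * B).det * V.det := by
      rw [Matrix.det_mul, Matrix.det_mul, Matrix.det_mul]; ring
    rw [this, hBB, Matrix.det_nonsing_inv, Ring.inverse_eq_inv']
  rw [ht, hdet, Real.log_mul (inv_ne_zero hS.det_pos.ne') hV.det_pos.ne', Real.log_inv] at h
  linarith

/-- The third order upper bound for `log det (1 + C)`, with `tr C³` replaced by `(tr C)³`. -/
lemma log_det_one_add_le {C : Matrix (Fin d) (Fin d) ℝ} (hC : C.PosSemidef) :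
    Real.log (1 + C).det ≤ C.trace - (C * C).trace / 2 + C.trace ^ 3 / 3 := by
  set l := hC.isHermitian.eigenvalues with hl
  have hl0 : ∀ i, 0 ≤ l i := hC.eigenvalues_nonneg
  have h1 : C.trace = ∑ i, l i := by
    rw [hC.isHermitian.trace_eq_sum_eigenvalues]; simp [hl]
  have h2 : (C * C).trace = ∑ i, l i ^ 2 := by
    set φ := Unitary.conjStarAlgAut ℝ (Matrix (Fin d) (Fin d) ℝ) hC.isHermitian.eigenvectorUnitary
      with hφ
    have hs : C = φ (Matrix.diagonal l) := hC.isHermitian.spectral_theorem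
    rw [hs, ← map_mul, Matrix.diagonal_mul_diagonal, hφ, Unitary.conjStarAlgAut_apply,
      Matrix.trace_mul_comm, ← mul_assoc, Unitary.coe_star_mul_self, one_mul,
      Matrix.trace_diagonal]
    exact Finset.sum_congr rfl fun i _ => (sq _).symm
  have h3 : (1 + C).det = ∏ i, (1 + l i) := by
    have hp := congrArg (Polynomial.eval (-1 : ℝ)) hC.isHermitian.charpoly_eq
    rw [Matrix.eval_charpoly, Polynomial.eval_prod] at hp
    have e1 : Matrix.scalar (Fin d) (-1 : ℝ) - C = -(1 + C) := by
      rw [map_neg, map_one]; abel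
    have e2 : ∀ i, Polynomial.eval (-1 : ℝ) (Polynomial.X - Polynomial.C
        ((hC.isHermitian.eigenvalues i : ℝ) : ℝ)) = -(1 + l i) := by
      intro i; simp [hl]; ring
    rw [e1, Matrix.det_neg] at hp
    simp only [RCLike.ofReal_real_eq_id, id_eq] at hp
    rw [Finset.prod_congr rfl fun i _ => e2 i, Finset.prod_neg] at hp
    simp only [Fintype.card_fin, Finset.card_univ] at hp
    exact mul_left_cancel₀ (pow_ne_zero _ (by norm_num)) hp
  have h4 : ∑ i, l i ^ 3 ≤ (∑ i, l i) ^ 3 := by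
    have hs : ∀ i, l i ≤ ∑ j, l j := fun i =>
      Finset.single_le_sum (fun j _ => hl0 j) (Finset.mem_univ i)
    calc ∑ i, l i ^ 3 = ∑ i, l i * l i ^ 2 := Finset.sum_congr rfl fun i _ => by ring
      _ ≤ ∑ i, l i * (∑ j, l j) ^ 2 := Finset.sum_le_sum fun i _ =>
          mul_le_mul_of_nonneg_left (pow_le_pow_left₀ (hl0 i) (hs i) 2) (hl0 i)
      _ = _ := by rw [← Finset.sum_mul]; ring
  rw [h1, h2, h3, Real.log_prod fun i _ => by have := hl0 i; positivity]
  calc ∑ i, Real.log (1 + l i) ≤ ∑ i, (l i - l i ^ 2 / 2 + l i ^ 3 / 3) :=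
        Finset.sum_le_sum fun i _ => log_one_add_le (hl0 i)
    _ = ∑ i, l i - (∑ i, l i ^ 2) / 2 + (∑ i, l i ^ 3) / 3 := by
        rw [Finset.sum_add_distrib, Finset.sum_sub_distrib, Finset.sum_div, Finset.sum_div]
    _ ≤ _ := by linarith

end LogDet

/-! ### Exponential tilts by Gaussian observations -/

section Tilt

variable {d : ℕ}

/-- The exponent `⟨x, y⟩ - s ‖x‖² / 2`: the log-likelihood ratio of observing `y = s x + √s z`
instead of `y = √s z`, where `z` is a standard Gaussian vector. -/
noncomputable def pot (s : ℝ) (y x : E d) : ℝ := inner ℝ x y - s * ‖x‖ ^ 2 / 2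

/-- The posterior law of a point `x` with prior `μ` given the Gaussian observation `y = s x + √s z` at
signal-to-noise ratio `s`. -/
noncomputable def tilt (μ : Measure (E d)) (s : ℝ) (y : E d) : Measure (E d) := μ.tilted (pot s y)

/-- The unnormalised posterior mean of `w`. -/
noncomputable def tiltInt (μ : Measure (E d)) (w : E d → ℝ) (s : ℝ) (y : E d) : ℝ :=
  ∫ x, w x * Real.exp (pot s y x) ∂μ

/-- The likelihood ratio of the observation `y`, i.e. the normalising constant of `tilt μ s y`. -/
noncomputable def partFun (μ : Measure (E d)) (s : ℝ) (y : E d) : ℝ :=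
  ∫ x, Real.exp (pot s y x) ∂μ

lemma continuous_pot (s : ℝ) : Continuous fun p : E d × E d => pot s p.1 p.2 := by
  unfold pot; fun_prop

@[fun_prop]
lemma continuous_pot_right (s : ℝ) (y : E d) : Continuous (pot s y) := by
  unfold pot; fun_prop

lemma pot_add (s h : ℝ) (y y' x : E d) : pot (s + h) (y + y') x = pot s y x + pot h y' x := by
  simp only [pot, inner_add_right]; ring

lemma abs_pot_le {s B : ℝ} (hs : 0 ≤ s) {x : E d} (hx : ‖x‖ ≤ B) (y : E d) :
    |pot s y x| ≤ B * ‖y‖ + s * B ^ 2 / 2 := by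
  unfold pot
  have h1 := abs_real_inner_le_norm x y
  have h2 : ‖x‖ * ‖y‖ ≤ B * ‖y‖ := by gcongr
  have h3 : s * ‖x‖ ^ 2 / 2 ≤ s * B ^ 2 / 2 := by gcongr
  have h4 : 0 ≤ s * ‖x‖ ^ 2 / 2 := by positivity
  calc |inner ℝ x y - s * ‖x‖ ^ 2 / 2| ≤ |inner ℝ x y| + |s * ‖x‖ ^ 2 / 2| := abs_sub _ _
    _ ≤ _ := by rw [abs_of_nonneg h4]; linarith

lemma partFun_eq (μ : Measure (E d)) (s : ℝ) (y : E d) :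
    partFun μ s y = tiltInt μ (fun _ => 1) s y := by simp [partFun, tiltInt]

lemma integrable_of_abs_le {μ : Measure (E d)} [IsFiniteMeasure μ] {w : E d → ℝ}
    (hw : Measurable w) {W : ℝ} (hW : ∀ᵐ x ∂μ, |w x| ≤ W) : Integrable w μ :=
  Integrable.of_bound hw.aestronglyMeasurable W hW

/-- The Cauchy-Schwarz inequality for bounded functions. -/
lemma integral_sq_mul_le {μ : Measure (E d)} [IsFiniteMeasure μ] {u v : E d → ℝ}
    (hu : Measurable u) (hv : Measurable v) {U V : ℝ} (hU : ∀ᵐ x ∂μ, |u x| ≤ U)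
    (hV : ∀ᵐ x ∂μ, |v x| ≤ V) :
    (∫ x, u x * v x ∂μ) ^ 2 ≤ (∫ x, u x ^ 2 ∂μ) * ∫ x, v x ^ 2 ∂μ := by
  have hbd : ∀ {f g : E d → ℝ} {F G : ℝ}, Measurable f → Measurable g →
      (∀ᵐ x ∂μ, |f x| ≤ F) → (∀ᵐ x ∂μ, |g x| ≤ G) → Integrable (fun x => f x * g x) μ := by
    intro f g F G hf hg hF hG
    refine integrable_of_abs_le (hf.mul hg) (W := F * G) ?_
    filter_upwards [hF, hG] with x h1 h2
    rw [abs_mul]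
    exact mul_le_mul h1 h2 (abs_nonneg _) ((abs_nonneg _).trans h1)
  have h := discrim_le_zero (a := ∫ x, v x * v x ∂μ) (b := 2 * ∫ x, u x * v x ∂μ)
    (c := ∫ x, u x * u x ∂μ) fun t => by
      have e : ∫ x, (t * v x + u x) ^ 2 ∂μ = (∫ x, v x * v x ∂μ) * (t * t) +
          2 * (∫ x, u x * v x ∂μ) * t + ∫ x, u x * u x ∂μ := by
        have : ∀ x, (t * v x + u x) ^ 2 =
          (t * t) * (v x * v x) + (2 * t) * (u x * v x) + u x * u x := fun x => by ring
        simp_rw [this]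
        rw [integral_add (((hbd hv hv hV hV).const_mul _).fun_add ((hbd hu hv hU hV).const_mul _))
          (hbd hu hu hU hU), integral_add ((hbd hv hv hV hV).const_mul _)
          ((hbd hu hv hU hV).const_mul _), integral_const_mul, integral_const_mul]
        ring
      rw [← e]
      exact integral_nonneg fun x => sq_nonneg _
  simp only [discrim, ← sq] at h
  nlinarith

lemma integrable_exp_mul_norm (c : ℝ) :
    Integrable (fun z : E d => Real.exp (c * ‖z‖)) (stdGaussian (E d)) := by
  obtain ⟨C, hC, hi⟩ := IsGaussian.exists_integrable_exp_sq (stdGaussian (E d))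
  refine (hi.const_mul (Real.exp (c ^ 2 / (4 * C)))).mono' (by fun_prop) (ae_of_all _ fun z => ?_)
  rw [Real.norm_eq_abs, Real.abs_exp, ← Real.exp_add]
  refine Real.exp_le_exp.2 ?_
  have h : c ^ 2 / (4 * C) + C * ‖z‖ ^ 2 - c * ‖z‖ = (c - 2 * C * ‖z‖) ^ 2 / (4 * C) := by
    field_simp; ring
  have : 0 ≤ (c - 2 * C * ‖z‖) ^ 2 / (4 * C) := by positivity
  linarith

lemma integrable_of_abs_le_exp {f : E d → ℝ} (hf : Measurable f) (C c b : ℝ)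
    (h : ∀ z, |f z| ≤ C * Real.exp (c * ‖z‖ + b)) : Integrable f (stdGaussian (E d)) := by
  refine ((integrable_exp_mul_norm c).const_mul (C * Real.exp b)).mono' hf.aestronglyMeasurable
    (ae_of_all _ fun z => (h z).trans_eq ?_)
  rw [Real.exp_add]; ring

lemma integral_exp_inner_sub (u : E d) :
    ∫ z, Real.exp (inner ℝ u z - ‖u‖ ^ 2 / 2) ∂(stdGaussian (E d)) = 1 := by
  have h := congrArg (fun μ : Measure (E d) => μ Set.univ)
    (multivariateGaussian_eq_withDensity_multivariateGaussian u 0 posDef_one)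
  simp only [measure_univ, multivariateGaussian_zero_one, withDensity_apply _ MeasurableSet.univ,
    Measure.restrict_univ] at h
  rw [integral_eq_lintegral_of_nonneg_ae (ae_of_all _ fun _ => (Real.exp_pos _).le) (by fun_prop)]
  rw [← ENNReal.toReal_one, h]
  congr 2
  ext z
  congr 2
  rw [inv_one, quad_one, Matrix.det_one, Real.log_one, sub_zero, norm_sub_sq_real,
    real_inner_comm z u]
  ring

lemma integral_exp_pot {s : ℝ} (hs : 0 ≤ s) (x : E d) :
    ∫ z, Real.exp (pot s (√s • z) x) ∂(stdGaussian (E d)) = 1 := by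
  rw [← integral_exp_inner_sub (√s • x)]
  refine integral_congr_ae (ae_of_all _ fun z => ?_)
  simp only [pot, inner_smul_right, inner_smul_left, norm_smul, mul_pow, Real.norm_eq_abs, sq_abs,
    Real.sq_sqrt hs]
  rfl

lemma ae_tilt {μ : Measure (E d)} {p : E d → Prop} (h : ∀ᵐ x ∂μ, p x) (s : ℝ) (y : E d) :
    ∀ᵐ x ∂(tilt μ s y), p x :=
  (tilted_absolutelyContinuous μ _).ae_le h

lemma integral_tilt (μ : Measure (E d)) (w : E d → ℝ) (s : ℝ) (y : E d) :
    ∫ x, w x ∂(tilt μ s y) = tiltInt μ w s y / partFun μ s y := by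
  rw [tilt, integral_tilted, tiltInt, ← integral_div]
  refine integral_congr_ae (ae_of_all _ fun x => ?_)
  simp only [smul_eq_mul, partFun]
  ring

variable {μ : Measure (E d)} [IsProbabilityMeasure μ] {B : ℝ} {s : ℝ}

lemma measurable_tiltInt {w : E d → ℝ} (hw : Measurable w) (s : ℝ) :
    Measurable (tiltInt μ w s) := by
  have h : StronglyMeasurable (Function.uncurry fun y x : E d => w x * Real.exp (pot s y x)) :=
    ((hw.comp measurable_snd).mul
      (Real.measurable_exp.comp (continuous_pot s).measurable)).stronglyMeasurable
  exact (h.integral_prod_right (ν := μ)).measurable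

@[fun_prop]
lemma measurable_partFun (s : ℝ) : Measurable (partFun μ s) := by
  have : partFun μ s = tiltInt μ (fun _ => 1) s := funext (partFun_eq μ s)
  rw [this]
  exact measurable_tiltInt measurable_const s

lemma integrable_exp_pot (hB : ∀ᵐ x ∂μ, ‖x‖ ≤ B) (hs : 0 ≤ s) (y : E d) :
    Integrable (fun x => Real.exp (pot s y x)) μ := by
  refine integrable_of_abs_le (by fun_prop) (W := Real.exp (B * ‖y‖ + s * B ^ 2 / 2)) ?_
  filter_upwards [hB] with x hx
  rw [Real.abs_exp]
  exact Real.exp_le_exp.2 ((le_abs_self _).trans (abs_pot_le hs hx y))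

lemma integrable_mul_exp_pot (hB : ∀ᵐ x ∂μ, ‖x‖ ≤ B) (hs : 0 ≤ s) (y : E d) {w : E d → ℝ}
    (hw : Measurable w) {W : ℝ} (hW : ∀ᵐ x ∂μ, |w x| ≤ W) :
    Integrable (fun x => w x * Real.exp (pot s y x)) μ :=
  (integrable_exp_pot hB hs y).bdd_mul (c := W) hw.aestronglyMeasurable hW

lemma partFun_pos (hB : ∀ᵐ x ∂μ, ‖x‖ ≤ B) (hs : 0 ≤ s) (y : E d) : 0 < partFun μ s y :=
  integral_exp_pos (integrable_exp_pot hB hs y)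

lemma exp_neg_le_partFun (hB : ∀ᵐ x ∂μ, ‖x‖ ≤ B) (hs : 0 ≤ s) (y : E d) :
    Real.exp (-(B * ‖y‖ + s * B ^ 2 / 2)) ≤ partFun μ s y := by
  have h : ∫ _ : E d, Real.exp (-(B * ‖y‖ + s * B ^ 2 / 2)) ∂μ ≤ partFun μ s y := by
    refine integral_mono_ae (integrable_const _) (integrable_exp_pot hB hs y) ?_
    filter_upwards [hB] with x hx
    exact Real.exp_le_exp.2 (neg_le_of_abs_le (abs_pot_le hs hx y))
  simpa using h

lemma partFun_le_exp (hB : ∀ᵐ x ∂μ, ‖x‖ ≤ B) (hs : 0 ≤ s) (y : E d) :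
    partFun μ s y ≤ Real.exp (B * ‖y‖ + s * B ^ 2 / 2) := by
  have h : partFun μ s y ≤ ∫ _ : E d, Real.exp (B * ‖y‖ + s * B ^ 2 / 2) ∂μ := by
    refine integral_mono_ae (integrable_exp_pot hB hs y) (integrable_const _) ?_
    filter_upwards [hB] with x hx
    exact Real.exp_le_exp.2 ((le_abs_self _).trans (abs_pot_le hs hx y))
  simpa using h

lemma isProbabilityMeasure_tilt (hB : ∀ᵐ x ∂μ, ‖x‖ ≤ B) (hs : 0 ≤ s) (y : E d) :
    IsProbabilityMeasure (tilt μ s y) :=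
  isProbabilityMeasure_tilted (integrable_exp_pot hB hs y)

lemma partFun_mul_integral_tilt (hB : ∀ᵐ x ∂μ, ‖x‖ ≤ B) (hs : 0 ≤ s) (w : E d → ℝ) (y : E d) :
    partFun μ s y * ∫ x, w x ∂(tilt μ s y) = tiltInt μ w s y := by
  rw [integral_tilt, mul_div_cancel₀ _ (partFun_pos hB hs y).ne']

lemma measurable_integral_tilt {w : E d → ℝ} (hw : Measurable w) (s : ℝ) :
    Measurable fun y => ∫ x, w x ∂(tilt μ s y) := by
  simp_rw [integral_tilt]
  exact (measurable_tiltInt hw s).div (measurable_partFun s)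

/-- Successive observations: the signal-to-noise ratios and the observed vectors add up. -/
lemma tilt_tilt (hB : ∀ᵐ x ∂μ, ‖x‖ ≤ B) (hs : 0 ≤ s) (h : ℝ) (y y' : E d) :
    tilt (tilt μ s y) h y' = tilt μ (s + h) (y + y') := by
  rw [tilt, tilt, tilted_tilted (integrable_exp_pot hB hs y), tilt]
  congr 1
  ext x
  exact (pot_add s h y y' x).symm

lemma partFun_add (hB : ∀ᵐ x ∂μ, ‖x‖ ≤ B) (hs : 0 ≤ s) (h : ℝ) (y y' : E d) :
    partFun μ (s + h) (y + y') = partFun μ s y * partFun (tilt μ s y) h y' := by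
  have e := partFun_mul_integral_tilt hB hs (fun x => Real.exp (pot h y' x)) y
  rw [show partFun (tilt μ s y) h y' = ∫ x, Real.exp (pot h y' x) ∂(tilt μ s y) from rfl, e,
    partFun, tiltInt]
  refine integral_congr_ae (ae_of_all _ fun x => ?_)
  simp only [pot_add, Real.exp_add]
  ring

lemma partFun_zero : partFun μ 0 0 = 1 := by simp [partFun, pot]

lemma tilt_zero : tilt μ 0 0 = μ := by
  have : pot (d := d) 0 0 = 0 := by ext x; simp [pot]
  rw [tilt, this, tilted_zero]

/-- The posterior mean of `w`, weighted by the likelihood ratio, averages to the prior mean. -/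
lemma integral_tiltInt (hB : ∀ᵐ x ∂μ, ‖x‖ ≤ B) (hs : 0 ≤ s) {w : E d → ℝ}
    (hw : Measurable w) {W : ℝ} (hW : ∀ᵐ x ∂μ, |w x| ≤ W) :
    ∫ z, tiltInt μ w s (√s • z) ∂(stdGaussian (E d)) = ∫ x, w x ∂μ := by
  have hi : Integrable (Function.uncurry fun (z x : E d) => w x * Real.exp (pot s (√s • z) x))
      ((stdGaussian (E d)).prod μ) := by
    have hb : Integrable (fun z : E d => W * Real.exp (B * √s * ‖z‖ + s * B ^ 2 / 2))
        (stdGaussian (E d)) := by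
      refine integrable_of_abs_le_exp (by fun_prop) |W| (B * √s) (s * B ^ 2 / 2) fun z => ?_
      rw [abs_mul, Real.abs_exp]
    refine (hb.comp_fst μ).mono' ?_ ?_
    · have hp : Continuous fun p : E d × E d => pot s (√s • p.1) p.2 := by unfold pot; fun_prop
      exact ((hw.comp measurable_snd).mul
        (Real.measurable_exp.comp hp.measurable)).aestronglyMeasurable
    · have h2 : ∀ᵐ p ∂((stdGaussian (E d)).prod μ), ‖p.2‖ ≤ B ∧ |w p.2| ≤ W :=
        Measure.quasiMeasurePreserving_snd.ae (hB.and hW)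
      filter_upwards [h2] with p hp
      rw [Function.uncurry_def, norm_mul, Real.norm_eq_abs, Real.norm_eq_abs, Real.abs_exp]
      have h3 := (le_abs_self _).trans (abs_pot_le hs hp.1 (√s • p.1))
      rw [norm_smul, Real.norm_eq_abs, abs_of_nonneg (Real.sqrt_nonneg s), ← mul_assoc] at h3
      exact mul_le_mul hp.2 (Real.exp_le_exp.2 h3) (Real.exp_pos _).le ((abs_nonneg _).trans hp.2)
  simp only [tiltInt]
  rw [integral_integral_swap hi]
  simp_rw [integral_const_mul, integral_exp_pot hs, mul_one]

lemma integral_partFun (hB : ∀ᵐ x ∂μ, ‖x‖ ≤ B) (hs : 0 ≤ s) :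
    ∫ z, partFun μ s (√s • z) ∂(stdGaussian (E d)) = 1 := by
  simp_rw [partFun_eq]
  rw [integral_tiltInt hB hs measurable_const (W := 1) (by simp)]
  simp

lemma integrable_partFun (hB : ∀ᵐ x ∂μ, ‖x‖ ≤ B) (hs : 0 ≤ s) :
    Integrable (fun z => partFun μ s (√s • z)) (stdGaussian (E d)) := by
  refine integrable_of_abs_le_exp (by fun_prop) 1 (B * √s) (s * B ^ 2 / 2) fun z => ?_
  have h := partFun_le_exp hB hs (√s • z)
  rw [norm_smul, Real.norm_eq_abs, abs_of_nonneg (Real.sqrt_nonneg s), ← mul_assoc] at h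
  rwa [abs_of_pos (partFun_pos hB hs _), one_mul]

/-- A Gaussian increment at signal-to-noise ratio `s + h` splits into independent increments. -/
lemma map_prod_stdGaussian {h : ℝ} (hs : 0 ≤ s) (hh : 0 ≤ h) :
    ((stdGaussian (E d)).prod (stdGaussian (E d))).map (fun p => √s • p.1 + √h • p.2) =
      (stdGaussian (E d)).map fun z => √(s + h) • z := by
  have e : ((stdGaussian (E d)).prod (stdGaussian (E d))).map (fun p => √s • p.1 + √h • p.2) =
      ((stdGaussian (E d)).map fun z => √s • z) ∗ ((stdGaussian (E d)).map fun z => √h • z) := by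
    rw [Measure.conv, Measure.map_prod_map _ _ (by fun_prop) (by fun_prop),
      Measure.map_map (by fun_prop) (by fun_prop)]
    rfl
  rw [e]
  have : IsProbabilityMeasure ((stdGaussian (E d)).map fun z => √s • z) :=
    Measure.isProbabilityMeasure_map (by fun_prop)
  have : IsProbabilityMeasure ((stdGaussian (E d)).map fun z => √h • z) :=
    Measure.isProbabilityMeasure_map (by fun_prop)
  have : IsProbabilityMeasure ((stdGaussian (E d)).map fun z => √(s + h) • z) :=
    Measure.isProbabilityMeasure_map (by fun_prop)
  refine Measure.ext_of_charFun ?_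
  ext t
  rw [charFun_conv, charFun_map_smul, charFun_map_smul, charFun_map_smul, charFun_stdGaussian,
    charFun_stdGaussian, charFun_stdGaussian, ← Complex.exp_add]
  congr 1
  simp only [norm_smul, Real.norm_eq_abs, Complex.ofReal_mul, mul_pow]
  simp only [← Complex.ofReal_pow, sq_abs, Real.sq_sqrt hs, Real.sq_sqrt hh,
    Real.sq_sqrt (add_nonneg hs hh)]
  push_cast
  ring

lemma integrable_prod_of_integrable {h : ℝ} (hs : 0 ≤ s) (hh : 0 ≤ h) {H : E d → ℝ}
    (hH : Measurable H) (hi : Integrable (fun z => H (√(s + h) • z)) (stdGaussian (E d))) :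
    Integrable (fun p : E d × E d => H (√s • p.1 + √h • p.2))
      ((stdGaussian (E d)).prod (stdGaussian (E d))) := by
  have h1 : Integrable H ((stdGaussian (E d)).map fun z => √(s + h) • z) :=
    (integrable_map_measure hH.aestronglyMeasurable (by fun_prop)).2 hi
  rw [← map_prod_stdGaussian hs hh, integrable_map_measure hH.aestronglyMeasurable (by fun_prop)]
    at h1
  exact h1

lemma integral_sqrt_add {h : ℝ} (hs : 0 ≤ s) (hh : 0 ≤ h) {H : E d → ℝ}
    (hH : Measurable H) (hi : Integrable (fun z => H (√(s + h) • z)) (stdGaussian (E d))) :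
    ∫ z, H (√(s + h) • z) ∂(stdGaussian (E d)) =
      ∫ z, ∫ z', H (√s • z + √h • z') ∂(stdGaussian (E d)) ∂(stdGaussian (E d)) := by
  rw [← integral_prod _ (integrable_prod_of_integrable hs hh hH hi),
    ← integral_map (φ := fun z : E d => √(s + h) • z) (by fun_prop) hH.aestronglyMeasurable,
    ← map_prod_stdGaussian hs hh, integral_map (by fun_prop) hH.aestronglyMeasurable]

end Tilt

/-! ### Small increments of the signal-to-noise ratio -/

section SmallTime

variable {d : ℕ}

lemma abs_exp_sub_one_le (a : ℝ) : |Real.exp a - 1| ≤ |a| * Real.exp |a| := by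
  have h1 := Real.add_one_le_exp a
  have h2 := Real.add_one_le_exp (-a)
  have h3 : Real.exp a - 1 ≤ a * Real.exp a := by
    have h4 : Real.exp a * (-a + 1) ≤ Real.exp a * Real.exp (-a) :=
      mul_le_mul_of_nonneg_left h2 (Real.exp_pos a).le
    rw [← Real.exp_add, add_neg_cancel, Real.exp_zero] at h4
    linarith
  have h5 : Real.exp a ≤ Real.exp |a| := Real.exp_le_exp.2 (le_abs_self a)
  have h6 : a * Real.exp a ≤ |a| * Real.exp |a| :=
    mul_le_mul (le_abs_self a) h5 (Real.exp_pos a).le (abs_nonneg a)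
  have h7 : |a| ≤ |a| * Real.exp |a| :=
    le_mul_of_one_le_right (abs_nonneg a) (Real.one_le_exp (abs_nonneg a))
  rw [abs_le]
  constructor
  · linarith [neg_abs_le a]
  · linarith

lemma abs_exp_sub_one_sub_le (a : ℝ) : |Real.exp a - 1 - a| ≤ a ^ 2 * Real.exp |a| := by
  have h1 := Real.add_one_le_exp a
  rw [abs_of_nonneg (by linarith)]
  have h2 := Real.add_one_le_exp (-a)
  have h4 : Real.exp a * (-a + 1) ≤ Real.exp a * Real.exp (-a) :=
    mul_le_mul_of_nonneg_left h2 (Real.exp_pos a).le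
  rw [← Real.exp_add, add_neg_cancel, Real.exp_zero] at h4
  calc Real.exp a - 1 - a ≤ a * (Real.exp a - 1) := by linarith
    _ ≤ |a| * |Real.exp a - 1| := by rw [← abs_mul]; exact le_abs_self _
    _ ≤ |a| * (|a| * Real.exp |a|) :=
        mul_le_mul_of_nonneg_left (abs_exp_sub_one_le a) (abs_nonneg a)
    _ = _ := by rw [← mul_assoc, ← sq, sq_abs]

/-- Third order upper bound for `x log x` at `1`. -/
lemma mul_log_le {x : ℝ} (hx : 0 < x) :
    x * Real.log x ≤ (x - 1) + (x - 1) ^ 2 / 2 + |x - 1| ^ 3 / 2 := by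
  rcases le_or_gt 1 x with h | h
  · have h1 := Real.self_le_sinh_iff.2 (Real.log_nonneg h)
    rw [Real.sinh_eq, Real.exp_neg, Real.exp_log hx] at h1
    have h2 : x * Real.log x ≤ x * ((x - x⁻¹) / 2) := mul_le_mul_of_nonneg_left h1 hx.le
    have h3 : x * ((x - x⁻¹) / 2) = (x - 1) + (x - 1) ^ 2 / 2 := by field_simp; ring
    have h4 : 0 ≤ |x - 1| ^ 3 / 2 := by positivity
    linarith
  · have hs := Real.hasSum_pow_div_log_of_abs_lt_one (x := 1 - x)
      (by rw [abs_lt]; constructor <;> linarith)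
    have h1 := sum_le_hasSum (Finset.range 2)
      (fun n _ => div_nonneg (pow_nonneg (by linarith : 0 ≤ 1 - x) _) (by positivity)) hs
    simp only [Finset.sum_range_succ, Finset.sum_range_zero, sub_sub_cancel] at h1
    norm_num at h1
    have h2 : x * Real.log x ≤ x * (-((1 - x) + (1 - x) ^ 2 / 2)) :=
      mul_le_mul_of_nonneg_left (by linarith) hx.le
    rw [abs_sub_comm, abs_of_pos (by linarith : 0 < 1 - x)]
    nlinarith

variable {ν : Measure (E d)} [IsProbabilityMeasure ν] {B : ℝ} {h : ℝ}

/-- For `h ≤ 1` and `‖x‖ ≤ B`, the exponent `pot h (√h • z) x` is at most `√h * growth B z`. -/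
noncomputable def growth (B : ℝ) (z : E d) : ℝ := B * ‖z‖ + B ^ 2 / 2

lemma growth_nonneg (hB0 : 0 ≤ B) (z : E d) : 0 ≤ growth B z := by unfold growth; positivity

lemma abs_pot_sqrt_le (h0 : 0 ≤ h) (h1 : h ≤ 1) {x : E d} (hx : ‖x‖ ≤ B) (z : E d) :
    |pot h (√h • z) x| ≤ √h * growth B z := by
  refine (abs_pot_le h0 hx _).trans ?_
  have hq : √h * √h = h := Real.mul_self_sqrt h0
  have hq1 : √h ≤ 1 := Real.sqrt_le_one.2 h1
  have hq0 := Real.sqrt_nonneg h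
  rw [norm_smul, Real.norm_eq_abs, abs_of_nonneg hq0, growth]
  have : h * B ^ 2 ≤ √h * B ^ 2 := by
    refine mul_le_mul_of_nonneg_right ?_ (sq_nonneg B)
    nlinarith
  linarith

lemma abs_exp_pot_sub_one_le (hB0 : 0 ≤ B) (h0 : 0 ≤ h) (h1 : h ≤ 1) {x : E d} (hx : ‖x‖ ≤ B)
    (z : E d) : |Real.exp (pot h (√h • z) x) - 1| ≤ √h * Real.exp (2 * growth B z) := by
  have hr := growth_nonneg hB0 z
  have ha := abs_pot_sqrt_le h0 h1 hx z
  have hq1 : √h ≤ 1 := Real.sqrt_le_one.2 h1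
  have hq0 := Real.sqrt_nonneg h
  have ha' : |pot h (√h • z) x| ≤ growth B z := ha.trans (mul_le_of_le_one_left hr hq1)
  have hre : growth B z ≤ Real.exp (growth B z) := by linarith [Real.add_one_le_exp (growth B z)]
  calc _ ≤ |pot h (√h • z) x| * Real.exp |pot h (√h • z) x| := abs_exp_sub_one_le _
    _ ≤ (√h * Real.exp (growth B z)) * Real.exp (growth B z) := by
        gcongr
        exact ha.trans (by gcongr)
    _ = _ := by rw [mul_assoc, ← Real.exp_add]; ring_nf

lemma abs_exp_pot_sub_sub_le (hB0 : 0 ≤ B) (h0 : 0 ≤ h) (h1 : h ≤ 1) {x : E d} (hx : ‖x‖ ≤ B)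
    (z : E d) : |Real.exp (pot h (√h • z) x) - 1 - √h * inner ℝ x z| ≤
      2 * h * Real.exp (3 * growth B z) := by
  have hr := growth_nonneg hB0 z
  have ha := abs_pot_sqrt_le h0 h1 hx z
  have hq1 : √h ≤ 1 := Real.sqrt_le_one.2 h1
  have hq0 := Real.sqrt_nonneg h
  have hqq : √h ^ 2 = h := Real.sq_sqrt h0
  have ha' : |pot h (√h • z) x| ≤ growth B z := ha.trans (mul_le_of_le_one_left hr hq1)
  have hre : growth B z ≤ Real.exp (growth B z) := by linarith [Real.add_one_le_exp (growth B z)]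
  have e : Real.exp (pot h (√h • z) x) - 1 - √h * inner ℝ x z =
      (Real.exp (pot h (√h • z) x) - 1 - pot h (√h • z) x) + -(h * ‖x‖ ^ 2 / 2) := by
    rw [pot, inner_smul_right]; ring
  have e1 : |Real.exp (pot h (√h • z) x) - 1 - pot h (√h • z) x| ≤
      h * Real.exp (3 * growth B z) := by
    calc _ ≤ pot h (√h • z) x ^ 2 * Real.exp |pot h (√h • z) x| := abs_exp_sub_one_sub_le _
      _ ≤ (√h * Real.exp (growth B z)) ^ 2 * Real.exp (growth B z) := by
          gcongr ?_ * Real.exp ?_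
          rw [← sq_abs]
          gcongr
          exact ha.trans (by gcongr)
      _ = _ := by
          rw [mul_pow, hqq, mul_assoc, ← Real.exp_nat_mul, ← Real.exp_add]
          push_cast
          ring_nf
  have e2 : |-(h * ‖x‖ ^ 2 / 2)| ≤ h * Real.exp (3 * growth B z) := by
    rw [abs_neg, abs_of_nonneg (by positivity), mul_div_assoc]
    refine mul_le_mul_of_nonneg_left ?_ h0
    have h5 : ‖x‖ ^ 2 / 2 ≤ B ^ 2 / 2 := by gcongr
    have h6 : B ^ 2 / 2 ≤ growth B z := by
      unfold growth
      have : 0 ≤ B * ‖z‖ := by positivity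
      linarith
    have h7 : Real.exp (growth B z) ≤ Real.exp (3 * growth B z) :=
      Real.exp_le_exp.2 (by linarith)
    linarith
  rw [e]
  exact (abs_add_le _ _).trans (by linarith)

section Increment

variable {v : E d → ℝ} {V : ℝ}

/-- The vector `E[v(X) X]`. -/
noncomputable def crossMoment (ν : Measure (E d)) (v : E d → ℝ) : E d := ∫ x, v x • x ∂ν

lemma integrable_smul_self (hB : ∀ᵐ x ∂ν, ‖x‖ ≤ B) (hv : Measurable v)
    (hV : ∀ᵐ x ∂ν, |v x| ≤ V) : Integrable (fun x => v x • x) ν := by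
  refine Integrable.of_bound (hv.aestronglyMeasurable.smul aestronglyMeasurable_id) (V * B) ?_
  filter_upwards [hB, hV] with x h1 h2
  rw [norm_smul]
  exact mul_le_mul h2 h1 (norm_nonneg _) ((abs_nonneg _).trans h2)

lemma norm_crossMoment_le (hB : ∀ᵐ x ∂ν, ‖x‖ ≤ B) (hV : ∀ᵐ x ∂ν, |v x| ≤ V) :
    ‖crossMoment ν v‖ ≤ V * B := by
  have := norm_integral_le_of_norm_le_const (μ := ν) (f := fun x => v x • x) (C := V * B) (by
    filter_upwards [hB, hV] with x h1 h2
    rw [norm_smul]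
    exact mul_le_mul h2 h1 (norm_nonneg _) ((abs_nonneg _).trans h2))
  simpa [crossMoment] using this

lemma tiltInt_sub (hB : ∀ᵐ x ∂ν, ‖x‖ ≤ B) (h0 : 0 ≤ h) (hv : Measurable v)
    (hV : ∀ᵐ x ∂ν, |v x| ≤ V) (z : E d) : tiltInt ν v h (√h • z) - ∫ x, v x ∂ν =
      ∫ x, v x * (Real.exp (pot h (√h • z) x) - 1) ∂ν := by
  rw [tiltInt, ← integral_sub (integrable_mul_exp_pot hB h0 _ hv hV) (integrable_of_abs_le hv hV)]
  simp_rw [mul_sub, mul_one]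

lemma abs_tiltInt_sub_le (hB : ∀ᵐ x ∂ν, ‖x‖ ≤ B) (hB0 : 0 ≤ B) (h0 : 0 ≤ h) (h1 : h ≤ 1)
    (hv : Measurable v) (hV : ∀ᵐ x ∂ν, |v x| ≤ V) (z : E d) :
    |tiltInt ν v h (√h • z) - ∫ x, v x ∂ν| ≤ V * (√h * Real.exp (2 * growth B z)) := by
  rw [tiltInt_sub hB h0 hv hV]
  have := norm_integral_le_of_norm_le_const (μ := ν)
    (f := fun x => v x * (Real.exp (pot h (√h • z) x) - 1))
    (C := V * (√h * Real.exp (2 * growth B z))) (by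
      filter_upwards [hB, hV] with x hx hvx
      rw [norm_mul]
      exact mul_le_mul hvx (abs_exp_pot_sub_one_le hB0 h0 h1 hx z) (norm_nonneg _)
        ((abs_nonneg _).trans hvx))
  simpa using this

lemma abs_tiltInt_sub_sub_le (hB : ∀ᵐ x ∂ν, ‖x‖ ≤ B) (hB0 : 0 ≤ B) (h0 : 0 ≤ h) (h1 : h ≤ 1)
    (hv : Measurable v) (hV : ∀ᵐ x ∂ν, |v x| ≤ V) (z : E d) :
    |tiltInt ν v h (√h • z) - ∫ x, v x ∂ν - √h * inner ℝ (crossMoment ν v) z| ≤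
      V * (2 * h * Real.exp (3 * growth B z)) := by
  have hI := integrable_smul_self hB hv hV
  have e : √h * inner ℝ (crossMoment ν v) z = ∫ x, v x * (√h * inner ℝ x z) ∂ν := by
    rw [crossMoment, real_inner_comm, ← integral_inner hI, ← integral_const_mul]
    refine integral_congr_ae (ae_of_all _ fun x => ?_)
    simp only [inner_smul_right, real_inner_comm z x]
    ring
  have hI2 : Integrable (fun x => v x * (√h * inner ℝ x z)) ν := by
    refine ((hI.const_inner (𝕜 := ℝ) z).const_mul √h).congr (ae_of_all _ fun x => ?_)
    simp only [inner_smul_right, real_inner_comm z x]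
    ring
  have hI1 : Integrable (fun x => v x * (Real.exp (pot h (√h • z) x) - 1)) ν := by
    simp_rw [mul_sub, mul_one]
    exact (integrable_mul_exp_pot hB h0 _ hv hV).sub (integrable_of_abs_le hv hV)
  rw [tiltInt_sub hB h0 hv hV, e, ← integral_sub hI1 hI2]
  have := norm_integral_le_of_norm_le_const (μ := ν)
    (f := fun x => v x * (Real.exp (pot h (√h • z) x) - 1) - v x * (√h * inner ℝ x z))
    (C := V * (2 * h * Real.exp (3 * growth B z))) (by
      filter_upwards [hB, hV] with x hx hvx
      rw [← mul_sub, norm_mul]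
      exact mul_le_mul hvx (abs_exp_pot_sub_sub_le hB0 h0 h1 hx z) (norm_nonneg _)
        ((abs_nonneg _).trans hvx))
  simpa using this

/-- The square of the first order term in the expansion of `tiltInt` has order `h`, and the error is
of order `h^(3/2)`. -/
lemma sq_tiltInt_sub_le (hB : ∀ᵐ x ∂ν, ‖x‖ ≤ B) (hB0 : 0 ≤ B) (h0 : 0 ≤ h) (h1 : h ≤ 1)
    (hv : Measurable v) (hV : ∀ᵐ x ∂ν, |v x| ≤ V) (hV0 : 0 ≤ V) (z : E d) :
    (tiltInt ν v h (√h • z) - ∫ x, v x ∂ν) ^ 2 ≤ h * inner ℝ (crossMoment ν v) z ^ 2 +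
      4 * V ^ 2 * (h * √h) * Real.exp (5 * growth B z) := by
  have e1 := abs_tiltInt_sub_le hB hB0 h0 h1 hv hV z
  have e2 := abs_tiltInt_sub_sub_le hB hB0 h0 h1 hv hV z
  set I := tiltInt ν v h (√h • z) - ∫ x, v x ∂ν
  set G := inner ℝ (crossMoment ν v) z
  have hr := growth_nonneg hB0 z
  have hq0 := Real.sqrt_nonneg h
  have hqq : √h ^ 2 = h := Real.sq_sqrt h0
  have e3 : |√h * G| ≤ V * (√h * Real.exp (2 * growth B z)) := by
    rw [abs_mul, abs_of_nonneg hq0]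
    have h2 : |G| ≤ V * Real.exp (2 * growth B z) := by
      calc |G| ≤ ‖crossMoment ν v‖ * ‖z‖ := abs_real_inner_le_norm _ _
        _ ≤ V * B * ‖z‖ := by gcongr; exact norm_crossMoment_le hB hV
        _ = V * (B * ‖z‖) := by ring
        _ ≤ V * Real.exp (2 * growth B z) := by
            refine mul_le_mul_of_nonneg_left ?_ hV0
            have h3 : B * ‖z‖ ≤ growth B z := by
              unfold growth
              have : 0 ≤ B ^ 2 := sq_nonneg B
              linarith
            linarith [Real.add_one_le_exp (2 * growth B z)]
    calc √h * |G| ≤ √h * (V * Real.exp (2 * growth B z)) := by gcongr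
      _ = _ := by ring
  have e4 : I ^ 2 = h * G ^ 2 + (I - √h * G) * (I + √h * G) := by
    have : h * G ^ 2 = (√h * G) ^ 2 := by rw [mul_pow, hqq]
    rw [this]; ring
  rw [e4]
  have e5 : (I - √h * G) * (I + √h * G) ≤ (V * (2 * h * Real.exp (3 * growth B z))) *
      (V * (√h * Real.exp (2 * growth B z)) + V * (√h * Real.exp (2 * growth B z))) := by
    refine (le_abs_self _).trans ?_
    rw [abs_mul]
    exact mul_le_mul e2 ((abs_add_le _ _).trans (add_le_add e1 e3)) (abs_nonneg _)
      ((abs_nonneg _).trans e2)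
  have e6 : Real.exp (5 * growth B z) = Real.exp (3 * growth B z) * Real.exp (2 * growth B z) := by
    rw [← Real.exp_add]; ring_nf
  rw [e6]
  linarith

end Increment

lemma abs_partFun_sub_one_le (hB : ∀ᵐ x ∂ν, ‖x‖ ≤ B) (hB0 : 0 ≤ B) (h0 : 0 ≤ h) (h1 : h ≤ 1)
    (z : E d) : |partFun ν h (√h • z) - 1| ≤ √h * Real.exp (2 * growth B z) := by
  have := abs_tiltInt_sub_le hB hB0 h0 h1 (v := fun _ => 1) measurable_const (V := 1) (by simp) z
  rw [← partFun_eq] at this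
  simpa using this

lemma inv_partFun_le (hB : ∀ᵐ x ∂ν, ‖x‖ ≤ B) (hB0 : 0 ≤ B) (h0 : 0 ≤ h) (h1 : h ≤ 1)
    (z : E d) : (partFun ν h (√h • z))⁻¹ ≤ Real.exp (growth B z) := by
  have h2 : Real.exp (-growth B z) ≤ partFun ν h (√h • z) := by
    refine le_trans (Real.exp_le_exp.2 (neg_le_neg ?_)) (exp_neg_le_partFun hB h0 (√h • z))
    have hq1 : √h ≤ 1 := Real.sqrt_le_one.2 h1
    rw [norm_smul, Real.norm_eq_abs, abs_of_nonneg (Real.sqrt_nonneg h), growth]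
    have e1 : B * (√h * ‖z‖) ≤ B * ‖z‖ :=
      mul_le_mul_of_nonneg_left (mul_le_of_le_one_left (norm_nonneg z) hq1) hB0
    have e2 : h * B ^ 2 ≤ B ^ 2 := mul_le_of_le_one_left (sq_nonneg B) h1
    linarith
  rw [inv_le_comm₀ (partFun_pos hB h0 _) (Real.exp_pos _), ← Real.exp_neg]
  exact h2

/-- The Gaussian integral that bounds the error terms. The factor `7` is large enough for the products
of exponentials that occur in the expansions of `postMean` and `signalKL`. -/
noncomputable def errConst (d : ℕ) (B : ℝ) : ℝ :=
  ∫ z : E d, Real.exp (7 * growth B z) ∂(stdGaussian (E d))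

lemma errConst_nonneg (d : ℕ) (B : ℝ) : 0 ≤ errConst d B :=
  integral_nonneg fun _ => (Real.exp_pos _).le

lemma integrable_exp_growth (B : ℝ) :
    Integrable (fun z : E d => Real.exp (7 * growth B z)) (stdGaussian (E d)) := by
  refine integrable_of_abs_le_exp (by unfold growth; fun_prop) 1 (7 * B) (7 * (B ^ 2 / 2))
    fun z => ?_
  rw [Real.abs_exp, one_mul, growth]
  exact Real.exp_le_exp.2 (by linarith)

lemma integrable_tiltInt (hB : ∀ᵐ x ∂ν, ‖x‖ ≤ B) (h0 : 0 ≤ h) {w : E d → ℝ} (hw : Measurable w)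
    {W : ℝ} (hW : ∀ᵐ x ∂ν, |w x| ≤ W) :
    Integrable (fun z => tiltInt ν w h (√h • z)) (stdGaussian (E d)) := by
  refine ((integrable_partFun hB h0).const_mul W).mono'
    ((measurable_tiltInt hw h).comp (by fun_prop)).aestronglyMeasurable (ae_of_all _ fun z => ?_)
  have := norm_integral_le_of_norm_le (μ := ν)
    (f := fun x => w x * Real.exp (pot h (√h • z) x))
    (g := fun x => W * Real.exp (pot h (√h • z) x)) ((integrable_exp_pot hB h0 _).const_mul W) (by
      filter_upwards [hW] with x hx
      rw [norm_mul, Real.norm_eq_abs, Real.norm_eq_abs, Real.abs_exp]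
      gcongr)
  rwa [integral_const_mul] at this

/-- The average over the observation at signal-to-noise ratio `s` of a functional `F` of the
posterior law. -/
noncomputable def postMean (μ : Measure (E d)) (s : ℝ) (F : Measure (E d) → ℝ) : ℝ :=
  ∫ z, partFun μ s (√s • z) * F (tilt μ s (√s • z)) ∂(stdGaussian (E d))

/-- The squared norm `‖cov(w, x)‖²`. -/
noncomputable def sqCov (ν : Measure (E d)) (w : E d → ℝ) : ℝ :=
  ∑ k, (∫ x, w x * x k ∂ν - (∫ x, w x ∂ν) * ∫ x, x k ∂ν) ^ 2

lemma abs_coord_le {x : E d} (hx : ‖x‖ ≤ B) (k : Fin d) : |x k| ≤ B :=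
  (PiLp.norm_apply_le x k).trans hx

lemma measurable_coord (k : Fin d) : Measurable fun x : E d => x k := by fun_prop

lemma integrable_coord (hB : ∀ᵐ x ∂ν, ‖x‖ ≤ B) (k : Fin d) : Integrable (fun x => x k) ν :=
  integrable_of_abs_le (measurable_coord k) (hB.mono fun _ hx => abs_coord_le hx k)

lemma integrable_mul_coord (hB : ∀ᵐ x ∂ν, ‖x‖ ≤ B) {w : E d → ℝ} (hw : Measurable w)
    {W : ℝ} (hW : ∀ᵐ x ∂ν, |w x| ≤ W) (k : Fin d) : Integrable (fun x => w x * x k) ν :=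
  (integrable_coord hB k).bdd_mul (c := W) hw.aestronglyMeasurable hW

lemma crossMoment_apply (hB : ∀ᵐ x ∂ν, ‖x‖ ≤ B) {w : E d → ℝ} (hw : Measurable w)
    {W : ℝ} (hW : ∀ᵐ x ∂ν, |w x| ≤ W) (k : Fin d) :
    crossMoment ν w k = ∫ x, w x * x k ∂ν := by
  have h := (EuclideanSpace.proj (𝕜 := ℝ) k).integral_comp_comm (integrable_smul_self hB hw hW)
  simp only [PiLp.proj_apply, PiLp.smul_apply, smul_eq_mul] at h
  exact h.symm

lemma norm_sq_crossMoment_sub (hB : ∀ᵐ x ∂ν, ‖x‖ ≤ B) {w : E d → ℝ} (hw : Measurable w)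
    {W : ℝ} (hW : ∀ᵐ x ∂ν, |w x| ≤ W) :
    ‖crossMoment ν fun x => w x - ∫ x, w x ∂ν‖ ^ 2 = sqCov ν w := by
  rw [EuclideanSpace.real_norm_sq_eq, sqCov]
  refine Finset.sum_congr rfl fun k _ => ?_
  have hW' : ∀ᵐ x ∂ν, |w x - ∫ x, w x ∂ν| ≤ W + |∫ x, w x ∂ν| :=
    hW.mono fun x hx => (abs_sub _ _).trans (by gcongr)
  rw [crossMoment_apply hB (by fun_prop) hW' k]
  simp_rw [sub_mul]
  rw [integral_sub (integrable_mul_coord hB hw hW k) ((integrable_coord hB k).const_mul _),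
    integral_const_mul]

lemma abs_integral_le (ν : Measure (E d)) [IsProbabilityMeasure ν] {w : E d → ℝ} {W : ℝ}
    (hW : ∀ᵐ x ∂ν, |w x| ≤ W) : |∫ x, w x ∂ν| ≤ W := by
  simpa using norm_integral_le_of_norm_le_const (μ := ν) (f := w) hW

lemma sqCov_le (hB : ∀ᵐ x ∂ν, ‖x‖ ≤ B) {w : E d → ℝ} (hw : Measurable w)
    {W : ℝ} (hW : ∀ᵐ x ∂ν, |w x| ≤ W) : sqCov ν w ≤ (2 * W * B) ^ 2 := by
  rw [← norm_sq_crossMoment_sub hB hw hW]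
  refine pow_le_pow_left₀ (norm_nonneg _) (norm_crossMoment_le hB ?_) 2
  filter_upwards [hW] with x hx
  calc _ ≤ |w x| + |∫ x, w x ∂ν| := abs_sub _ _
    _ ≤ _ := by linarith [abs_integral_le ν hW]

/-- Observing `x` at a small signal-to-noise ratio `h` raises the mean square of the posterior mean
of `w` by `h ‖cov(w, x)‖²`, up to an error of order `h^(3/2)`. -/
lemma postMean_sq_integral_le (hB : ∀ᵐ x ∂ν, ‖x‖ ≤ B) (hB0 : 0 ≤ B) (h0 : 0 ≤ h) (h1 : h ≤ 1)
    {w : E d → ℝ} (hw : Measurable w) {W : ℝ} (hW : ∀ᵐ x ∂ν, |w x| ≤ W) (hW0 : 0 ≤ W) :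
    postMean ν h (fun ν => (∫ x, w x ∂ν) ^ 2) ≤
      (∫ x, w x ∂ν) ^ 2 + h * sqCov ν w + 20 * W ^ 2 * errConst d B * (h * √h) := by
  set m := ∫ x, w x ∂ν with hm
  -- the first order term vanishes after centring `w`
  set v : E d → ℝ := fun x => w x - m with hv
  have hvm : Measurable v := by fun_prop
  have hVb : ∀ᵐ x ∂ν, |v x| ≤ 2 * W := by
    filter_upwards [hW] with x hx
    calc _ ≤ |w x| + |m| := abs_sub _ _
      _ ≤ _ := by linarith [abs_integral_le ν hW]
  have hv0 : ∫ x, v x ∂ν = 0 := by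
    rw [hv, integral_sub (integrable_of_abs_le hw hW) (integrable_const _)]; simp [hm]
  have hq0 := Real.sqrt_nonneg h
  have hqq : √h ^ 2 = h := Real.sq_sqrt h0
  have key : ∀ z, partFun ν h (√h • z) * (∫ x, w x ∂(tilt ν h (√h • z))) ^ 2 ≤
      m ^ 2 * partFun ν h (√h • z) + 2 * m * tiltInt ν v h (√h • z) +
        h * (inner ℝ (crossMoment ν v) z * inner ℝ (crossMoment ν v) z) +
        20 * W ^ 2 * (h * √h) * Real.exp (7 * growth B z) := by
    intro z
    have hr := growth_nonneg hB0 z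
    have hLpos := partFun_pos hB h0 (√h • z)
    have e1 := abs_partFun_sub_one_le hB hB0 h0 h1 z
    have e2 := inv_partFun_le hB hB0 h0 h1 z
    have e3 := abs_tiltInt_sub_le hB hB0 h0 h1 hvm hVb z
    have e4 := sq_tiltInt_sub_le hB hB0 h0 h1 hvm hVb (by positivity) z
    have e5 : tiltInt ν w h (√h • z) = m * partFun ν h (√h • z) + tiltInt ν v h (√h • z) := by
      simp only [tiltInt, partFun, hv, sub_mul]
      rw [integral_sub (integrable_mul_exp_pot hB h0 _ hw hW)
        ((integrable_exp_pot hB h0 _).const_mul m), integral_const_mul]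
      ring
    rw [hv0, sub_zero] at e3 e4
    rw [integral_tilt, e5]
    set L := partFun ν h (√h • z)
    set I := tiltInt ν v h (√h • z)
    have e6 : L * ((m * L + I) / L) ^ 2 = m ^ 2 * L + 2 * m * I + I ^ 2 + I ^ 2 * ((1 - L) * L⁻¹) := by
      field_simp; ring
    have e7 : I ^ 2 * ((1 - L) * L⁻¹) ≤ (2 * W * (√h * Real.exp (2 * growth B z))) ^ 2 *
        ((√h * Real.exp (2 * growth B z)) * Real.exp (growth B z)) := by
      have a1 : I ^ 2 ≤ (2 * W * (√h * Real.exp (2 * growth B z))) ^ 2 := by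
        rw [← sq_abs]; exact pow_le_pow_left₀ (abs_nonneg _) e3 2
      have a2 : (1 - L) * L⁻¹ ≤ (√h * Real.exp (2 * growth B z)) * Real.exp (growth B z) := by
        refine mul_le_mul ?_ e2 (inv_pos.2 hLpos).le (by positivity)
        rw [abs_sub_comm] at e1
        exact (le_abs_self _).trans e1
      exact (mul_le_mul_of_nonneg_left a2 (sq_nonneg I)).trans
        (mul_le_mul_of_nonneg_right a1 (by positivity))
    have e8 : (2 * W * (√h * Real.exp (2 * growth B z))) ^ 2 *
        ((√h * Real.exp (2 * growth B z)) * Real.exp (growth B z)) =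
        4 * W ^ 2 * (h * √h) * Real.exp (7 * growth B z) := by
      have : Real.exp (7 * growth B z) = Real.exp (2 * growth B z) ^ 2 *
          Real.exp (2 * growth B z) * Real.exp (growth B z) := by
        rw [← Real.exp_nat_mul, ← Real.exp_add, ← Real.exp_add]; push_cast; ring_nf
      rw [this, ← hqq]
      rw [Real.sqrt_sq hq0]
      ring
    have e9 : 4 * (2 * W) ^ 2 * (h * √h) * Real.exp (5 * growth B z) ≤
        16 * W ^ 2 * (h * √h) * Real.exp (7 * growth B z) := by
      have : Real.exp (5 * growth B z) ≤ Real.exp (7 * growth B z) :=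
        Real.exp_le_exp.2 (by linarith)
      calc _ = 16 * W ^ 2 * (h * √h) * Real.exp (5 * growth B z) := by ring
        _ ≤ _ := by gcongr
    rw [e6]
    nlinarith
  have hint := integrable_inner_mul_inner (crossMoment ν v) (crossMoment ν v)
  have i1 := (integrable_partFun hB h0).const_mul (m ^ 2)
  have i2 := (integrable_tiltInt hB h0 hvm hVb).const_mul (2 * m)
  have i3 := hint.const_mul h
  have i4 := (integrable_exp_growth (d := d) B).const_mul (20 * W ^ 2 * (h * √h))
  have := integral_mono_of_nonneg (μ := stdGaussian (E d))
    (ae_of_all _ fun z => mul_nonneg (partFun_pos hB h0 (√h • z)).le (sq_nonneg _))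
    (((i1.fun_add i2).fun_add i3).fun_add i4) (ae_of_all _ key)
  refine this.trans_eq ?_
  rw [integral_add ((i1.fun_add i2).fun_add i3) i4, integral_add (i1.fun_add i2) i3,
    integral_add i1 i2, integral_const_mul, integral_const_mul, integral_const_mul,
    integral_const_mul, integral_partFun hB h0, integral_tiltInt hB h0 hvm hVb, hv0,
    integral_inner_mul_inner, real_inner_self_eq_norm_sq, norm_sq_crossMoment_sub hB hw hW,
    errConst]
  ring

/-- The divergence between the laws of the observation with and without signal, at
signal-to-noise ratio `s`. -/
noncomputable def signalKL (μ : Measure (E d)) (s : ℝ) : ℝ :=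
  ∫ z, partFun μ s (√s • z) * Real.log (partFun μ s (√s • z)) ∂(stdGaussian (E d))

lemma norm_sq_crossMoment_one (hB : ∀ᵐ x ∂ν, ‖x‖ ≤ B) :
    ‖crossMoment ν fun _ => 1‖ ^ 2 = ∑ k, (∫ x, x k ∂ν) ^ 2 := by
  rw [EuclideanSpace.real_norm_sq_eq]
  refine Finset.sum_congr rfl fun k _ => ?_
  rw [crossMoment_apply hB measurable_const (W := 1) (by simp) k]
  simp

lemma abs_log_partFun_le (hB : ∀ᵐ x ∂ν, ‖x‖ ≤ B) (h0 : 0 ≤ h) (y : E d) :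
    |Real.log (partFun ν h y)| ≤ B * ‖y‖ + h * B ^ 2 / 2 := by
  have h1 := Real.log_le_log (Real.exp_pos _) (exp_neg_le_partFun hB h0 y)
  have h2 := Real.log_le_log (partFun_pos hB h0 y) (partFun_le_exp hB h0 y)
  rw [Real.log_exp] at h1 h2
  exact abs_le.2 ⟨h1, h2⟩

lemma integrable_partFun_mul_log (hB : ∀ᵐ x ∂ν, ‖x‖ ≤ B) (h0 : 0 ≤ h) :
    Integrable (fun z => partFun ν h (√h • z) * Real.log (partFun ν h (√h • z)))
      (stdGaussian (E d)) := by
  refine integrable_of_abs_le_exp (((measurable_partFun h).comp (by fun_prop)).mul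
    (Real.measurable_log.comp ((measurable_partFun h).comp (by fun_prop)))) 1
    (2 * (B * √h)) (2 * (h * B ^ 2 / 2)) fun z => ?_
  have e1 := abs_log_partFun_le hB h0 (√h • z)
  have e2 := partFun_le_exp hB h0 (√h • z)
  rw [norm_smul, Real.norm_eq_abs, abs_of_nonneg (Real.sqrt_nonneg h), ← mul_assoc] at e1 e2
  rw [abs_mul, abs_of_pos (partFun_pos hB h0 _), one_mul]
  set a := B * √h * ‖z‖ + h * B ^ 2 / 2
  have e3 : |Real.log (partFun ν h (√h • z))| ≤ Real.exp a :=
    e1.trans (by linarith [Real.add_one_le_exp a])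
  calc _ ≤ Real.exp a * Real.exp a := mul_le_mul e2 e3 (abs_nonneg _) (Real.exp_pos _).le
    _ = _ := by
        rw [← Real.exp_add]
        congr 1
        simp only [a]
        ring

/-- At a small signal-to-noise ratio `h`, the divergence is `h ‖E x‖² / 2`, up to an error of order
`h^(3/2)`. -/
lemma signalKL_le (hB : ∀ᵐ x ∂ν, ‖x‖ ≤ B) (hB0 : 0 ≤ B) (h0 : 0 ≤ h) (h1 : h ≤ 1) :
    signalKL ν h ≤ h / 2 * ∑ k, (∫ x, x k ∂ν) ^ 2 + 3 * errConst d B * (h * √h) := by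
  have hq0 := Real.sqrt_nonneg h
  have hqq : √h ^ 2 = h := Real.sq_sqrt h0
  set g := crossMoment ν fun _ => 1 with hg
  have key : ∀ z, partFun ν h (√h • z) * Real.log (partFun ν h (√h • z)) ≤
      (partFun ν h (√h • z) - 1) + h / 2 * (inner ℝ g z * inner ℝ g z) +
        3 * (h * √h) * Real.exp (7 * growth B z) := by
    intro z
    have hr := growth_nonneg hB0 z
    have hLpos := partFun_pos hB h0 (√h • z)
    have e1 := abs_partFun_sub_one_le hB hB0 h0 h1 z
    have e2 := sq_tiltInt_sub_le hB hB0 h0 h1 (v := fun _ => 1) measurable_const (V := 1)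
      (by simp) zero_le_one z
    rw [← partFun_eq, ← hg] at e2
    simp only [integral_const, probReal_univ, smul_eq_mul, mul_one, one_pow] at e2
    have e3 := mul_log_le hLpos
    set L := partFun ν h (√h • z)
    have e4 : |L - 1| ^ 3 ≤ h * √h * Real.exp (7 * growth B z) := by
      calc |L - 1| ^ 3 ≤ (√h * Real.exp (2 * growth B z)) ^ 3 :=
            pow_le_pow_left₀ (abs_nonneg _) e1 3
        _ = √h ^ 2 * √h * Real.exp (6 * growth B z) := by
            rw [mul_pow, ← Real.exp_nat_mul]; push_cast; ring_nf
        _ ≤ _ := by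
            rw [hqq]
            gcongr
            linarith
    have e5 : h * √h * Real.exp (5 * growth B z) ≤ h * √h * Real.exp (7 * growth B z) := by
      gcongr; linarith
    have e6 : 0 ≤ h * √h * Real.exp (7 * growth B z) := by positivity
    rw [← sq]
    linarith
  have i1 := (integrable_partFun hB h0).sub (integrable_const (1 : ℝ))
  have i2 := (integrable_inner_mul_inner g g).const_mul (h / 2)
  have i3 := (integrable_exp_growth (d := d) B).const_mul (3 * (h * √h))
  refine (integral_mono (integrable_partFun_mul_log hB h0) ((i1.add i2).add i3) key).trans_eq ?_
  have := integral_add (i1.add i2) i3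
  simp only [Pi.add_apply, Pi.sub_apply] at this ⊢
  rw [this]
  have := integral_add i1 i2
  simp only [Pi.sub_apply] at this
  rw [this, integral_sub (integrable_partFun hB h0) (integrable_const _), integral_partFun hB h0,
    integral_const_mul, integral_const_mul, integral_inner_mul_inner, real_inner_self_eq_norm_sq,
    hg, norm_sq_crossMoment_one hB, errConst]
  simp
  ring

end SmallTime

/-! ### Third order bound on the divergence of a Gaussian observation -/

section Increments

variable {d : ℕ} {μ : Measure (E d)} [IsProbabilityMeasure μ] {B s h : ℝ}

lemma integrable_partFun_mul (hB : ∀ᵐ x ∂μ, ‖x‖ ≤ B) (hs : 0 ≤ s) {F : Measure (E d) → ℝ}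
    (hF : Measurable fun y => F (tilt μ s y)) {c : ℝ} (hc : ∀ y, |F (tilt μ s y)| ≤ c) :
    Integrable (fun z => partFun μ s (√s • z) * F (tilt μ s (√s • z))) (stdGaussian (E d)) :=
  (integrable_partFun hB hs).mul_bdd (c := c)
    (hF.comp (by fun_prop : Measurable fun z : E d => √s • z)).aestronglyMeasurable
    (ae_of_all _ fun z => hc _)

lemma measurable_sqCov_tilt {w : E d → ℝ} (hw : Measurable w) (s : ℝ) :
    Measurable fun y => sqCov (tilt μ s y) w := by
  unfold sqCov
  refine Finset.measurable_sum _ fun k _ => ?_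
  exact ((measurable_integral_tilt (hw.mul (measurable_coord k)) s).sub
    ((measurable_integral_tilt hw s).mul (measurable_integral_tilt (measurable_coord k) s))).pow_const
    2

lemma abs_sqCov_tilt_le (hB : ∀ᵐ x ∂μ, ‖x‖ ≤ B) (hs : 0 ≤ s) {w : E d → ℝ} (hw : Measurable w)
    {W : ℝ} (hW : ∀ᵐ x ∂μ, |w x| ≤ W) (y : E d) : |sqCov (tilt μ s y) w| ≤ (2 * W * B) ^ 2 := by
  have := isProbabilityMeasure_tilt hB hs y
  rw [abs_of_nonneg (Finset.sum_nonneg fun k _ => sq_nonneg _)]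
  exact sqCov_le (ae_tilt hB s y) hw (ae_tilt hW s y)

lemma abs_sq_integral_tilt_le (hB : ∀ᵐ x ∂μ, ‖x‖ ≤ B) (hs : 0 ≤ s) {w : E d → ℝ}
    {W : ℝ} (hW : ∀ᵐ x ∂μ, |w x| ≤ W) (y : E d) : |(∫ x, w x ∂(tilt μ s y)) ^ 2| ≤ W ^ 2 := by
  have := isProbabilityMeasure_tilt hB hs y
  rw [abs_pow]
  exact pow_le_pow_left₀ (abs_nonneg _) (abs_integral_le _ (ae_tilt hW s y)) 2

/-- `postMean_sq_integral_le` started from an arbitrary signal-to-noise ratio: the posterior law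
plays the role of the prior of the next increment. -/
lemma postMean_sq_integral_add_le (hB : ∀ᵐ x ∂μ, ‖x‖ ≤ B) (hB0 : 0 ≤ B) (hs : 0 ≤ s) (h0 : 0 ≤ h)
    (h1 : h ≤ 1) {w : E d → ℝ} (hw : Measurable w) {W : ℝ} (hW : ∀ᵐ x ∂μ, |w x| ≤ W)
    (hW0 : 0 ≤ W) :
    postMean μ (s + h) (fun ν => (∫ x, w x ∂ν) ^ 2) ≤ postMean μ s (fun ν => (∫ x, w x ∂ν) ^ 2) +
      h * postMean μ s (fun ν => sqCov ν w) + 20 * W ^ 2 * errConst d B * (h * √h) := by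
  set H : E d → ℝ := fun y => partFun μ (s + h) y * (∫ x, w x ∂(tilt μ (s + h) y)) ^ 2 with hH
  have hHm : Measurable H := (measurable_partFun _).mul ((measurable_integral_tilt hw _).pow_const 2)
  have hHi : Integrable (fun z => H (√(s + h) • z)) (stdGaussian (E d)) :=
    integrable_partFun_mul hB (add_nonneg hs h0) (F := fun ν => (∫ x, w x ∂ν) ^ 2)
      ((measurable_integral_tilt hw _).pow_const 2)
      (abs_sq_integral_tilt_le hB (add_nonneg hs h0) hW)
  have e1 : postMean μ (s + h) (fun ν => (∫ x, w x ∂ν) ^ 2) = _ := integral_sqrt_add hs h0 hHm hHi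
  have e2 : ∀ z, ∫ z', H (√s • z + √h • z') ∂(stdGaussian (E d)) = partFun μ s (√s • z) *
      postMean (tilt μ s (√s • z)) h (fun ν => (∫ x, w x ∂ν) ^ 2) := by
    intro z
    rw [postMean, ← integral_const_mul]
    refine integral_congr_ae (ae_of_all _ fun z' => ?_)
    simp only [hH]
    rw [partFun_add hB hs, tilt_tilt hB hs, mul_assoc]
  have hi := (integrable_prod_of_integrable hs h0 hHm hHi).integral_prod_left
  rw [e1]
  simp_rw [e2] at hi ⊢
  have i1 := integrable_partFun_mul hB hs (F := fun ν => (∫ x, w x ∂ν) ^ 2)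
    ((measurable_integral_tilt hw _).pow_const 2) (abs_sq_integral_tilt_le hB hs hW)
  have i2 := (integrable_partFun_mul hB hs (F := fun ν => sqCov ν w)
    (measurable_sqCov_tilt hw s) (abs_sqCov_tilt_le hB hs hw hW)).const_mul h
  have i3 := (integrable_partFun hB hs).const_mul (20 * W ^ 2 * errConst d B * (h * √h))
  refine (integral_mono hi ((i1.fun_add i2).fun_add i3) fun z => ?_).trans_eq ?_
  · have := isProbabilityMeasure_tilt hB hs (√s • z)
    have k := postMean_sq_integral_le (ae_tilt hB s (√s • z)) hB0 h0 h1 hw (ae_tilt hW s (√s • z)) hW0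
    have k' := mul_le_mul_of_nonneg_left k (partFun_pos hB hs (√s • z)).le
    refine k'.trans_eq ?_
    ring
  · rw [integral_add (i1.fun_add i2) i3, integral_add i1 i2, integral_const_mul,
      integral_const_mul, integral_partFun hB hs]
    simp only [postMean]
    ring

/-- `signalKL_le` started from an arbitrary signal-to-noise ratio, by the chain rule for the
divergence. -/
lemma signalKL_add_le (hB : ∀ᵐ x ∂μ, ‖x‖ ≤ B) (hB0 : 0 ≤ B) (hs : 0 ≤ s) (h0 : 0 ≤ h)
    (h1 : h ≤ 1) : signalKL μ (s + h) ≤ signalKL μ s +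
      h / 2 * postMean μ s (fun ν => ∑ k, (∫ x, x k ∂ν) ^ 2) + 3 * errConst d B * (h * √h) := by
  set H : E d → ℝ := fun y => partFun μ (s + h) y * Real.log (partFun μ (s + h) y) with hH
  have hHm : Measurable H := (measurable_partFun _).mul (measurable_partFun _).log
  have hHi : Integrable (fun z => H (√(s + h) • z)) (stdGaussian (E d)) :=
    integrable_partFun_mul_log hB (add_nonneg hs h0)
  have e1 : signalKL μ (s + h) = _ := integral_sqrt_add hs h0 hHm hHi
  have e2 : ∀ z, ∫ z', H (√s • z + √h • z') ∂(stdGaussian (E d)) =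
      partFun μ s (√s • z) * Real.log (partFun μ s (√s • z)) +
      partFun μ s (√s • z) * signalKL (tilt μ s (√s • z)) h := by
    intro z
    have := isProbabilityMeasure_tilt hB hs (√s • z)
    have hB' := ae_tilt hB s (√s • z)
    have j1 := (integrable_partFun hB' h0).const_mul
      (partFun μ s (√s • z) * Real.log (partFun μ s (√s • z)))
    have j2 := (integrable_partFun_mul_log hB' h0).const_mul (partFun μ s (√s • z))
    have e3 : ∀ z', H (√s • z + √h • z') =
        partFun μ s (√s • z) * Real.log (partFun μ s (√s • z)) *
          partFun (tilt μ s (√s • z)) h (√h • z') +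
        partFun μ s (√s • z) * (partFun (tilt μ s (√s • z)) h (√h • z') *
          Real.log (partFun (tilt μ s (√s • z)) h (√h • z'))) := by
      intro z'
      simp only [hH]
      rw [partFun_add hB hs, Real.log_mul (partFun_pos hB hs _).ne' (partFun_pos hB' h0 _).ne']
      ring
    simp_rw [e3]
    rw [integral_add j1 j2, integral_const_mul, integral_const_mul, integral_partFun hB' h0, mul_one,
      signalKL]
  have hi := (integrable_prod_of_integrable hs h0 hHm hHi).integral_prod_left
  rw [e1]
  simp_rw [e2] at hi ⊢
  have i1 := integrable_partFun_mul_log hB hs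
  have hW : ∀ k : Fin d, ∀ᵐ x ∂μ, |x k| ≤ B := fun k => hB.mono fun x hx => abs_coord_le hx k
  have i2 := (integrable_partFun_mul hB hs (F := fun ν => ∑ k, (∫ x, x k ∂ν) ^ 2)
    (Finset.measurable_sum _ fun k _ => (measurable_integral_tilt (measurable_coord k) _).pow_const 2)
    (c := ∑ _ : Fin d, B ^ 2) fun y => (Finset.abs_sum_le_sum_abs _ _).trans
      (Finset.sum_le_sum fun k _ => abs_sq_integral_tilt_le hB hs (hW k) y)).const_mul (h / 2)
  have i3 := (integrable_partFun hB hs).const_mul (3 * errConst d B * (h * √h))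
  refine (integral_mono hi ((i1.fun_add i2).fun_add i3) fun z => ?_).trans_eq ?_
  · have := isProbabilityMeasure_tilt hB hs (√s • z)
    have k := signalKL_le (ae_tilt hB s (√s • z)) hB0 h0 h1
    have k' := mul_le_mul_of_nonneg_left k (partFun_pos hB hs (√s • z)).le
    simp only
    linarith
  · rw [integral_add (i1.fun_add i2) i3, integral_add i1 i2, integral_const_mul,
      integral_const_mul, integral_partFun hB hs]
    simp only [postMean, signalKL]
    ring

lemma postMean_sum (hB : ∀ᵐ x ∂μ, ‖x‖ ≤ B) (hs : 0 ≤ s) {ι : Type*} (t : Finset ι)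
    {F : ι → Measure (E d) → ℝ} (hF : ∀ i, Measurable fun y => F i (tilt μ s y)) {c : ι → ℝ}
    (hc : ∀ i y, |F i (tilt μ s y)| ≤ c i) :
    postMean μ s (fun ν => ∑ i ∈ t, F i ν) = ∑ i ∈ t, postMean μ s (F i) := by
  simp only [postMean, Finset.mul_sum]
  exact integral_finsetSum _ fun i _ => integrable_partFun_mul hB hs (hF i) (hc i)

lemma postMean_integral (hB : ∀ᵐ x ∂μ, ‖x‖ ≤ B) (hs : 0 ≤ s) {w : E d → ℝ}
    (hw : Measurable w) {W : ℝ} (hW : ∀ᵐ x ∂μ, |w x| ≤ W) :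
    postMean μ s (fun ν => ∫ x, w x ∂ν) = ∫ x, w x ∂μ := by
  rw [← integral_tiltInt hB hs hw hW, postMean]
  simp_rw [partFun_mul_integral_tilt hB hs]

lemma postMean_zero (F : Measure (E d) → ℝ) : postMean μ 0 F = F μ := by
  simp [postMean, partFun_zero, tilt_zero]

lemma signalKL_zero : signalKL μ 0 = 0 := by simp [signalKL, partFun_zero]

end Increments

section Moments

variable {d : ℕ} {ν : Measure (E d)} [IsProbabilityMeasure ν] {B R : ℝ}

/-- The second moment matrix dominates the covariance matrix in Hilbert-Schmidt norm. -/
lemma sum_sqCov_coord_le (hB : ∀ᵐ x ∂ν, ‖x‖ ≤ B) :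
    ∑ i, sqCov ν (fun x => x i) ≤ ∑ i, ∑ j, (∫ x, x i * x j ∂ν) ^ 2 := by
  set m : Fin d → ℝ := fun i => ∫ x, x i ∂ν with hm
  set S : Fin d → Fin d → ℝ := fun i j => ∫ x, x i * x j ∂ν with hS
  have hc : ∀ i, ∀ᵐ x ∂ν, |x i| ≤ B := fun i => hB.mono fun x hx => abs_coord_le hx i
  have hint : ∀ i j, Integrable (fun x : E d => x i * x j) ν := fun i j =>
    integrable_mul_coord hB (measurable_coord i) (hc i) j
  have e1 : ∫ x, (∑ i, m i * x i) ^ 2 ∂ν = ∑ i, ∑ j, m i * m j * S i j := by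
    have : ∀ x : E d, (∑ i, m i * x i) ^ 2 = ∑ i, ∑ j, m i * m j * (x i * x j) := by
      intro x
      rw [sq, Finset.sum_mul_sum]
      exact Finset.sum_congr rfl fun i _ => Finset.sum_congr rfl fun j _ => by ring
    simp_rw [this]
    rw [integral_finsetSum _ fun i _ => integrable_finsetSum _ fun j _ => (hint i j).const_mul _]
    refine Finset.sum_congr rfl fun i _ => ?_
    rw [integral_finsetSum _ fun j _ => (hint i j).const_mul _]
    exact Finset.sum_congr rfl fun j _ => integral_const_mul _ _
  have e2 : ∫ x, (∑ i, m i * x i) ∂ν = ∑ i, m i * m i := by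
    rw [integral_finsetSum _ fun i _ => (integrable_coord hB i).const_mul _]
    exact Finset.sum_congr rfl fun i _ => integral_const_mul _ _
  have hb : ∀ᵐ x ∂ν, |∑ i, m i * x i| ≤ ∑ i, |m i| * B := by
    filter_upwards [hB] with x hx
    refine (Finset.abs_sum_le_sum_abs _ _).trans (Finset.sum_le_sum fun i _ => ?_)
    rw [abs_mul]
    exact mul_le_mul_of_nonneg_left (abs_coord_le hx i) (abs_nonneg _)
  -- `⟨m, S m⟩ ≥ ‖m‖⁴`, where `S` is the second moment matrix
  have e3 := integral_sq_mul_le (μ := ν) (u := fun _ => 1) (v := fun x : E d => ∑ i, m i * x i)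
    measurable_const (Finset.measurable_sum _ fun i _ => (measurable_coord i).const_mul _)
    (U := 1) (by simp) hb
  simp only [one_mul, one_pow, integral_const, probReal_univ, smul_eq_mul] at e3
  rw [e1, e2] at e3
  have e4 : ∑ i, sqCov ν (fun x => x i) = ∑ i, ∑ j, (S i j) ^ 2 -
      2 * (∑ i, ∑ j, m i * m j * S i j) + (∑ i, m i * m i) ^ 2 := by
    rw [sq (∑ i, m i * m i), Finset.sum_mul_sum, Finset.mul_sum, ← Finset.sum_sub_distrib,
      ← Finset.sum_add_distrib]
    refine Finset.sum_congr rfl fun i _ => ?_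
    rw [Finset.mul_sum, ← Finset.sum_sub_distrib, ← Finset.sum_add_distrib]
    refine Finset.sum_congr rfl fun j _ => ?_
    simp only [hS, hm]
    ring
  rw [e4]
  nlinarith [sq_nonneg (∑ i, m i * m i)]

/-- A law carried by a ball of radius `R` has total variance at most `R²`. -/
lemma sum_variance_le (hB : ∀ᵐ x ∂ν, ‖x‖ ≤ B) {c : E d} (hR : ∀ᵐ x ∂ν, ‖x - c‖ ≤ R) :
    ∑ k, ∫ x, (x k - ∫ x, x k ∂ν) ^ 2 ∂ν ≤ R ^ 2 := by
  have hc : ∀ i, ∀ᵐ x ∂ν, |x i| ≤ B := fun i => hB.mono fun x hx => abs_coord_le hx i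
  have hI : ∀ i (a : ℝ), Integrable (fun x : E d => (x i - a) ^ 2) ν := by
    intro i a
    refine integrable_of_abs_le (by fun_prop) (W := (B + |a|) ^ 2) ?_
    filter_upwards [hc i] with x hx
    rw [abs_pow]
    exact pow_le_pow_left₀ (abs_nonneg _) ((abs_sub _ _).trans (by gcongr)) 2
  have e1 : ∀ k, ∫ x, (x k - ∫ x, x k ∂ν) ^ 2 ∂ν ≤ ∫ x, (x k - c k) ^ 2 ∂ν := by
    intro k
    set m := ∫ x, x k ∂ν with hm
    have e2 : ∀ x : E d, (x k - c k) ^ 2 =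
        (x k - m) ^ 2 + (2 * (m - c k)) * (x k - m) + (m - c k) ^ 2 := fun x => by ring
    simp_rw [e2]
    have hk : Integrable (fun x : E d => x k - m) ν :=
      (integrable_coord hB k).sub (integrable_const m)
    rw [integral_add ((hI k m).fun_add (hk.const_mul _)) (integrable_const _),
      integral_add (hI k m) (hk.const_mul _), integral_const_mul]
    have : ∫ x : E d, (x k - m) ∂ν = 0 := by
      rw [integral_sub (integrable_coord hB k) (integrable_const m)]; simp [hm]
    simp only [this, mul_zero, add_zero, integral_const, probReal_univ, smul_eq_mul,
      one_mul]
    linarith [sq_nonneg (m - c k)]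
  calc _ ≤ ∑ k, ∫ x, (x k - c k) ^ 2 ∂ν := Finset.sum_le_sum fun k _ => e1 k
    _ = ∫ x, ‖x - c‖ ^ 2 ∂ν := by
        rw [← integral_finsetSum _ fun k _ => hI k _]
        refine integral_congr_ae (ae_of_all _ fun x => ?_)
        simp [EuclideanSpace.real_norm_sq_eq]
    _ ≤ ∫ _, R ^ 2 ∂ν := by
        refine integral_mono_of_nonneg (ae_of_all _ fun x => sq_nonneg _) (integrable_const _) ?_
        filter_upwards [hR] with x hx
        exact pow_le_pow_left₀ (norm_nonneg _) hx 2
    _ = R ^ 2 := by simp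

/-- Bound on the third cumulant, by the Cauchy-Schwarz inequality
`‖E[u ⊗ v]‖² ≤ E‖u‖² E‖v‖²` with `u = x ⊗ x` and `v = x - E x`. -/
lemma sum_sqCov_mul_le (hB : ∀ᵐ x ∂ν, ‖x‖ ≤ B) {c : E d} (hR : ∀ᵐ x ∂ν, ‖x - c‖ ≤ R) :
    ∑ i, ∑ j, sqCov ν (fun x => x i * x j) ≤ B ^ 2 * R ^ 2 * ∫ x, ‖x‖ ^ 2 ∂ν := by
  have hc : ∀ i, ∀ᵐ x ∂ν, |x i| ≤ B := fun i => hB.mono fun x hx => abs_coord_le hx i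
  have hcc : ∀ i j, ∀ᵐ x ∂ν, |x i * x j| ≤ B * B := fun i j => by
    filter_upwards [hB] with x hx
    rw [abs_mul]
    exact mul_le_mul (abs_coord_le hx i) (abs_coord_le hx j) (abs_nonneg _)
      ((norm_nonneg _).trans hx)
  have hmm : ∀ i j, Measurable fun x : E d => x i * x j := fun i j => by fun_prop
  have e1 : ∀ i j, sqCov ν (fun x => x i * x j) ≤
      (∫ x, (x i * x j) ^ 2 ∂ν) * R ^ 2 := by
    intro i j
    calc sqCov ν (fun x => x i * x j)
        ≤ ∑ k, (∫ x, (x i * x j) ^ 2 ∂ν) * ∫ x, (x k - ∫ x, x k ∂ν) ^ 2 ∂ν := by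
          refine Finset.sum_le_sum fun k _ => ?_
          have e : ∫ x, x i * x j * x k ∂ν - (∫ x, x i * x j ∂ν) * ∫ x, x k ∂ν =
              ∫ x, (x i * x j) * (x k - ∫ x, x k ∂ν) ∂ν := by
            simp_rw [mul_sub]
            rw [integral_sub (integrable_mul_coord hB (hmm i j) (hcc i j) k)
              ((integrable_of_abs_le (hmm i j) (hcc i j)).mul_const _), integral_mul_const]
          rw [e]
          refine integral_sq_mul_le (hmm i j) (by fun_prop) (hcc i j)
            (V := B + |∫ x, x k ∂ν|) ?_
          filter_upwards [hc k] with x hx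
          exact (abs_sub _ _).trans (by gcongr)
      _ ≤ _ := by
          rw [← Finset.mul_sum]
          exact mul_le_mul_of_nonneg_left (sum_variance_le hB hR)
            (integral_nonneg fun x => sq_nonneg _)
  have hI4 : ∀ i j, Integrable (fun x : E d => (x i * x j) ^ 2) ν := fun i j => by
    refine integrable_of_abs_le (by fun_prop) (W := (B * B) ^ 2) ?_
    filter_upwards [hcc i j] with x hx
    rw [abs_pow]
    exact pow_le_pow_left₀ (abs_nonneg _) hx 2
  have e2 : ∑ i, ∑ j, ∫ x, (x i * x j) ^ 2 ∂ν = ∫ x, ‖x‖ ^ 2 * ‖x‖ ^ 2 ∂ν := by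
    simp_rw [← integral_finsetSum _ fun j _ => hI4 _ j]
    rw [← integral_finsetSum _ fun i _ => integrable_finsetSum _ fun j _ => hI4 i j]
    refine integral_congr_ae (ae_of_all _ fun x => ?_)
    simp only [EuclideanSpace.real_norm_sq_eq, Finset.sum_mul_sum, mul_pow]
  have hn2 : Integrable (fun x : E d => ‖x‖ ^ 2) ν :=
    integrable_of_abs_le (by fun_prop) (W := B ^ 2) (hB.mono fun x hx => by
      rw [abs_of_nonneg (sq_nonneg _)]; exact pow_le_pow_left₀ (norm_nonneg _) hx 2)
  have e3 : ∫ x, ‖x‖ ^ 2 * ‖x‖ ^ 2 ∂ν ≤ B ^ 2 * ∫ x, ‖x‖ ^ 2 ∂ν := by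
    rw [← integral_const_mul]
    refine integral_mono_of_nonneg (ae_of_all _ fun x => by positivity) (hn2.const_mul _) ?_
    filter_upwards [hB] with x hx
    exact mul_le_mul_of_nonneg_right (pow_le_pow_left₀ (norm_nonneg _) hx 2) (sq_nonneg _)
  calc _ ≤ ∑ i, ∑ j, (∫ x, (x i * x j) ^ 2 ∂ν) * R ^ 2 :=
        Finset.sum_le_sum fun i _ => Finset.sum_le_sum fun j _ => e1 i j
    _ = (∑ i, ∑ j, ∫ x, (x i * x j) ^ 2 ∂ν) * R ^ 2 := by simp_rw [Finset.sum_mul]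
    _ ≤ (B ^ 2 * ∫ x, ‖x‖ ^ 2 ∂ν) * R ^ 2 := by
        rw [e2]; exact mul_le_mul_of_nonneg_right e3 (sq_nonneg _)
    _ = _ := by ring

end Moments

/-- Three nested differential inequalities `U' ≤ b`, `M' ≤ U`, `K' ≤ M / 2`, integrated over
`[0, 1]`. Each is only known for finite increments `h`, up to an error `A h^(3/2)`. -/
lemma le_of_nested_increments {U M K : ℝ → ℝ} {a b A : ℝ} (hA : 0 ≤ A) (ha : 0 ≤ a) (hb : 0 ≤ b)
    (hU : ∀ s h, 0 ≤ s → 0 ≤ h → h ≤ 1 → U (s + h) ≤ U s + h * b + A * (h * √h))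
    (hM : ∀ s h, 0 ≤ s → 0 ≤ h → h ≤ 1 → M (s + h) ≤ M s + h * U s + A * (h * √h))
    (hK : ∀ s h, 0 ≤ s → 0 ≤ h → h ≤ 1 → K (s + h) ≤ K s + h / 2 * M s + A * (h * √h))
    (hU0 : U 0 ≤ a) (hM0 : M 0 ≤ 0) (hK0 : K 0 ≤ 0) : K 1 ≤ a / 4 + b / 12 := by
  -- `N + 1` increments of length `h = 1 / (N + 1)`
  have key : ∀ N : ℕ, K 1 ≤ A * √(1 / ((N : ℝ) + 1)) + (a + A * √(1 / ((N : ℝ) + 1))) / 4 +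
      (b + A * √(1 / ((N : ℝ) + 1))) / 12 := by
    intro N
    set h : ℝ := 1 / ((N : ℝ) + 1) with hh
    have h0 : 0 ≤ h := by positivity
    have h1 : h ≤ 1 := by
      rw [hh, div_le_one (by positivity)]
      linarith [(Nat.cast_nonneg N : (0 : ℝ) ≤ N)]
    set e := A * √h with he
    have he0 : 0 ≤ e := by positivity
    have hAe : A * (h * √h) = h * e := by rw [he]; ring
    have ind : ∀ k : ℕ, U (k * h) ≤ a + k * h * (b + e) ∧
        M (k * h) ≤ k * h * (a + e) + (b + e) * (h ^ 2 * (k : ℝ) ^ 2 / 2) ∧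
        K (k * h) ≤ k * h * e + (a + e) * (h ^ 2 * (k : ℝ) ^ 2 / 4) +
          (b + e) * (h ^ 3 * (k : ℝ) ^ 3 / 12) := by
      intro k
      induction k with
      | zero => simpa using ⟨hU0, hM0, hK0⟩
      | succ k ih =>
        obtain ⟨i1, i2, i3⟩ := ih
        have hk : (0 : ℝ) ≤ k * h := by positivity
        have hk0 : (0 : ℝ) ≤ k := by positivity
        have ek : ((k + 1 : ℕ) : ℝ) * h = k * h + h := by push_cast; ring
        have j1 := hU (k * h) h hk h0 h1
        have j2 := hM (k * h) h hk h0 h1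
        have j3 := hK (k * h) h hk h0 h1
        rw [hAe] at j1 j2 j3
        rw [ek]
        push_cast
        refine ⟨by nlinarith, ?_, ?_⟩
        · have l1 := mul_le_mul_of_nonneg_left i1 h0
          have l2 : 0 ≤ (b + e) * h ^ 2 := by positivity
          nlinarith
        · have l1 := mul_le_mul_of_nonneg_left i2 (by positivity : 0 ≤ h / 2)
          have l2 : 0 ≤ (b + e) * h ^ 3 := by positivity
          have l3 : 0 ≤ (a + e) * h ^ 2 := by positivity
          have l4 : 0 ≤ (b + e) * h ^ 3 * (3 * k + 1) := by positivity
          nlinarith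
    have hN := (ind (N + 1)).2.2
    have hNh : ((N + 1 : ℕ) : ℝ) * h = 1 := by
      rw [hh]; push_cast; field_simp
    have hN2 : h ^ 2 * ((N + 1 : ℕ) : ℝ) ^ 2 = 1 := by rw [← mul_pow, mul_comm, hNh, one_pow]
    have hN3 : h ^ 3 * ((N + 1 : ℕ) : ℝ) ^ 3 = 1 := by rw [← mul_pow, mul_comm, hNh, one_pow]
    rw [hNh, hN2, hN3] at hN
    linarith
  have hlim : Filter.Tendsto (fun N : ℕ => A * √(1 / ((N : ℝ) + 1)) +
      (a + A * √(1 / ((N : ℝ) + 1))) / 4 + (b + A * √(1 / ((N : ℝ) + 1))) / 12) Filter.atTop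
      (nhds (A * √0 + (a + A * √0) / 4 + (b + A * √0) / 12)) := by
    have h1 : Filter.Tendsto (fun N : ℕ => √(1 / ((N : ℝ) + 1))) Filter.atTop (nhds √0) :=
      (Real.continuous_sqrt.tendsto 0).comp tendsto_one_div_add_atTop_nhds_zero_nat
    have h2 := h1.const_mul A
    exact (h2.add ((h2.const_add a).div_const 4)).add ((h2.const_add b).div_const 12)
  have := ge_of_tendsto' hlim key
  simpa using this

/-- The divergence of `X + Z` from the standard Gaussian vector `Z`, for a centred `X` in a ball of
radius `R`: the second order term is exact, the third order term is controlled by `R⁶`. -/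
lemma signalKL_one_le {d : ℕ} (μ : Measure (E d)) [IsProbabilityMeasure μ] {R : ℝ} (hR0 : 0 ≤ R)
    {c : E d} (hR : ∀ᵐ x ∂μ, ‖x - c‖ ≤ R) (hB : ∀ᵐ x ∂μ, ‖x‖ ≤ 2 * R)
    (hμ : ∀ k, ∫ x, x k ∂μ = 0) :
    signalKL μ 1 ≤ (∑ i, ∑ j, (∫ x, x i * x j ∂μ) ^ 2) / 4 + R ^ 6 / 3 := by
  set ec := errConst d (2 * R) with hec
  have hec0 : 0 ≤ ec := errConst_nonneg _ _
  have hB0 : 0 ≤ 2 * R := by positivity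
  have hc : ∀ i, ∀ᵐ x ∂μ, |x i| ≤ 2 * R := fun i => hB.mono fun x hx => abs_coord_le hx i
  have hcc : ∀ i j, ∀ᵐ x ∂μ, |x i * x j| ≤ 2 * R * (2 * R) := fun i j => by
    filter_upwards [hB] with x hx
    rw [abs_mul]
    exact mul_le_mul (abs_coord_le hx i) (abs_coord_le hx j) (abs_nonneg _) hB0
  have hmm : ∀ i j, Measurable fun x : E d => x i * x j := fun i j => by fun_prop
  have hn2b : ∀ᵐ x ∂μ, |‖x‖ ^ 2| ≤ (2 * R) ^ 2 := hB.mono fun x hx => by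
    rw [abs_of_nonneg (sq_nonneg _)]; exact pow_le_pow_left₀ (norm_nonneg _) hx 2
  have hvar : ∫ x, ‖x‖ ^ 2 ∂μ ≤ R ^ 2 := by
    have h := sum_variance_le hB hR
    simp_rw [hμ, sub_zero] at h
    rw [← integral_finsetSum _ fun k _ => integrable_of_abs_le (by fun_prop) (W := (2 * R) ^ 2)
      ((hc k).mono fun x hx => by rw [abs_pow]; exact pow_le_pow_left₀ (abs_nonneg _) hx 2)] at h
    simpa [EuclideanSpace.real_norm_sq_eq] using h
  -- a common constant for the three error terms
  set A : ℝ := (d : ℝ) * (20 * (2 * R) ^ 2 * ec) +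
    (d : ℝ) * ((d : ℝ) * (20 * (2 * R * (2 * R)) ^ 2 * ec)) + 3 * ec with hA
  have hA1 : (d : ℝ) * (20 * (2 * R) ^ 2 * ec) ≤ A := by
    rw [hA]
    have : 0 ≤ (d : ℝ) * ((d : ℝ) * (20 * (2 * R * (2 * R)) ^ 2 * ec)) + 3 * ec := by positivity
    linarith
  have hA2 : (d : ℝ) * ((d : ℝ) * (20 * (2 * R * (2 * R)) ^ 2 * ec)) ≤ A := by
    rw [hA]
    have : 0 ≤ (d : ℝ) * (20 * (2 * R) ^ 2 * ec) := by positivity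
    linarith
  have hA3 : 3 * ec ≤ A := by
    rw [hA]
    have : 0 ≤ (d : ℝ) * (20 * (2 * R) ^ 2 * ec) +
      (d : ℝ) * ((d : ℝ) * (20 * (2 * R * (2 * R)) ^ 2 * ec)) := by positivity
    linarith
  have hA0 : 0 ≤ A := by positivity
  -- measurability and boundedness of the functionals of the posterior law
  have mF : ∀ {w : E d → ℝ} (s : ℝ), Measurable w →
      Measurable fun y => (∫ x, w x ∂(tilt μ s y)) ^ 2 := fun s hw =>
    (measurable_integral_tilt hw s).pow_const 2
  have sumM : ∀ s, 0 ≤ s → postMean μ s (fun ν => ∑ k, (∫ x, x k ∂ν) ^ 2) =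
      ∑ k, postMean μ s (fun ν => (∫ x, x k ∂ν) ^ 2) := fun s hs =>
    postMean_sum hB hs Finset.univ (fun k => mF s (measurable_coord k))
      (c := fun _ => (2 * R) ^ 2) fun k y => abs_sq_integral_tilt_le hB hs (hc k) y
  have sumU : ∀ s, 0 ≤ s → postMean μ s (fun ν => ∑ i, ∑ j, (∫ x, x i * x j ∂ν) ^ 2) =
      ∑ i, ∑ j, postMean μ s (fun ν => (∫ x, x i * x j ∂ν) ^ 2) := fun s hs => by
    rw [postMean_sum hB hs Finset.univ (fun i => Finset.measurable_sum _ fun j _ => mF s (hmm i j))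
      (c := fun _ => ∑ _ : Fin d, (2 * R * (2 * R)) ^ 2) fun i y =>
        (Finset.abs_sum_le_sum_abs _ _).trans (Finset.sum_le_sum fun j _ =>
          abs_sq_integral_tilt_le hB hs (hcc i j) y)]
    exact Finset.sum_congr rfl fun i _ => postMean_sum hB hs Finset.univ (fun j => mF s (hmm i j))
      (c := fun _ => (2 * R * (2 * R)) ^ 2) fun j y => abs_sq_integral_tilt_le hB hs (hcc i j) y
  have intC : ∀ s, 0 ≤ s → ∀ i, Integrable (fun z => partFun μ s (√s • z) *
      sqCov (tilt μ s (√s • z)) (fun x => x i)) (stdGaussian (E d)) := fun s hs i =>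
    integrable_partFun_mul hB hs (F := fun ν => sqCov ν fun x => x i)
      (measurable_sqCov_tilt (measurable_coord i) s)
      (abs_sqCov_tilt_le hB hs (measurable_coord i) (hc i))
  have intCC : ∀ s, 0 ≤ s → ∀ i j, Integrable (fun z => partFun μ s (√s • z) *
      sqCov (tilt μ s (√s • z)) (fun x => x i * x j)) (stdGaussian (E d)) := fun s hs i j =>
    integrable_partFun_mul hB hs (F := fun ν => sqCov ν fun x => x i * x j)
      (measurable_sqCov_tilt (hmm i j) s) (abs_sqCov_tilt_le hB hs (hmm i j) (hcc i j))
  have intU : ∀ s, 0 ≤ s → Integrable (fun z => ∑ i, ∑ j, partFun μ s (√s • z) *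
      (∫ x, x i * x j ∂(tilt μ s (√s • z))) ^ 2) (stdGaussian (E d)) := fun s hs =>
    integrable_finsetSum _ fun i _ => integrable_finsetSum _ fun j _ =>
      integrable_partFun_mul hB hs (F := fun ν => (∫ x, x i * x j ∂ν) ^ 2) (mF s (hmm i j))
        fun y => abs_sq_integral_tilt_le hB hs (hcc i j) y
  have boundM : ∀ s, 0 ≤ s → ∑ i, postMean μ s (fun ν => sqCov ν fun x => x i) ≤
      postMean μ s (fun ν => ∑ i, ∑ j, (∫ x, x i * x j ∂ν) ^ 2) := by
    intro s hs
    simp only [postMean, Finset.mul_sum]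
    rw [← integral_finsetSum _ fun i _ => intC s hs i]
    refine integral_mono (integrable_finsetSum _ fun i _ => intC s hs i) (intU s hs) fun z => ?_
    have := isProbabilityMeasure_tilt hB hs (√s • z)
    have k := mul_le_mul_of_nonneg_left (sum_sqCov_coord_le (ae_tilt hB s (√s • z)))
      (partFun_pos hB hs (√s • z)).le
    simpa only [Finset.mul_sum] using k
  have boundU : ∀ s, 0 ≤ s → ∑ i, ∑ j, postMean μ s (fun ν => sqCov ν fun x => x i * x j) ≤
      4 * R ^ 6 := by
    intro s hs
    have iN := integrable_partFun_mul hB hs (F := fun ν => ∫ x, ‖x‖ ^ 2 ∂ν)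
      (measurable_integral_tilt (by fun_prop) s) (c := (2 * R) ^ 2) fun y => by
        have := isProbabilityMeasure_tilt hB hs y
        exact abs_integral_le _ (ae_tilt hn2b s y)
    have e1 : ∑ i, ∑ j, postMean μ s (fun ν => sqCov ν fun x => x i * x j) ≤
        (2 * R) ^ 2 * R ^ 2 * postMean μ s (fun ν => ∫ x, ‖x‖ ^ 2 ∂ν) := by
      simp only [postMean]
      rw [← integral_const_mul]
      simp_rw [← integral_finsetSum _ fun j _ => intCC s hs _ j]
      rw [← integral_finsetSum _ fun i _ => integrable_finsetSum _ fun j _ => intCC s hs i j]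
      refine integral_mono (integrable_finsetSum _ fun i _ => integrable_finsetSum _ fun j _ =>
        intCC s hs i j) (iN.const_mul _) fun z => ?_
      have := isProbabilityMeasure_tilt hB hs (√s • z)
      have k := mul_le_mul_of_nonneg_left (sum_sqCov_mul_le (ae_tilt hB s (√s • z))
        (ae_tilt hR s (√s • z))) (partFun_pos hB hs (√s • z)).le
      simp only [Finset.mul_sum] at k
      refine k.trans_eq ?_
      ring
    rw [postMean_integral hB hs (by fun_prop) hn2b] at e1
    calc _ ≤ _ := e1
      _ ≤ (2 * R) ^ 2 * R ^ 2 * R ^ 2 := mul_le_mul_of_nonneg_left hvar (by positivity)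
      _ = _ := by ring
  have hU : ∀ s h, 0 ≤ s → 0 ≤ h → h ≤ 1 →
      postMean μ (s + h) (fun ν => ∑ i, ∑ j, (∫ x, x i * x j ∂ν) ^ 2) ≤
      postMean μ s (fun ν => ∑ i, ∑ j, (∫ x, x i * x j ∂ν) ^ 2) + h * (4 * R ^ 6) +
        A * (h * √h) := by
    intro s h hs h0 h1
    rw [sumU s hs, sumU _ (add_nonneg hs h0)]
    have k := Finset.sum_le_sum fun i (_ : i ∈ Finset.univ) =>
      Finset.sum_le_sum fun j (_ : j ∈ Finset.univ) =>
        postMean_sq_integral_add_le hB hB0 hs h0 h1 (hmm i j) (hcc i j) (by positivity)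
    simp only [Finset.sum_add_distrib, ← Finset.mul_sum, Finset.sum_const, Finset.card_univ,
      Fintype.card_fin, nsmul_eq_mul] at k
    have k1 := mul_le_mul_of_nonneg_left (boundU s hs) h0
    have k2 := mul_le_mul_of_nonneg_right hA2 (by positivity : 0 ≤ h * √h)
    rw [hec] at k2
    linarith
  have hM : ∀ s h, 0 ≤ s → 0 ≤ h → h ≤ 1 →
      postMean μ (s + h) (fun ν => ∑ k, (∫ x, x k ∂ν) ^ 2) ≤
      postMean μ s (fun ν => ∑ k, (∫ x, x k ∂ν) ^ 2) +
        h * postMean μ s (fun ν => ∑ i, ∑ j, (∫ x, x i * x j ∂ν) ^ 2) + A * (h * √h) := by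
    intro s h hs h0 h1
    rw [sumM s hs, sumM _ (add_nonneg hs h0)]
    have k := Finset.sum_le_sum fun i (_ : i ∈ Finset.univ) =>
        postMean_sq_integral_add_le hB hB0 hs h0 h1 (measurable_coord i) (hc i) hB0
    simp only [Finset.sum_add_distrib, ← Finset.mul_sum, Finset.sum_const, Finset.card_univ,
      Fintype.card_fin, nsmul_eq_mul] at k
    have k1 := mul_le_mul_of_nonneg_left (boundM s hs) h0
    have k2 := mul_le_mul_of_nonneg_right hA1 (by positivity : 0 ≤ h * √h)
    rw [hec] at k2
    linarith
  have hK : ∀ s h, 0 ≤ s → 0 ≤ h → h ≤ 1 → signalKL μ (s + h) ≤ signalKL μ s +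
      h / 2 * postMean μ s (fun ν => ∑ k, (∫ x, x k ∂ν) ^ 2) + A * (h * √h) := by
    intro s h hs h0 h1
    have k := signalKL_add_le hB hB0 hs h0 h1
    have k2 := mul_le_mul_of_nonneg_right hA3 (by positivity : 0 ≤ h * √h)
    rw [hec] at k2
    linarith
  have := le_of_nested_increments (a := ∑ i, ∑ j, (∫ x, x i * x j ∂μ) ^ 2) hA0
    (Finset.sum_nonneg fun i _ => Finset.sum_nonneg fun j _ => sq_nonneg _)
    (by positivity) hU hM hK (postMean_zero _).le
    (by rw [postMean_zero]; simp [hμ]) signalKL_zero.le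
  linarith

/-! ### Gaussian mixtures with bounded centres -/

section Mixture

open InformationTheory

variable {d : ℕ}

/-- The mean of a law on `ℝ^d`. -/
noncomputable def meanVec (κ : Measure (E d)) : E d := WithLp.toLp 2 fun i => ∫ x, x i ∂κ

/-- The covariance matrix of a law on `ℝ^d`. -/
noncomputable def covMat (κ : Measure (E d)) : Matrix (Fin d) (Fin d) ℝ :=
  Matrix.of fun i j => ∫ x, (x i - meanVec κ i) * (x j - meanVec κ j) ∂κ

@[simp]
lemma meanVec_apply (κ : Measure (E d)) (i : Fin d) : meanVec κ i = ∫ x, x i ∂κ := rfl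

lemma covMat_apply (κ : Measure (E d)) (i j : Fin d) :
    covMat κ i j = ∫ x, (x i - meanVec κ i) * (x j - meanVec κ j) ∂κ := rfl

variable {κ : Measure (E d)} [IsProbabilityMeasure κ] {R : ℝ}

lemma integrable_sub_mul_sub (hR : ∀ᵐ x ∂κ, ‖x‖ ≤ R) (μ : E d) (i j : Fin d) :
    Integrable (fun x : E d => (x i - μ i) * (x j - μ j)) κ := by
  refine integrable_of_abs_le (by fun_prop) (W := (R + |μ i|) * (R + |μ j|)) ?_
  filter_upwards [hR] with x hx
  rw [abs_mul]
  have hi := (abs_sub (x i) (μ i)).trans (add_le_add_left (abs_coord_le hx i) _)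
  have hj := (abs_sub (x j) (μ j)).trans (add_le_add_left (abs_coord_le hx j) _)
  exact mul_le_mul hi hj (abs_nonneg _) ((abs_nonneg _).trans hi)

lemma integral_sub_mul_sub (hR : ∀ᵐ x ∂κ, ‖x‖ ≤ R) (μ : E d) (i j : Fin d) :
    ∫ x, (x i - μ i) * (x j - μ j) ∂κ =
      covMat κ i j + (meanVec κ i - μ i) * (meanVec κ j - μ j) := by
  have e : ∀ x : E d, (x i - μ i) * (x j - μ j) =
      (x i - meanVec κ i) * (x j - meanVec κ j) +
        ((meanVec κ i - μ i) * (x j - meanVec κ j) + (meanVec κ j - μ j) * (x i - meanVec κ i) +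
          (meanVec κ i - μ i) * (meanVec κ j - μ j)) := fun x => by ring
  have hI : ∀ k, Integrable (fun x : E d => x k - meanVec κ k) κ := fun k =>
    (integrable_coord hR k).sub (integrable_const _)
  have h0 : ∀ k, ∫ x : E d, (x k - meanVec κ k) ∂κ = 0 := fun k => by
    rw [integral_sub (integrable_coord hR k) (integrable_const _)]; simp
  rw [integral_congr_ae (ae_of_all _ e), integral_add (integrable_sub_mul_sub hR _ i j)
    ((((hI j).const_mul _).fun_add ((hI i).const_mul _)).fun_add (integrable_const _)),
    integral_add (((hI j).const_mul _).fun_add ((hI i).const_mul _)) (integrable_const _),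
    integral_add ((hI j).const_mul _) ((hI i).const_mul _), integral_const_mul, integral_const_mul,
    h0, h0, ← covMat_apply, integral_const, probReal_univ, one_smul, mul_zero, mul_zero, add_zero,
    zero_add]

lemma covMat_comm (κ : Measure (E d)) (i j : Fin d) : covMat κ i j = covMat κ j i := by
  simp only [covMat_apply, mul_comm]

lemma integrable_quad_sub (hR : ∀ᵐ x ∂κ, ‖x‖ ≤ R) (P : Matrix (Fin d) (Fin d) ℝ) (μ : E d) :
    Integrable (fun x => quad P (x - μ)) κ := by
  simp_rw [quad_eq_sum, PiLp.sub_apply]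
  exact integrable_finsetSum _ fun i _ => integrable_finsetSum _ fun j _ =>
    (integrable_sub_mul_sub hR μ i j).const_mul _

lemma integral_quad_sub (hR : ∀ᵐ x ∂κ, ‖x‖ ≤ R) (P : Matrix (Fin d) (Fin d) ℝ) (μ : E d) :
    ∫ x, quad P (x - μ) ∂κ = (P * covMat κ).trace + quad P (meanVec κ - μ) := by
  have hI : ∀ i j, Integrable (fun x : E d => P i j * ((x i - μ i) * (x j - μ j))) κ :=
    fun i j => (integrable_sub_mul_sub hR μ i j).const_mul _
  simp_rw [quad_eq_sum, PiLp.sub_apply]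
  rw [integral_finsetSum _ fun i _ => integrable_finsetSum _ fun j _ => hI i j]
  simp_rw [integral_finsetSum _ fun j _ => hI _ j, integral_const_mul,
    integral_sub_mul_sub hR, mul_add, Finset.sum_add_distrib]
  congr 1
  simp only [Matrix.trace, Matrix.diag_apply, Matrix.mul_apply, covMat_comm κ]

lemma posSemidef_covMat (hR : ∀ᵐ x ∂κ, ‖x‖ ≤ R) : (covMat κ).PosSemidef := by
  refine Matrix.PosSemidef.of_dotProduct_mulVec_nonneg ?_ fun v => ?_
  · ext i j
    simp [covMat_comm κ i j]
  · have h := integral_quad_sub hR (Matrix.of fun i j => v i * v j) (meanVec κ)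
    have e : ∀ w : E d, quad (Matrix.of fun i j => v i * v j) w = (∑ i, v i * w i) ^ 2 := by
      intro w
      rw [quad_eq_sum, sq, Finset.sum_mul_sum]
      exact Finset.sum_congr rfl fun i _ => Finset.sum_congr rfl fun j _ => by
        simp only [Matrix.of_apply]; ring
    have h0 : 0 ≤ ∫ x, quad (Matrix.of fun i j => v i * v j) (x - meanVec κ) ∂κ :=
      integral_nonneg fun x => by rw [e]; positivity
    rw [h, e, sub_self] at h0
    simp only [PiLp.zero_apply, mul_zero, Finset.sum_const_zero, ne_eq, OfNat.ofNat_ne_zero,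
      not_false_eq_true, zero_pow, add_zero, Matrix.trace, Matrix.diag_apply, Matrix.mul_apply,
      Matrix.of_apply] at h0
    refine h0.trans_eq ?_
    simp only [dotProduct, Matrix.mulVec, Finset.mul_sum, star_trivial]
    exact Finset.sum_congr rfl fun i _ => Finset.sum_congr rfl fun j _ => by
      rw [covMat_comm]; ring

lemma posDef_one_add_covMat (hR : ∀ᵐ x ∂κ, ‖x‖ ≤ R) : (1 + covMat κ).PosDef :=
  posDef_one.add_posSemidef (posSemidef_covMat hR)

lemma trace_covMat_le (hR : ∀ᵐ x ∂κ, ‖x‖ ≤ R) : (covMat κ).trace ≤ R ^ 2 := by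
  have := sum_variance_le hR (c := 0) (R := R) (by simpa using hR)
  refine le_trans (le_of_eq ?_) this
  simp only [Matrix.trace, Matrix.diag_apply, covMat_apply, meanVec_apply, sq]

/-- The mean divergence of the standard Gaussian laws with centre `x ∼ κ` from a fixed Gaussian
law only involves the first two moments of `κ`. -/
lemma lintegral_klDiv_gaussian (hR : ∀ᵐ x ∂κ, ‖x‖ ≤ R) (μ : E d) {S : Matrix (Fin d) (Fin d) ℝ}
    (hS : S.PosDef) :
    ∫⁻ x, klDiv (multivariateGaussian x 1) (multivariateGaussian μ S) ∂κ =
      ENNReal.ofReal (((S⁻¹ * (1 + covMat κ)).trace + quad S⁻¹ (meanVec κ - μ) +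
        Real.log S.det - d) / 2) := by
  have h0 : 0 ≤ S⁻¹.trace + Real.log S.det - d := by
    simpa using log_det_le_trace_inv_mul hS posDef_one
  have hI := integrable_quad_sub hR S⁻¹ μ
  simp_rw [klDiv_multivariateGaussian _ μ hS]
  have e : ∀ x, (S⁻¹.trace + quad S⁻¹ (x - μ) + Real.log S.det - d) / 2 =
      quad S⁻¹ (x - μ) * (1 / 2) + (S⁻¹.trace + Real.log S.det - d) / 2 := fun x => by ring
  simp_rw [e]
  rw [← ofReal_integral_eq_lintegral_ofReal ((hI.mul_const _).fun_add (integrable_const _))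
    (ae_of_all _ fun x => ?_), integral_add (hI.mul_const _) (integrable_const _),
    integral_mul_const, integral_quad_sub hR]
  · congr 1
    rw [mul_add, Matrix.trace_add, mul_one]
    simp only [integral_const, probReal_univ, smul_eq_mul, one_mul]
    ring
  · have := quad_nonneg hS.inv.posSemidef (x - μ)
    simp only [Pi.zero_apply]
    linarith

/-- The best Gaussian approximation of a mixture: for moment matching, the mean divergence is
`log det (1 + C) / 2`. -/
lemma lintegral_klDiv_gaussian_moments (hR : ∀ᵐ x ∂κ, ‖x‖ ≤ R) :
    ∫⁻ x, klDiv (multivariateGaussian x 1)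
      (multivariateGaussian (meanVec κ) (1 + covMat κ)) ∂κ =
      ENNReal.ofReal (Real.log (1 + covMat κ).det / 2) := by
  have hV := posDef_one_add_covMat hR
  rw [lintegral_klDiv_gaussian hR _ hV, Matrix.nonsing_inv_mul _
    ((Matrix.isUnit_iff_isUnit_det _).1 hV.isUnit)]
  simp [quad_eq_sum]

lemma lintegral_klDiv_gaussian_moments_le (hR : ∀ᵐ x ∂κ, ‖x‖ ≤ R) (μ : E d)
    {S : Matrix (Fin d) (Fin d) ℝ} (hS : S.PosSemidef) :
    ∫⁻ x, klDiv (multivariateGaussian x 1)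
      (multivariateGaussian (meanVec κ) (1 + covMat κ)) ∂κ ≤
    ∫⁻ x, klDiv (multivariateGaussian x 1) (multivariateGaussian μ S) ∂κ := by
  by_cases hS' : S.PosDef
  · rw [lintegral_klDiv_gaussian_moments hR, lintegral_klDiv_gaussian hR _ hS']
    refine ENNReal.ofReal_le_ofReal ?_
    have h1 := log_det_le_trace_inv_mul hS' (posDef_one_add_covMat hR)
    have h2 := quad_nonneg hS'.inv.posSemidef (meanVec κ - μ)
    linarith
  · simp [klDiv_multivariateGaussian_of_not_posDef _ _ hS hS']

lemma lintegral_klDiv_gaussian_moments_le_ofReal (hR : ∀ᵐ x ∂κ, ‖x‖ ≤ R) :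
    ∫⁻ x, klDiv (multivariateGaussian x 1)
      (multivariateGaussian (meanVec κ) (1 + covMat κ)) ∂κ ≤ ENNReal.ofReal (R ^ 2 / 2) := by
  rw [lintegral_klDiv_gaussian_moments hR]
  refine ENNReal.ofReal_le_ofReal ?_
  have h := log_det_le_trace_sub (posDef_one_add_covMat hR)
  rw [Matrix.trace_add, Matrix.trace_one, Fintype.card_fin] at h
  linarith [trace_covMat_le hR]

/-- The kernel `x ↦ N(c + b x, v I)`. -/
noncomputable def affineKernel (c : E d) (b v : ℝ) : Kernel (E d) (E d) :=
  gaussianKernel (fun x => c + b • x) (fun _ => v • (1 : Matrix (Fin d) (Fin d) ℝ))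
    (by fun_prop) (fun _ _ => measurable_const)

instance (c : E d) (b v : ℝ) : IsMarkovKernel (affineKernel c b v) := by
  unfold affineKernel; infer_instance

lemma affineKernel_apply (c : E d) (b v : ℝ) (x : E d) :
    affineKernel c b v x = multivariateGaussian (c + b • x) (v • 1) := rfl

lemma affineKernel_one_apply (x : E d) :
    affineKernel 0 1 1 x = multivariateGaussian x 1 := by
  simp [affineKernel_apply]

/-- The density of a Gaussian mixture relative to the Gaussian law with the same mean is the
partition function of the centred mixing law. -/
lemma mixture_eq_withDensity (κ : Measure (E d)) [IsProbabilityMeasure κ] (m : E d) :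
    affineKernel 0 1 1 ∘ₘ κ = (multivariateGaussian m 1).withDensity fun y =>
      ∫⁻ x, ENNReal.ofReal (Real.exp (pot 1 (y - m) (x - m))) ∂κ := by
  have hpot : Measurable fun p : E d × E d => pot 1 (p.2 - m) (p.1 - m) := by
    unfold pot; fun_prop
  ext A hA
  rw [Measure.bind_apply hA (Kernel.aemeasurable _), withDensity_apply _ hA,
    lintegral_lintegral_swap (f := fun y x => ENNReal.ofReal (Real.exp (pot 1 (y - m) (x - m))))
      (hpot.exp.ennreal_ofReal.comp measurable_swap).aemeasurable]
  refine lintegral_congr fun x => ?_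
  rw [affineKernel_one_apply,
    multivariateGaussian_eq_withDensity_multivariateGaussian x m posDef_one,
    withDensity_apply _ hA]
  refine lintegral_congr fun y => ?_
  congr 2
  have e : y - x = (y - m) - (x - m) := by abel
  rw [inv_one, quad_one, Matrix.det_one, Real.log_one, e, norm_sub_sq_real (y - m), pot,
    real_inner_comm]
  ring

/-- The divergence of a mixture from a standard Gaussian law with centre `m`, as that of the mixture
with centres shifted by `-m` from the centred one. -/
lemma klDiv_mixture_shift (hR : ∀ᵐ x ∂κ, ‖x‖ ≤ R) (m : E d) :
    klDiv (affineKernel 0 1 1 ∘ₘ κ) (multivariateGaussian m 1) =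
      ENNReal.ofReal (signalKL (κ.map fun x => x - m) 1) := by
  have hm : Measurable fun x : E d => x - m := by fun_prop
  set μ := κ.map fun x => x - m with hμ
  have : IsProbabilityMeasure μ := Measure.isProbabilityMeasure_map hm.aemeasurable
  have hB : ∀ᵐ x ∂μ, ‖x‖ ≤ R + ‖m‖ := by
    rw [hμ, ae_map_iff hm.aemeasurable (measurableSet_le (by fun_prop) measurable_const)]
    filter_upwards [hR] with x hx
    exact (norm_sub_le _ _).trans (by gcongr)
  have hmp := measurable_partFun (μ := μ) (s := 1)
  have hZ : ∀ y, partFun μ 1 (y - m) = ∫ x, Real.exp (pot 1 (y - m) (x - m)) ∂κ := fun y => by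
    rw [partFun, hμ, integral_map hm.aemeasurable]
    exact (by unfold pot; fun_prop :
      Measurable fun x => Real.exp (pot 1 (y - m) x)).aestronglyMeasurable
  have hpos : ∀ y, 0 < partFun μ 1 y := partFun_pos hB zero_le_one
  have hint : ∀ y, Integrable (fun x => Real.exp (pot 1 (y - m) (x - m))) κ := fun y => by
    have := integrable_exp_pot hB zero_le_one (y - m)
    exact this.comp_measurable hm
  have hden : (affineKernel 0 1 1 ∘ₘ κ) = (multivariateGaussian m 1).withDensity fun y =>
      ENNReal.ofReal (Real.exp (Real.log (partFun μ 1 (y - m)))) := by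
    rw [mixture_eq_withDensity κ m]
    congr 1
    funext y
    rw [Real.exp_log (hpos _), hZ, ofReal_integral_eq_lintegral_ofReal (hint y)
      (ae_of_all _ fun x => (Real.exp_pos _).le)]
  have hg : Measurable fun y => Real.log (partFun μ 1 (y - m)) :=
    Real.measurable_log.comp (hmp.comp hm)
  have hi := integrable_partFun_mul_log hB zero_le_one
  have hmz : Measurable fun z : E d => z + m := by fun_prop
  have hdm : Measurable fun y => ENNReal.ofReal (Real.exp (Real.log (partFun μ 1 (y - m)))) := by
    fun_prop
  rw [klDiv_withDensity_exp _ _ hg hden]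
  · congr 1
    rw [hden, integral_withDensity_eq_integral_toReal_smul hdm
        (ae_of_all _ fun _ => ENNReal.ofReal_lt_top),
      multivariateGaussian_one, integral_map hmz.aemeasurable]
    · simp only [signalKL]
      refine integral_congr_ae (ae_of_all _ fun z => ?_)
      simp [Real.exp_log (hpos _), (hpos _).le]
    · exact (by fun_prop : Measurable _).aestronglyMeasurable
  · rw [hden, integrable_withDensity_iff_integrable_smul' hdm
        (ae_of_all _ fun _ => ENNReal.ofReal_lt_top),
      multivariateGaussian_one, integrable_map_measure
        (by fun_prop : Measurable _).aestronglyMeasurable hmz.aemeasurable]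
    refine hi.congr (ae_of_all _ fun z => ?_)
    simp [Real.exp_log (hpos _), (hpos _).le]

/-- A Gaussian mixture with centres in a ball of radius `R` is within `R⁶ / 2` of the Gaussian law
with the same mean and covariance. The first and second order terms of the expansion in the
covariance cancel. -/
lemma klDiv_mixture_le (hR : ∀ᵐ x ∂κ, ‖x‖ ≤ R) :
    klDiv (affineKernel 0 1 1 ∘ₘ κ) (multivariateGaussian (meanVec κ) (1 + covMat κ)) ≤
      ENNReal.ofReal (R ^ 6 / 2) := by
  have hR0 : 0 ≤ R := by
    obtain ⟨x, hx⟩ := hR.exists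
    exact (norm_nonneg x).trans hx
  set m := meanVec κ with hm
  have hmm : Measurable fun x : E d => x - m := by fun_prop
  have hmR : ‖m‖ ≤ R := by
    have e : m = ∫ x, x ∂κ := by
      have hI : Integrable (fun x : E d => x) κ :=
        (integrable_const R).mono' (by fun_prop) hR
      ext i
      exact ((EuclideanSpace.proj (𝕜 := ℝ) i).integral_comp_comm hI)
    rw [e]
    simpa using norm_integral_le_of_norm_le_const hR
  -- the mixture is compared with both Gaussian laws through the same mean divergence `J`
  have c1 := lintegral_klDiv_eq_add κ (affineKernel 0 1 1) (multivariateGaussian m 1)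
  have c2 := lintegral_klDiv_eq_add κ (affineKernel 0 1 1)
    (multivariateGaussian m (1 + covMat κ))
  simp only [affineKernel_one_apply] at c1 c2
  rw [lintegral_klDiv_gaussian_moments hR] at c2
  rw [lintegral_klDiv_gaussian hR m posDef_one, klDiv_mixture_shift hR] at c1
  set J := ∫⁻ x, klDiv (multivariateGaussian x 1) (affineKernel 0 1 1 ∘ₘ κ) ∂κ
  have hsig : signalKL (κ.map fun x => x - m) 1 ≤ (covMat κ * covMat κ).trace / 4 + R ^ 6 / 3 := by
    have : IsProbabilityMeasure (κ.map fun x => x - m) :=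
      Measure.isProbabilityMeasure_map hmm.aemeasurable
    have h := signalKL_one_le (κ.map fun x => x - m) (R := R) (c := -m) hR0 ?_ ?_ ?_
    · refine h.trans_eq ?_
      congr 2
      simp only [Matrix.trace, Matrix.diag_apply, Matrix.mul_apply]
      refine Finset.sum_congr rfl fun i _ => Finset.sum_congr rfl fun j _ => ?_
      rw [covMat_comm κ j i, ← sq, covMat_apply,
        integral_map hmm.aemeasurable (by fun_prop : Measurable _).aestronglyMeasurable]
      rfl
    · rw [ae_map_iff hmm.aemeasurable (measurableSet_le (by fun_prop) measurable_const)]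
      simpa using hR
    · rw [ae_map_iff hmm.aemeasurable (measurableSet_le (by fun_prop) measurable_const)]
      filter_upwards [hR] with x hx
      exact (norm_sub_le _ _).trans (by linarith)
    · intro k
      rw [integral_map hmm.aemeasurable (by fun_prop : Measurable _).aestronglyMeasurable]
      simp only [PiLp.sub_apply]
      rw [integral_sub (integrable_coord hR k) (integrable_const _)]
      simp [hm]
  have htr := trace_covMat_le hR
  have hC := posSemidef_covMat hR
  have htr0 : 0 ≤ (covMat κ).trace := hC.trace_nonneg
  have hlog := log_det_one_add_le hC
  have htr3 : (covMat κ).trace ^ 3 ≤ R ^ 6 :=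
    (pow_le_pow_left₀ htr0 htr 3).trans_eq (by ring)
  have e1 : (((1 : Matrix (Fin d) (Fin d) ℝ)⁻¹ * (1 + covMat κ)).trace +
      quad (1 : Matrix (Fin d) (Fin d) ℝ)⁻¹ (meanVec κ - m) +
      Real.log (1 : Matrix (Fin d) (Fin d) ℝ).det - d) / 2 = (covMat κ).trace / 2 := by
    simp [hm, quad_eq_sum, Matrix.trace_add]
  rw [e1] at c1
  have hJ : J ≠ ∞ := by
    intro h
    rw [h, top_add] at c1
    exact ENNReal.ofReal_ne_top c1
  have hfin : ENNReal.ofReal (signalKL (κ.map fun x => x - m) 1) ≠ ∞ := ENNReal.ofReal_ne_top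
  have hk : klDiv (affineKernel 0 1 1 ∘ₘ κ) (multivariateGaussian m (1 + covMat κ)) ≠ ∞ := by
    intro h
    rw [h, add_top] at c2
    exact ENNReal.ofReal_ne_top c2
  have hs0 : ENNReal.ofReal (signalKL (κ.map fun x => x - m) 1) ≤
      ENNReal.ofReal ((covMat κ * covMat κ).trace / 4 + R ^ 6 / 3) := ENNReal.ofReal_le_ofReal hsig
  have hCC : 0 ≤ (covMat κ * covMat κ).trace / 4 + R ^ 6 / 3 := by
    have : 0 ≤ (covMat κ * covMat κ).trace := by
      simp only [Matrix.trace, Matrix.diag_apply, Matrix.mul_apply]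
      refine Finset.sum_nonneg fun i _ => Finset.sum_nonneg fun j _ => ?_
      rw [covMat_comm κ j i]
      exact mul_self_nonneg _
    positivity
  have r1 := congrArg ENNReal.toReal c1
  have r2 := congrArg ENNReal.toReal c2
  have hs1 := (ENNReal.toReal_mono ENNReal.ofReal_ne_top hs0)
  rw [ENNReal.toReal_ofReal hCC] at hs1
  rw [ENNReal.toReal_add hJ hfin, ENNReal.toReal_ofReal (by positivity)] at r1
  rw [ENNReal.toReal_add hJ hk] at r2
  rcases le_total 0 (Real.log (1 + covMat κ).det / 2) with hlog0 | hlog0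
  swap
  · rw [ENNReal.ofReal_of_nonpos hlog0] at c2
    rw [(add_eq_zero.1 c2.symm).2]
    exact zero_le
  rw [ENNReal.toReal_ofReal hlog0] at r2
  rw [← ENNReal.ofReal_toReal hk]
  refine ENNReal.ofReal_le_ofReal ?_
  linarith

end Mixture

/-! ### Affine changes of variables -/

section Affine

open InformationTheory

variable {d : ℕ} {κ : Measure (E d)} {R : ℝ}

/-- The Gaussian law with the mean and covariance of the mixture `affineKernel c b v ∘ₘ κ`. -/
noncomputable def momentMatch (c : E d) (b v : ℝ) (κ : Measure (E d)) : Measure (E d) :=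
  multivariateGaussian (c + b • meanVec κ) (v • 1 + b ^ 2 • covMat κ)

instance (c : E d) (b v : ℝ) (κ : Measure (E d)) : IsProbabilityMeasure (momentMatch c b v κ) := by
  unfold momentMatch; infer_instance

/-- The affine bijection `y ↦ c + r y`. -/
noncomputable def affineEquiv (c : E d) (r : ℝ) (hr : r ≠ 0) : E d ≃ᵐ E d where
  toFun y := c + r • y
  invFun y := r⁻¹ • (y - c)
  left_inv y := by simp [smul_smul, inv_mul_cancel₀ hr]
  right_inv y := by simp [smul_smul, mul_inv_cancel₀ hr]
  measurable_toFun := (by fun_prop : Measurable fun y : E d => c + r • y)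
  measurable_invFun := (by fun_prop : Measurable fun y : E d => r⁻¹ • (y - c))

lemma measurable_smul_left (r : ℝ) : Measurable fun x : E d => r • x := by fun_prop

lemma meanVec_map_smul (r : ℝ) : meanVec (κ.map fun x => r • x) = r • meanVec κ := by
  ext i
  rw [meanVec_apply, integral_map (measurable_smul_left r).aemeasurable
    (measurable_coord i).aestronglyMeasurable]
  simp [integral_const_mul]

lemma covMat_map_smul (r : ℝ) : covMat (κ.map fun x => r • x) = r ^ 2 • covMat κ := by
  ext i j
  rw [covMat_apply, meanVec_map_smul, integral_map (measurable_smul_left r).aemeasurable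
    (by fun_prop : Measurable _).aestronglyMeasurable, Matrix.smul_apply, covMat_apply,
    smul_eq_mul, ← integral_const_mul]
  refine integral_congr_ae (ae_of_all _ fun x => ?_)
  simp only [PiLp.smul_apply, smul_eq_mul]
  ring

lemma ae_norm_map_smul (hR : ∀ᵐ x ∂κ, ‖x‖ ≤ R) {r : ℝ} (hr : 0 ≤ r) :
    ∀ᵐ x ∂(κ.map fun x => r • x), ‖x‖ ≤ r * R := by
  rw [ae_map_iff (measurable_smul_left r).aemeasurable
    (measurableSet_le (by fun_prop) measurable_const)]
  filter_upwards [hR] with x hx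
  rw [norm_smul, Real.norm_eq_abs, abs_of_nonneg hr]
  gcongr

variable {r : ℝ}

lemma map_affineEquiv_gaussian (c : E d) (b : ℝ) (hr : 0 < r) (x : E d) :
    (multivariateGaussian ((b / r) • x) 1).map (affineEquiv c r hr.ne') =
      affineKernel c b (r ^ 2) x := by
  have h := map_affine_multivariateGaussian c ((b / r) • x) hr.le posDef_one.posSemidef
  rw [smul_smul, mul_div_cancel₀ b hr.ne'] at h
  exact h

lemma comp_affineKernel (c : E d) (b : ℝ) (hr : 0 < r) :
    affineKernel c b (r ^ 2) ∘ₘ κ =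
      (affineKernel 0 1 1 ∘ₘ (κ.map fun x => (b / r) • x)).map (affineEquiv c r hr.ne') := by
  ext A hA
  rw [MeasurableEquiv.map_apply, Measure.bind_apply hA (Kernel.aemeasurable _),
    Measure.bind_apply ((affineEquiv c r hr.ne').measurable hA) (Kernel.aemeasurable _),
    lintegral_map (Kernel.measurable_coe _ ((affineEquiv c r hr.ne').measurable hA))
      (measurable_smul_left _)]
  refine lintegral_congr fun x => ?_
  rw [affineKernel_one_apply, ← MeasurableEquiv.map_apply, map_affineEquiv_gaussian c b hr]

lemma lintegral_klDiv_affineKernel (c : E d) (b : ℝ) (hr : 0 < r) (p : Measure (E d))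
    [IsProbabilityMeasure p] :
    ∫⁻ x, klDiv (affineKernel c b (r ^ 2) x) (p.map (affineEquiv c r hr.ne')) ∂κ =
      ∫⁻ x, klDiv (multivariateGaussian x 1) p ∂(κ.map fun x => (b / r) • x) := by
  have hm : Measurable fun x => klDiv (multivariateGaussian x 1) p := by
    have := measurable_klDiv (affineKernel (d := d) 0 1 1) (Kernel.const (E d) p)
    simpa only [affineKernel_one_apply, Kernel.const_apply] using this
  rw [lintegral_map hm (measurable_smul_left _)]
  refine lintegral_congr fun x => ?_
  rw [← map_affineEquiv_gaussian c b hr, klDiv_map_equiv]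

variable [IsProbabilityMeasure κ]

lemma posSemidef_momentMatch {v : ℝ} (hv : 0 ≤ v) (b : ℝ) (hR : ∀ᵐ x ∂κ, ‖x‖ ≤ R) :
    (v • 1 + b ^ 2 • covMat κ).PosSemidef :=
  (posDef_one.posSemidef.smul hv).add ((posSemidef_covMat hR).smul (sq_nonneg b))

lemma map_affineEquiv_momentMatch (c : E d) (b : ℝ) (hr : 0 < r) (hR : ∀ᵐ x ∂κ, ‖x‖ ≤ R) :
    (multivariateGaussian (meanVec (κ.map fun x => (b / r) • x))
      (1 + covMat (κ.map fun x => (b / r) • x))).map (affineEquiv c r hr.ne') =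
      momentMatch c b (r ^ 2) κ := by
  have hP : (1 + (b / r) ^ 2 • covMat κ).PosSemidef :=
    posDef_one.posSemidef.add ((posSemidef_covMat hR).smul (sq_nonneg _))
  have h := map_affine_multivariateGaussian c ((b / r) • meanVec κ) hr.le hP
  rw [smul_smul, mul_div_cancel₀ b hr.ne', smul_add, smul_smul, ← mul_pow,
    mul_div_cancel₀ b hr.ne'] at h
  rw [meanVec_map_smul, covMat_map_smul]
  exact h

/-- Among all Gaussian laws, the one with matching moments minimizes the mean divergence. -/
lemma lintegral_klDiv_momentMatch_le (c : E d) {b : ℝ} (hb : 0 ≤ b) (hr : 0 < r)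
    (hR : ∀ᵐ x ∂κ, ‖x‖ ≤ R) (μ : E d) {S : Matrix (Fin d) (Fin d) ℝ} (hS : S.PosSemidef) :
    ∫⁻ x, klDiv (affineKernel c b (r ^ 2) x) (momentMatch c b (r ^ 2) κ) ∂κ ≤
      ∫⁻ x, klDiv (affineKernel c b (r ^ 2) x) (multivariateGaussian μ S) ∂κ := by
  have : IsProbabilityMeasure (κ.map fun x => (b / r) • x) :=
    Measure.isProbabilityMeasure_map (measurable_smul_left _).aemeasurable
  have hS' : ((r⁻¹) ^ 2 • S).PosSemidef := hS.smul (sq_nonneg _)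
  have e : multivariateGaussian μ S =
      (multivariateGaussian (r⁻¹ • (μ - c)) ((r⁻¹) ^ 2 • S)).map (affineEquiv c r hr.ne') := by
    have h := map_affine_multivariateGaussian c (r⁻¹ • (μ - c)) hr.le hS'
    rw [smul_smul, smul_smul, ← mul_pow, mul_inv_cancel₀ hr.ne', one_pow, one_smul, one_smul,
      add_sub_cancel] at h
    exact h.symm
  rw [e, ← map_affineEquiv_momentMatch c b hr hR, lintegral_klDiv_affineKernel c b hr,
    lintegral_klDiv_affineKernel c b hr]
  exact lintegral_klDiv_gaussian_moments_le (ae_norm_map_smul hR (by positivity)) _ hS'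

lemma lintegral_klDiv_momentMatch_le_ofReal (c : E d) {b : ℝ} (hb : 0 ≤ b) (hr : 0 < r)
    (hR : ∀ᵐ x ∂κ, ‖x‖ ≤ R) :
    ∫⁻ x, klDiv (affineKernel c b (r ^ 2) x) (momentMatch c b (r ^ 2) κ) ∂κ ≤
      ENNReal.ofReal ((b / r * R) ^ 2 / 2) := by
  have : IsProbabilityMeasure (κ.map fun x => (b / r) • x) :=
    Measure.isProbabilityMeasure_map (measurable_smul_left _).aemeasurable
  rw [← map_affineEquiv_momentMatch c b hr hR, lintegral_klDiv_affineKernel c b hr]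
  exact lintegral_klDiv_gaussian_moments_le_ofReal (ae_norm_map_smul hR (by positivity))

lemma klDiv_momentMatch_le (c : E d) {b : ℝ} (hb : 0 ≤ b) (hr : 0 < r)
    (hR : ∀ᵐ x ∂κ, ‖x‖ ≤ R) :
    klDiv (affineKernel c b (r ^ 2) ∘ₘ κ) (momentMatch c b (r ^ 2) κ) ≤
      ENNReal.ofReal ((b / r * R) ^ 6 / 2) := by
  have : IsProbabilityMeasure (κ.map fun x => (b / r) • x) :=
    Measure.isProbabilityMeasure_map (measurable_smul_left _).aemeasurable
  rw [← map_affineEquiv_momentMatch c b hr hR, comp_affineKernel c b hr, klDiv_map_equiv]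
  exact klDiv_mixture_le (ae_norm_map_smul hR (by positivity))

/-- The divergence of a Gaussian mixture with bounded centres from the standard Gaussian law is
finite. -/
lemma klDiv_comp_affineKernel_ne_top (c : E d) {b : ℝ} (hb : 0 ≤ b) (hr : 0 < r)
    (hR : ∀ᵐ x ∂κ, ‖x‖ ≤ R) :
    klDiv (affineKernel c b (r ^ 2) ∘ₘ κ) (multivariateGaussian 0 1) ≠ ∞ := by
  have : IsProbabilityMeasure (κ.map fun x => (b / r) • x) :=
    Measure.isProbabilityMeasure_map (measurable_smul_left _).aemeasurable
  have hr2 : 0 < (r⁻¹) ^ 2 := by positivity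
  have hS' : ((r⁻¹) ^ 2 • (1 : Matrix (Fin d) (Fin d) ℝ)).PosDef := posDef_one.smul hr2
  have e : multivariateGaussian (0 : E d) 1 =
      (multivariateGaussian (r⁻¹ • (0 - c)) ((r⁻¹) ^ 2 • 1)).map (affineEquiv c r hr.ne') := by
    have h := map_affine_multivariateGaussian c (r⁻¹ • (0 - c)) hr.le hS'.posSemidef
    rw [smul_smul, smul_smul, ← mul_pow, mul_inv_cancel₀ hr.ne', one_pow, one_smul, one_smul,
      add_sub_cancel] at h
    exact h.symm
  have h := lintegral_klDiv_eq_add κ (affineKernel c b (r ^ 2)) (multivariateGaussian 0 1)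
  rw [e, lintegral_klDiv_affineKernel c b hr,
    lintegral_klDiv_gaussian (ae_norm_map_smul hR (by positivity)) _ hS', ← e] at h
  intro htop
  rw [htop, add_top] at h
  exact ENNReal.ofReal_ne_top h

end Affine

/-! ### Conjugacy of Gaussian transitions -/

section Bayes

variable {d : ℕ}

/-- The product of two standard Gaussian laws is invariant under the reflections
`(z, w) ↦ (c z + s w, s z - c w)`. -/
lemma map_reflect_stdGaussian {c s : ℝ} (h : c ^ 2 + s ^ 2 = 1) :
    ((stdGaussian (E d)).prod (stdGaussian (E d))).map
      (fun p => (c • p.1 + s • p.2, s • p.1 - c • p.2)) =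
      (stdGaussian (E d)).prod (stdGaussian (E d)) := by
  set π := (stdGaussian (E d)).prod (stdGaussian (E d)) with hπ
  have hm : Measurable fun p : E d × E d => (c • p.1 + s • p.2, s • p.1 - c • p.2) := by fun_prop
  have : IsProbabilityMeasure (π.map fun p => (c • p.1 + s • p.2, s • p.1 - c • p.2)) :=
    Measure.isProbabilityMeasure_map hm.aemeasurable
  refine (MeasurableEquiv.toLp 2 (E d × E d)).map_measurableEquiv_injective ?_
  refine Measure.ext_of_charFun ?_
  ext t
  rw [MeasurableEquiv.coe_toLp, hπ, charFun_prod, ← hπ, Measure.map_map (by fun_prop) hm, charFun,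
    integral_map (by fun_prop) (by fun_prop : Measurable _).aestronglyMeasurable]
  have e1 := charFun_prod (μ := stdGaussian (E d)) (ν := stdGaussian (E d))
    (t := WithLp.toLp 2 (c • t.ofLp.1 + s • t.ofLp.2, s • t.ofLp.1 - c • t.ofLp.2))
  rw [charFun, integral_map (by fun_prop) (by fun_prop : Measurable _).aestronglyMeasurable,
    ← hπ] at e1
  have e2 : ∀ p : E d × E d,
      inner ℝ ((WithLp.toLp 2 ∘ fun p : E d × E d => (c • p.1 + s • p.2, s • p.1 - c • p.2)) p) t =
      inner ℝ (WithLp.toLp 2 p)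
        (WithLp.toLp 2 (c • t.ofLp.1 + s • t.ofLp.2, s • t.ofLp.1 - c • t.ofLp.2)) := by
    intro p
    simp only [WithLp.prod_inner_apply, Function.comp_apply, inner_add_left, inner_add_right,
      inner_sub_left, inner_sub_right, real_inner_smul_left, real_inner_smul_right]
    ring
  simp_rw [e2]
  rw [e1, charFun_stdGaussian, charFun_stdGaussian, charFun_stdGaussian, charFun_stdGaussian,
    ← Complex.exp_add, ← Complex.exp_add]
  congr 1
  simp only [← Complex.ofReal_pow]
  have e3 : ‖c • t.ofLp.1 + s • t.ofLp.2‖ ^ 2 + ‖s • t.ofLp.1 - c • t.ofLp.2‖ ^ 2 =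
      ‖t.ofLp.1‖ ^ 2 + ‖t.ofLp.2‖ ^ 2 := by
    rw [norm_add_sq_real, norm_sub_sq_real]
    simp only [norm_smul, mul_pow, Real.norm_eq_abs, sq_abs, real_inner_smul_left,
      real_inner_smul_right]
    linear_combination (‖t.ofLp.1‖ ^ 2 + ‖t.ofLp.2‖ ^ 2) * h
  have e4 := congrArg (fun x : ℝ => -(x : ℂ) / 2) e3
  push_cast at e4 ⊢
  linear_combination e4

lemma multivariateGaussian_smul_one (m : E d) {v : ℝ} (hv : 0 ≤ v) :
    multivariateGaussian m (v • 1) = (stdGaussian (E d)).map fun z => m + √v • z := by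
  have h := map_affine_multivariateGaussian m 0 (Real.sqrt_nonneg v)
    (posDef_one (d := d)).posSemidef
  rw [Real.sq_sqrt hv, smul_zero, add_zero, multivariateGaussian_zero_one] at h
  exact h.symm

lemma map_stdGaussian_compProd {f : E d → E d} (hf : Measurable f) (c : E d) (b : ℝ) {v : ℝ}
    (hv : 0 ≤ v) : (stdGaussian (E d)).map f ⊗ₘ affineKernel c b v =
      ((stdGaussian (E d)).prod (stdGaussian (E d))).map
        fun p => (f p.1, c + b • f p.1 + √v • p.2) := by
  have : IsProbabilityMeasure ((stdGaussian (E d)).map f) :=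
    Measure.isProbabilityMeasure_map hf.aemeasurable
  refine Measure.ext_of_lintegral _ fun g hg => ?_
  rw [Measure.lintegral_compProd hg, lintegral_map hg (by fun_prop),
    lintegral_prod _ (by fun_prop), lintegral_map (by fun_prop) hf]
  refine lintegral_congr fun z => ?_
  rw [affineKernel_apply, multivariateGaussian_smul_one _ hv, lintegral_map (by fun_prop)
    (by fun_prop)]

/-- Bayes' rule for a Gaussian prior and a Gaussian observation. -/
lemma gaussian_bayes (m : E d) (α : ℝ) {v w u : ℝ} (hv : 0 ≤ v) (hw : 0 < w)
    (hu : u = α ^ 2 * v + w) :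
    (multivariateGaussian m (v • 1) ⊗ₘ affineKernel 0 α w).map Prod.swap =
      multivariateGaussian (α • m) (u • 1) ⊗ₘ
        affineKernel ((w / u) • m) (α * v / u) (v * w / u) := by
  have hu0 : 0 < u := by rw [hu]; positivity
  have hσ : 0 ≤ v * w / u := by positivity
  rw [multivariateGaussian_smul_one m hv, multivariateGaussian_smul_one _ hu0.le,
    map_stdGaussian_compProd (by fun_prop) _ _ hw.le,
    map_stdGaussian_compProd (by fun_prop) _ _ hσ,
    Measure.map_map measurable_swap (by fun_prop)]
  have hc : (α * √v / √u) ^ 2 + (√w / √u) ^ 2 = 1 := by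
    rw [div_pow, div_pow, mul_pow, Real.sq_sqrt hv, Real.sq_sqrt hw.le, Real.sq_sqrt hu0.le,
      ← add_div, ← hu, div_self hu0.ne']
  have hsu : √u ≠ 0 := (Real.sqrt_pos.2 hu0).ne'
  have huu : √u * √u = u := Real.mul_self_sqrt hu0.le
  have hvv : √v * √v = v := Real.mul_self_sqrt hv
  have hww : √w * √w = w := Real.mul_self_sqrt hw.le
  -- reflect the two noises so that the observation only involves the first one
  nth_rw 1 [← map_reflect_stdGaussian (d := d) hc]
  rw [Measure.map_map (by fun_prop) (by fun_prop)]
  congr 1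
  funext p
  simp only [Function.comp_apply, Prod.swap_prod_mk, Prod.mk.injEq]
  have hσs : √(v * w / u) = √v * √w / √u := by
    rw [Real.sqrt_div (by positivity), Real.sqrt_mul hv]
  have k1 : α * √v * (α * √v / √u) + √w * (√w / √u) = √u := by
    field_simp
    linear_combination α ^ 2 * hvv + hww - huu - hu
  have k2 : α * √v * (√w / √u) = √w * (α * √v / √u) := by ring
  have k3 : w / u + α * v / u * α = 1 := by
    field_simp
    linear_combination -hu
  have k4 : √v * (α * √v / √u) = α * v / u * √u := by
    field_simp
    linear_combination α * u * hvv - α * v * huu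
  rw [hσs]
  constructor
  · ext i
    simp only [PiLp.add_apply, PiLp.smul_apply, PiLp.sub_apply, PiLp.zero_apply, smul_eq_mul]
    linear_combination p.1 i * k1 + p.2 i * k2
  · ext i
    simp only [PiLp.add_apply, PiLp.smul_apply, smul_eq_mul]
    linear_combination p.1 i * k4 - m i * k3

end Bayes

/-! ### The forward process -/

section Chain

variable {d : ℕ} (ν : Measure (E d)) (K : ℕ → Kernel (E d) (E d)) [∀ n, IsMarkovKernel (K n)]

lemma map_chainLaw_zero : (chainLaw ν K).map (fun x => x 0) = ν := by
  have h0 : (fun x : ℕ → E d => x 0) =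
      (fun y : Finset.Iic 0 → E d => y ⟨0, by simp⟩) ∘ Preorder.frestrictLe (π := fun _ => E d) 0 :=
    rfl
  rw [h0, ← Measure.map_map (measurable_pi_apply _) (by fun_prop), chainLaw, Kernel.trajMeasure,
    Measure.map_comp _ _ (by fun_prop), Kernel.traj_map_frestrictLe_of_le le_rfl,
    Measure.deterministic_comp_eq_map]
  refine (congrArg _ Measure.map_id).trans ?_
  rw [Measure.map_map (by fun_prop) (MeasurableEquiv.measurable _)]
  exact Measure.map_id

variable [IsProbabilityMeasure ν]

lemma map_chainLaw_succ (n : ℕ) :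
    (chainLaw ν K).map (fun x => (Preorder.frestrictLe n x, x (n + 1))) =
      (chainLaw ν K).map (Preorder.frestrictLe n) ⊗ₘ lastStep (K n) n :=
  (Kernel.map_frestrictLe_trajMeasure_compProd_eq_map_trajMeasure (X := fun _ => E d)
    (κ := fun n => lastStep (K n) n) (μ₀ := ν)).symm

lemma lintegral_chainLaw_succ (n : ℕ) {γ : Type*} [MeasurableSpace γ]
    {X : (Finset.Iic n → E d) → γ} (hX : Measurable X) {f : γ × E d → ℝ≥0∞} (hf : Measurable f) :
    ∫⁻ x, f (X (Preorder.frestrictLe n x), x (n + 1)) ∂(chainLaw ν K) =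
      ∫⁻ x, ∫⁻ y, f (X (Preorder.frestrictLe n x), y) ∂(K n (x n)) ∂(chainLaw ν K) := by
  have hg : Measurable fun p : (Finset.Iic n → E d) × E d => f (X p.1, p.2) := by fun_prop
  have hr : Measurable (Preorder.frestrictLe (π := fun _ => E d) n) := by fun_prop
  have h := congrArg (fun m => ∫⁻ p, f (X p.1, p.2) ∂m) (map_chainLaw_succ ν K n)
  beta_reduce at h
  rw [lintegral_map hg (by fun_prop), Measure.lintegral_compProd hg,
    lintegral_map hg.lintegral_kernel_prod_right' hr] at h
  exact h

end Chain

section Schedule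

variable {β : ℕ → ℝ} {T : ℕ}

lemma alphaBar_zero (β : ℕ → ℝ) : alphaBar β 0 = 1 := by simp [alphaBar]

lemma alphaBar_succ (β : ℕ → ℝ) (t : ℕ) : alphaBar β (t + 1) = alphaBar β t * (1 - β (t + 1)) := by
  rw [alphaBar, Finset.prod_Icc_succ_top (by omega)]; rfl

lemma alphaBar_pos (hβ : ∀ t ∈ Finset.Icc 1 T, β t ∈ Set.Ioo (0 : ℝ) 1) {t : ℕ} (ht : t ≤ T) :
    0 < alphaBar β t :=
  Finset.prod_pos fun s hs => by
    rw [Finset.mem_Icc] at hs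
    linarith [(hβ s (Finset.mem_Icc.2 ⟨hs.1, hs.2.trans ht⟩)).2]

lemma alphaBar_le_one (hβ : ∀ t ∈ Finset.Icc 1 T, β t ∈ Set.Ioo (0 : ℝ) 1) {t : ℕ} (ht : t ≤ T) :
    alphaBar β t ≤ 1 :=
  Finset.prod_le_one (fun s hs => by
    rw [Finset.mem_Icc] at hs
    linarith [(hβ s (Finset.mem_Icc.2 ⟨hs.1, hs.2.trans ht⟩)).2]) fun s hs => by
    rw [Finset.mem_Icc] at hs
    linarith [(hβ s (Finset.mem_Icc.2 ⟨hs.1, hs.2.trans ht⟩)).1]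

lemma alphaBar_lt_one (hβ : ∀ t ∈ Finset.Icc 1 T, β t ∈ Set.Ioo (0 : ℝ) 1) {t : ℕ}
    (ht : t + 1 ≤ T) : alphaBar β (t + 1) < 1 := by
  have h1 := hβ (t + 1) (Finset.mem_Icc.2 ⟨by omega, ht⟩)
  have h2 := alphaBar_le_one hβ (t := t) (by omega)
  have h3 := alphaBar_pos hβ (t := t) (by omega)
  rw [alphaBar_succ]
  nlinarith [h1.1]

/-- The coefficient of `x_{t+1}` in the mean of `q(x_t | x_{t+1}, x_0)`. -/
noncomputable def bridgeState (β : ℕ → ℝ) (t : ℕ) : ℝ :=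
  √(1 - β (t + 1)) * (1 - alphaBar β t) / (1 - alphaBar β (t + 1))

/-- The coefficient of `x_0` in the mean of `q(x_t | x_{t+1}, x_0)`. -/
noncomputable def bridgeData (β : ℕ → ℝ) (t : ℕ) : ℝ :=
  β (t + 1) / (1 - alphaBar β (t + 1)) * √(alphaBar β t)

/-- The standard deviation of `q(x_t | x_{t+1}, x_0)` in each direction. -/
noncomputable def bridgeStd (β : ℕ → ℝ) (t : ℕ) : ℝ :=
  √((1 - alphaBar β t) * β (t + 1) / (1 - alphaBar β (t + 1)))

lemma bridgeData_nonneg (hβ : ∀ t ∈ Finset.Icc 1 T, β t ∈ Set.Ioo (0 : ℝ) 1) {t : ℕ}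
    (ht : t + 1 ≤ T) : 0 ≤ bridgeData β t := by
  have h1 := (hβ (t + 1) (Finset.mem_Icc.2 ⟨by omega, ht⟩)).1
  have h2 := alphaBar_lt_one hβ ht
  exact mul_nonneg (div_nonneg h1.le (by linarith)) (Real.sqrt_nonneg _)

lemma bridgeVar_nonneg (hβ : ∀ t ∈ Finset.Icc 1 T, β t ∈ Set.Ioo (0 : ℝ) 1) {t : ℕ}
    (ht : t + 1 ≤ T) : 0 ≤ (1 - alphaBar β t) * β (t + 1) / (1 - alphaBar β (t + 1)) := by
  have h1 := (hβ (t + 1) (Finset.mem_Icc.2 ⟨by omega, ht⟩)).1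
  have h2 := alphaBar_lt_one hβ ht
  have h3 := alphaBar_le_one hβ (t := t) (by omega)
  exact div_nonneg (mul_nonneg (by linarith) h1.le) (by linarith)

lemma bridgeStd_pos (hβ : ∀ t ∈ Finset.Icc 1 T, β t ∈ Set.Ioo (0 : ℝ) 1) {t : ℕ}
    (ht : t + 2 ≤ T) : 0 < bridgeStd β (t + 1) := by
  have h1 := (hβ (t + 1 + 1) (Finset.mem_Icc.2 ⟨by omega, ht⟩)).1
  have h2 := alphaBar_lt_one hβ (t := t + 1) ht
  have h3 := alphaBar_lt_one hβ (t := t) (by omega)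
  exact Real.sqrt_pos.2 (div_pos (mul_pos (by linarith) h1) (by linarith))

/-- Given `x_{t+2}`, the point `x_{t+1}` is a Gaussian observation of `x_0` at signal-to-noise ratio
`γ_{t+1}`. -/
lemma sq_bridgeData_div_bridgeStd (hβ : ∀ t ∈ Finset.Icc 1 T, β t ∈ Set.Ioo (0 : ℝ) 1) {t : ℕ}
    (ht : t + 2 ≤ T) : (bridgeData β (t + 1) / bridgeStd β (t + 1)) ^ 2 = snrStep β (t + 1) := by
  have h1 := (hβ (t + 1 + 1) (Finset.mem_Icc.2 ⟨by omega, ht⟩)).1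
  have h2 := alphaBar_lt_one hβ (t := t + 1) ht
  have h3 := alphaBar_lt_one hβ (t := t) (by omega)
  have h4 := alphaBar_pos hβ (t := t + 1) (by omega)
  have h5 := bridgeVar_nonneg hβ (t := t + 1) ht
  have h6 := alphaBar_succ β (t + 1)
  rw [bridgeData, bridgeStd, div_pow, mul_pow, Real.sq_sqrt h4.le, Real.sq_sqrt h5, snrStep, snr,
    snr]
  have e2 : 1 - alphaBar β (t + 1 + 1) ≠ 0 := by linarith
  have e3 : 1 - alphaBar β (t + 1) ≠ 0 := by linarith
  have e1 := h1.ne'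
  field_simp
  rw [h6]
  ring

end Schedule

section Forward

variable {d T : ℕ} (q₀ : Measure (E d)) [IsProbabilityMeasure q₀] {β : ℕ → ℝ}

lemma forwardKernel_eq (b : ℝ) : forwardKernel d b = affineKernel 0 √(1 - b) b := by
  ext x
  simp [forwardKernel, affineKernel, gaussianKernel]

/-- The law of `x_t` given `x_0`. -/
noncomputable def noisyKernel (d : ℕ) (β : ℕ → ℝ) (t : ℕ) : Kernel (E d) (E d) :=
  affineKernel 0 √(alphaBar β t) (1 - alphaBar β t)

instance (t : ℕ) : IsMarkovKernel (noisyKernel d β t) := by unfold noisyKernel; infer_instance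

/-- Bayes' rule for `x_t` and `x_{t+1}`, given `x_0 = x`. -/
lemma noisyKernel_compProd (hβ : ∀ t ∈ Finset.Icc 1 T, β t ∈ Set.Ioo (0 : ℝ) 1) {t : ℕ}
    (ht : t + 1 ≤ T) (x : E d) :
    (noisyKernel d β t x ⊗ₘ forwardKernel d (β (t + 1))).map Prod.swap =
      noisyKernel d β (t + 1) x ⊗ₘ
        affineKernel (bridgeData β t • x) (bridgeState β t) (bridgeStd β t ^ 2) := by
  have h1 := hβ (t + 1) (Finset.mem_Icc.2 ⟨by omega, ht⟩)
  have h2 := alphaBar_le_one hβ (t := t) (by omega)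
  have h := gaussian_bayes (√(alphaBar β t) • x) √(1 - β (t + 1)) (v := 1 - alphaBar β t)
    (u := 1 - alphaBar β (t + 1)) (by linarith) h1.1 (by
      rw [Real.sq_sqrt (by linarith [h1.2]), alphaBar_succ]; ring)
  rw [smul_smul, smul_smul, mul_comm, ← Real.sqrt_mul (alphaBar_pos hβ (by omega)).le,
    ← alphaBar_succ] at h
  rw [noisyKernel, noisyKernel, affineKernel_apply, affineKernel_apply, zero_add, zero_add,
    forwardKernel_eq, bridgeStd, Real.sq_sqrt (bridgeVar_nonneg hβ ht)]
  exact h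

lemma lintegral_forwardLaw_succ {t : ℕ}
    (h : (forwardLaw q₀ β).map (fun x => (x 0, x t)) = q₀ ⊗ₘ noisyKernel d β t)
    {f : E d × E d × E d → ℝ≥0∞} (hf : Measurable f) :
    ∫⁻ x, f (x 0, x t, x (t + 1)) ∂(forwardLaw q₀ β) =
      ∫⁻ x, ∫⁻ p, f (x, p) ∂(noisyKernel d β t x ⊗ₘ forwardKernel d (β (t + 1))) ∂q₀ := by
  have h1 := lintegral_chainLaw_succ q₀ (fun n => forwardKernel d (β (n + 1))) t
    (X := fun y => (y ⟨0, by simp⟩, y ⟨t, by simp⟩)) (by fun_prop)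
    (f := fun p => f (p.1.1, p.1.2, p.2)) (by fun_prop)
  have hm : Measurable fun p : E d × E d =>
      ∫⁻ y, f (p.1, p.2, y) ∂(forwardKernel d (β (t + 1)) p.2) :=
    (by fun_prop : Measurable fun p : (E d × E d) × E d => f (p.1.1, p.1.2, p.2)
      ).lintegral_kernel_prod_right' (κ := Kernel.prodMkLeft (E d) (forwardKernel d (β (t + 1))))
  refine h1.trans ?_
  have h2 := congrArg (fun m => ∫⁻ p, ∫⁻ y, f (p.1, p.2, y) ∂(forwardKernel d (β (t + 1)) p.2) ∂m) h
  beta_reduce at h2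
  rw [lintegral_map hm (by fun_prop), Measure.lintegral_compProd hm] at h2
  refine h2.trans (lintegral_congr fun x => ?_)
  rw [Measure.lintegral_compProd (by fun_prop)]

/-- `lintegral_forwardLaw_succ` with the last two points sampled in reversed order. -/
lemma lintegral_forwardLaw_succ' (hβ : ∀ t ∈ Finset.Icc 1 T, β t ∈ Set.Ioo (0 : ℝ) 1) {t : ℕ}
    (ht : t + 1 ≤ T)
    (h : (forwardLaw q₀ β).map (fun x => (x 0, x t)) = q₀ ⊗ₘ noisyKernel d β t)
    {f : E d × E d × E d → ℝ≥0∞} (hf : Measurable f) :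
    ∫⁻ x, f (x 0, x (t + 1), x t) ∂(forwardLaw q₀ β) =
      ∫⁻ x, ∫⁻ v, ∫⁻ u, f (x, v, u)
        ∂(affineKernel (bridgeData β t • x) (bridgeState β t) (bridgeStd β t ^ 2) v)
        ∂(noisyKernel d β (t + 1) x) ∂q₀ := by
  rw [lintegral_forwardLaw_succ q₀ h (f := fun p => f (p.1, p.2.2, p.2.1)) (by fun_prop)]
  refine lintegral_congr fun x => ?_
  rw [← Measure.lintegral_compProd (f := fun p => f (x, p)) (by fun_prop),
    ← noisyKernel_compProd hβ ht, lintegral_map (by fun_prop) measurable_swap]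
  rfl

/-- The law of `x_t` given `x_0` is `N(√ᾱ_t x_0, (1 - ᾱ_t) I)`. -/
lemma map_forwardLaw (hβ : ∀ t ∈ Finset.Icc 1 T, β t ∈ Set.Ioo (0 : ℝ) 1) {t : ℕ} (ht : t ≤ T) :
    (forwardLaw q₀ β).map (fun x => (x 0, x t)) = q₀ ⊗ₘ noisyKernel d β t := by
  induction t with
  | zero =>
    -- a Gaussian law with covariance `0` is a Dirac mass
    have h0 : noisyKernel d β 0 = Kernel.id := by
      ext x : 1
      rw [noisyKernel, affineKernel_apply, alphaBar_zero, sub_self,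
        multivariateGaussian_smul_one _ le_rfl, Kernel.id_apply]
      simp
    rw [h0, Measure.compProd_id, ← map_chainLaw_zero q₀ (fun n => forwardKernel d (β (n + 1))),
      Measure.map_map (by fun_prop) (by fun_prop), map_chainLaw_zero]
    rfl
  | succ t ih =>
    refine Measure.ext_of_lintegral _ fun f hf => ?_
    rw [lintegral_map hf (by fun_prop), Measure.lintegral_compProd hf]
    refine (lintegral_forwardLaw_succ' q₀ hβ ht (ih (by omega)) (f := fun p => f (p.1, p.2.1))
      (by fun_prop)).trans ?_
    simp

/-- The kernel `(x_{t+1}, x_0) ↦ N(a x_{t+1} + b x_0, v I)`. -/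
noncomputable def bridgeKernel (d : ℕ) (a b v : ℝ) : Kernel (E d × E d) (E d) where
  toFun p := affineKernel (a • p.1) b v p.2
  measurable' := measurable_multivariateGaussian (by fun_prop) fun _ _ => measurable_const

lemma bridgeKernel_apply (a b v : ℝ) (p : E d × E d) :
    bridgeKernel d a b v p = affineKernel (a • p.1) b v p.2 := rfl

instance (a b v : ℝ) : IsMarkovKernel (bridgeKernel d a b v) :=
  ⟨fun p => by rw [bridgeKernel_apply]; infer_instance⟩

/-- Bayes' rule for the forward process. -/
lemma map_forwardLaw_bridge (hβ : ∀ t ∈ Finset.Icc 1 T, β t ∈ Set.Ioo (0 : ℝ) 1) {t : ℕ}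
    (ht : t + 1 ≤ T) :
    (forwardLaw q₀ β).map (fun x => ((x (t + 1), x 0), x t)) =
      (forwardLaw q₀ β).map (fun x => (x (t + 1), x 0)) ⊗ₘ
        bridgeKernel d (bridgeState β t) (bridgeData β t) (bridgeStd β t ^ 2) := by
  set K := bridgeKernel d (bridgeState β t) (bridgeData β t) (bridgeStd β t ^ 2) with hK
  refine Measure.ext_of_lintegral _ fun f hf => ?_
  have hm := hf.lintegral_kernel_prod_right' (κ := K)
  have hm' : Measurable fun p : E d × E d => ∫⁻ y, f (p.swap, y) ∂(K p.swap) :=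
    hm.comp measurable_swap
  have h1 := congrArg (fun m => ∫⁻ p, ∫⁻ y, f (p.swap, y) ∂(K p.swap) ∂m)
    (map_forwardLaw q₀ hβ ht)
  beta_reduce at h1
  rw [lintegral_map hm' (by fun_prop), Measure.lintegral_compProd hm'] at h1
  rw [lintegral_map hf (by fun_prop), Measure.lintegral_compProd hf,
    lintegral_map hm (by fun_prop)]
  refine (lintegral_forwardLaw_succ' q₀ hβ ht (map_forwardLaw q₀ hβ (by omega))
    (f := fun p => f ((p.2.1, p.1), p.2.2)) (by fun_prop)).trans (Eq.trans ?_ h1.symm)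
  refine lintegral_congr fun x => lintegral_congr fun v => ?_
  rw [Prod.swap_prod_mk, hK, bridgeKernel_apply, affineKernel_apply, affineKernel_apply, add_comm]

lemma posteriorGivenData_ae_eq (hβ : ∀ t ∈ Finset.Icc 1 T, β t ∈ Set.Ioo (0 : ℝ) 1) {t : ℕ}
    (ht : t + 1 ≤ T) : ∀ᵐ x ∂(forwardLaw q₀ β), posteriorGivenData q₀ β (t + 1) (x (t + 1), x 0) =
      affineKernel (bridgeState β t • x (t + 1)) (bridgeData β t) (bridgeStd β t ^ 2) (x 0) :=
  ae_of_ae_map (f := fun x : ℕ → E d => (x (t + 1), x 0)) (by fun_prop)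
    (condDistrib_ae_eq_of_measure_eq_compProd_of_measurable (by fun_prop) (by fun_prop)
      (map_forwardLaw_bridge q₀ hβ ht))

/-- The law of `x_0` given `x_t`. -/
noncomputable def dataPosterior (q₀ : Measure (E d)) [IsProbabilityMeasure q₀] (β : ℕ → ℝ)
    (t : ℕ) : Kernel (E d) (E d) :=
  condDistrib (fun x : ℕ → E d => x 0) (fun x => x t) (forwardLaw q₀ β)

instance (t : ℕ) : IsMarkovKernel (dataPosterior q₀ β t) := by
  unfold dataPosterior; infer_instance

lemma map_compProd_dataPosterior (t : ℕ) :
    (forwardLaw q₀ β).map (fun x => x t) ⊗ₘ dataPosterior q₀ β t =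
      (forwardLaw q₀ β).map fun x => (x t, x 0) :=
  compProd_map_condDistrib (measurable_pi_apply 0).aemeasurable

/-- The exact reverse transition is a mixture of Gaussian laws. -/
lemma exactReverse_ae_eq (hβ : ∀ t ∈ Finset.Icc 1 T, β t ∈ Set.Ioo (0 : ℝ) 1) {t : ℕ}
    (ht : t + 1 ≤ T) : ∀ᵐ v ∂((forwardLaw q₀ β).map fun x => x (t + 1)),
      exactReverse q₀ β (t + 1) v =
        affineKernel (bridgeState β t • v) (bridgeData β t) (bridgeStd β t ^ 2) ∘ₘ
          dataPosterior q₀ β (t + 1) v := by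
  set K := bridgeKernel d (bridgeState β t) (bridgeData β t) (bridgeStd β t ^ 2) with hK
  have h : (forwardLaw q₀ β).map (fun x => (x (t + 1), x t)) =
      (forwardLaw q₀ β).map (fun x => x (t + 1)) ⊗ₘ (dataPosterior q₀ β (t + 1) ⊗ₖ K).snd := by
    have e := map_forwardLaw_bridge q₀ hβ ht
    rw [← map_compProd_dataPosterior, ← hK] at e
    refine Measure.ext_of_lintegral _ fun f hf => ?_
    have e1 := congrArg (fun m => ∫⁻ p, f (p.1.1, p.2) ∂m) e
    beta_reduce at e1
    rw [lintegral_map (by fun_prop) (by fun_prop), Measure.lintegral_compProd (by fun_prop),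
      Measure.lintegral_compProd (Measurable.lintegral_kernel_prod_right'
        (f := fun p : (E d × E d) × E d => f (p.1.1, p.2)) (by fun_prop))] at e1
    rw [lintegral_map hf (by fun_prop), Measure.lintegral_compProd hf]
    refine e1.trans (lintegral_congr fun v => ?_)
    rw [Kernel.lintegral_snd _ _ (by fun_prop), Kernel.lintegral_compProd _ _ _ (by fun_prop)]
  filter_upwards [condDistrib_ae_eq_of_measure_eq_compProd_of_measurable
    (by fun_prop) (by fun_prop) h] with v hv
  refine hv.trans ?_
  ext A hA
  rw [Kernel.snd_apply' _ _ hA, Kernel.compProd_apply (measurable_snd hA),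
    Measure.bind_apply hA (Kernel.aemeasurable _)]
  rfl

lemma ae_dataPosterior {D : ℝ} (hD : ∀ᵐ x ∂q₀, ‖x‖ ≤ D) (t : ℕ) :
    ∀ᵐ v ∂((forwardLaw q₀ β).map fun x => x t), ∀ᵐ x ∂(dataPosterior q₀ β t v), ‖x‖ ≤ D := by
  refine Measure.ae_ae_of_ae_compProd (p := fun p : E d × E d => ‖p.2‖ ≤ D) ?_
  rw [map_compProd_dataPosterior, ae_map_iff (by fun_prop)
    (measurableSet_le (by fun_prop) measurable_const)]
  have h : (forwardLaw q₀ β).map (fun x => x 0) = q₀ :=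
    map_chainLaw_zero q₀ (fun n => forwardKernel d (β (n + 1)))
  rw [← h] at hD
  exact ae_of_ae_map (measurable_pi_apply 0).aemeasurable hD

lemma map_forwardLaw_apply (hβ : ∀ t ∈ Finset.Icc 1 T, β t ∈ Set.Ioo (0 : ℝ) 1) {t : ℕ}
    (ht : t ≤ T) : (forwardLaw q₀ β).map (fun x => x t) = noisyKernel d β t ∘ₘ q₀ := by
  rw [← Measure.snd_compProd, ← map_forwardLaw q₀ hβ ht, Measure.snd,
    Measure.map_map measurable_snd (by fun_prop)]
  rfl

lemma terminalKL_ne_top (hβ : ∀ t ∈ Finset.Icc 1 T, β t ∈ Set.Ioo (0 : ℝ) 1) (hT : 1 ≤ T)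
    {D : ℝ} (hD : ∀ᵐ x ∂q₀, ‖x‖ ≤ D) : terminalKL q₀ β T ≠ ∞ := by
  obtain ⟨t, rfl⟩ : ∃ t, T = t + 1 := ⟨T - 1, by omega⟩
  have h := alphaBar_lt_one hβ (t := t) le_rfl
  have hp : 0 < 1 - alphaBar β (t + 1) := by linarith
  rw [terminalKL, map_forwardLaw_apply q₀ hβ le_rfl, noisyKernel, ← Real.sq_sqrt hp.le]
  exact klDiv_comp_affineKernel_ne_top 0 (Real.sqrt_nonneg _) (Real.sqrt_pos.2 hp) hD

end Forward

/-! ### The divergence of path laws -/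

section PathSpace

variable {d : ℕ}

/-- Splitting off the last point of a path. -/
def splitLast (d n : ℕ) : (Finset.Iic (n + 1) → E d) ≃ᵐ (Finset.Iic n → E d) × E d where
  toFun y := (fun k => y ⟨k, Finset.mem_Iic.2 ((Finset.mem_Iic.1 k.2).trans n.le_succ)⟩,
    y ⟨n + 1, Finset.mem_Iic.2 le_rfl⟩)
  invFun p k := if h : (k : ℕ) ≤ n then p.1 ⟨k, Finset.mem_Iic.2 h⟩ else p.2
  left_inv y := by
    funext ⟨k, hk⟩
    rw [Finset.mem_Iic] at hk
    by_cases h : k ≤ n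
    · simp [h]
    · obtain rfl : k = n + 1 := by omega
      simp
  right_inv p := by
    refine Prod.ext (funext fun k => ?_) ?_
    · simp [Finset.mem_Iic.1 k.2]
    · simp
  measurable_toFun := by
    refine Measurable.prodMk (measurable_pi_lambda _ fun k => ?_) ?_ <;>
      exact measurable_pi_apply _
  measurable_invFun := by
    refine measurable_pi_lambda _ fun k => ?_
    by_cases h : (k : ℕ) ≤ n
    · simp only [Equiv.coe_fn_symm_mk, h, dite_true]
      exact (measurable_pi_apply _).comp measurable_fst
    · simp only [Equiv.coe_fn_symm_mk, h, dite_false]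
      exact measurable_snd

/-- Time reversal `t = T - k`, from paths `(y 0, …, y (T - 1))` to paths `(x 1, …, x T)`. -/
def timeReversal (d : ℕ) {T : ℕ} (hT : 1 ≤ T) :
    (Finset.Iic (T - 1) → E d) ≃ᵐ (Finset.Icc 1 T → E d) where
  toFun y t := y ⟨T - t, by have := Finset.mem_Icc.1 t.2; rw [Finset.mem_Iic]; omega⟩
  invFun x k := x ⟨T - k, by have := Finset.mem_Iic.1 k.2; rw [Finset.mem_Icc]; omega⟩
  left_inv y := by
    funext ⟨k, hk⟩
    rw [Finset.mem_Iic] at hk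
    simp only
    congr 2
    omega
  right_inv x := by
    funext ⟨k, hk⟩
    rw [Finset.mem_Icc] at hk
    simp only
    congr 2
    omega
  measurable_toFun := measurable_pi_lambda _ fun t => measurable_pi_apply _
  measurable_invFun := measurable_pi_lambda _ fun t => measurable_pi_apply _

end PathSpace

section PathLaw

open InformationTheory

variable {d : ℕ} (q₀ : Measure (E d)) [IsProbabilityMeasure q₀] (β : ℕ → ℝ)

instance (t : ℕ) : IsMarkovKernel (exactReverse q₀ β t) := by
  unfold exactReverse; infer_instance

lemma map_compProd_exactReverse (t : ℕ) :
    (forwardLaw q₀ β).map (fun x => x t) ⊗ₘ exactReverse q₀ β t =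
      (forwardLaw q₀ β).map fun x => (x t, x (t - 1)) :=
  compProd_map_condDistrib (measurable_pi_apply (t - 1)).aemeasurable

lemma measurable_revPath (d T n : ℕ) :
    Measurable fun (x : ℕ → E d) (k : Finset.Iic n) => x (T - k) :=
  measurable_pi_lambda _ fun _ => measurable_pi_apply _

/-- The Markov property of the forward process in reversed time: given `x_t, …, x_{t+m}`, the law
of `x_{t-1}` only depends on `x_t`. The future is encoded as a path stopped after `m` steps. -/
lemma lintegral_exactReverse (t m : ℕ) {f : E d × (ℕ → E d) → ℝ≥0∞} (hf : Measurable f) :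
    ∫⁻ x, f (x (t - 1), fun j => x (t + min j m)) ∂(forwardLaw q₀ β) =
      ∫⁻ x, ∫⁻ u, f (u, fun j => x (t + min j m)) ∂(exactReverse q₀ β t (x t))
        ∂(forwardLaw q₀ β) := by
  induction m generalizing f with
  | zero =>
    have hg : Measurable fun p : E d × E d => f (p.2, fun _ => p.1) := by fun_prop
    have h := congrArg (fun m => ∫⁻ p, f (p.2, fun _ => p.1) ∂m)
      (map_compProd_exactReverse q₀ β t)
    beta_reduce at h
    rw [lintegral_map hg (by fun_prop), Measure.lintegral_compProd hg,
      lintegral_map hg.lintegral_kernel_prod_right' (by fun_prop)] at h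
    simpa using h.symm
  | succ m ih =>
    set F := forwardKernel d (β (t + m + 1)) with hF
    set R := exactReverse q₀ β t with hR
    -- the path stopped after `m + 1` steps, from the path stopped after `m` steps
    let glue : (ℕ → E d) → E d → ℕ → E d := fun y z j => if j ≤ m then y j else z
    have hglue : Measurable fun p : (ℕ → E d) × E d => glue p.1 p.2 := by
      refine measurable_pi_lambda _ fun j => ?_
      by_cases hj : j ≤ m
      · simp only [glue, hj, if_true]; fun_prop
      · simp only [glue, hj, if_false]; fun_prop
    have e : ∀ x : ℕ → E d, (fun j => x (t + min j (m + 1))) =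
        glue (fun j => x (t + min j m)) (x (t + m + 1)) := by
      intro x
      funext j
      by_cases hj : j ≤ m
      · simp only [glue, hj, if_true]
        rw [min_eq_left hj, min_eq_left (hj.trans m.le_succ)]
      · simp only [glue, hj, if_false]
        rw [min_eq_right (by omega)]
        rfl
    have step : ∀ {g : (E d × (ℕ → E d)) × E d → ℝ≥0∞}, Measurable g →
        ∫⁻ x, g ((x (t - 1), fun j => x (t + min j m)), x (t + m + 1)) ∂(forwardLaw q₀ β) =
        ∫⁻ x, ∫⁻ z, g ((x (t - 1), fun j => x (t + min j m)), z) ∂(F (x (t + m)))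
          ∂(forwardLaw q₀ β) := by
      intro g hg
      refine lintegral_chainLaw_succ q₀ (fun n => forwardKernel d (β (n + 1))) (t + m)
        (X := fun y => (y ⟨t - 1, Finset.mem_Iic.2 (by omega)⟩,
          fun j => y ⟨t + min j m, Finset.mem_Iic.2 (by omega)⟩)) ?_ hg
      exact (measurable_pi_apply _).prodMk
        (measurable_pi_lambda _ fun j => measurable_pi_apply _)
    have hfg : Measurable fun p : (E d × (ℕ → E d)) × E d => f (p.1.1, glue p.1.2 p.2) :=
      hf.comp ((measurable_fst.comp measurable_fst).prodMk
        (hglue.comp ((measurable_snd.comp measurable_fst).prodMk measurable_snd)))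
    -- average over the last point first
    have hA : Measurable fun p : E d × (ℕ → E d) => ∫⁻ z, f (p.1, glue p.2 z) ∂(F (p.2 m)) :=
      hfg.lintegral_kernel_prod_right' (κ := F.comap (fun p : E d × (ℕ → E d) => p.2 m)
        (by fun_prop))
    -- average over the first point first
    have hB : Measurable fun p : (ℕ → E d) × E d => ∫⁻ u, f (u, glue p.1 p.2) ∂(R (p.1 0)) :=
      (by fun_prop : Measurable fun p : ((ℕ → E d) × E d) × E d => f (p.2, glue p.1.1 p.1.2)
        ).lintegral_kernel_prod_right' (κ := R.comap (fun p : (ℕ → E d) × E d => p.1 0)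
          (by fun_prop))
    simp_rw [e]
    calc ∫⁻ x, f (x (t - 1), glue (fun j => x (t + min j m)) (x (t + m + 1))) ∂(forwardLaw q₀ β)
        = ∫⁻ x, ∫⁻ z, f (x (t - 1), glue (fun j => x (t + min j m)) z) ∂(F (x (t + m)))
            ∂(forwardLaw q₀ β) := step hfg
      _ = ∫⁻ x, ∫⁻ u, ∫⁻ z, f (u, glue (fun j => x (t + min j m)) z) ∂(F (x (t + m)))
            ∂(R (x t)) ∂(forwardLaw q₀ β) := by
          have := ih hA
          simpa using this
      _ = ∫⁻ x, ∫⁻ z, ∫⁻ u, f (u, glue (fun j => x (t + min j m)) z) ∂(R (x t))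
            ∂(F (x (t + m))) ∂(forwardLaw q₀ β) := by
          refine lintegral_congr fun x => lintegral_lintegral_swap ?_
          exact (hf.comp (measurable_fst.prodMk (hglue.comp
            (measurable_const.prodMk measurable_snd)))).aemeasurable
      _ = _ := by
          have := step (g := fun p => ∫⁻ u, f (u, glue p.1.2 p.2) ∂(R (p.1.2 0)))
            (hB.comp ((measurable_snd.comp measurable_fst).prodMk measurable_snd))
          simpa using this.symm

/-- The law of `(x_T, x_{T-1}, …, x_{T-n})`. -/
noncomputable def reversedLaw (T n : ℕ) : Measure (Finset.Iic n → E d) :=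
  (forwardLaw q₀ β).map fun x k => x (T - k)

instance (T n : ℕ) : IsProbabilityMeasure (reversedLaw q₀ β T n) :=
  Measure.isProbabilityMeasure_map (measurable_revPath d T n).aemeasurable

lemma reversedLaw_succ {T n : ℕ} (hn : n + 1 ≤ T) :
    (reversedLaw q₀ β T (n + 1)).map (splitLast d n) =
      reversedLaw q₀ β T n ⊗ₘ lastStep (exactReverse q₀ β (T - n)) n := by
  have hm := fun n => measurable_revPath d T n
  have hG := measurable_revPath d n n
  have e : ∀ x : ℕ → E d, (fun k : Finset.Iic n => x (T - k)) =
      fun k : Finset.Iic n => (fun j => x (T - n + min j n)) (n - (k : ℕ)) := by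
    intro x
    funext k
    have := Finset.mem_Iic.1 k.2
    simp only
    congr 1
    omega
  refine Measure.ext_of_lintegral _ fun f hf => ?_
  rw [reversedLaw, Measure.map_map (splitLast d n).measurable (hm _),
    lintegral_map hf ((splitLast d n).measurable.comp (hm _)), Measure.lintegral_compProd hf,
    reversedLaw, lintegral_map hf.lintegral_kernel_prod_right' (hm _)]
  have h := lintegral_exactReverse q₀ β (T - n) n
    (f := fun p => f (fun k => p.2 (n - k), p.1)) (hf.comp ((hG.comp measurable_snd).prodMk
      measurable_fst))
  simp only [e]
  refine Eq.trans ?_ (h.trans ?_)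
  · refine lintegral_congr fun x => congrArg f (Prod.ext (e x) ?_)
    change x (T - (n + 1)) = x (T - n - 1)
    rw [Nat.sub_sub]
  · refine lintegral_congr fun x => ?_
    simp [lastStep]

lemma map_chainLaw_splitLast (ν : Measure (E d)) [IsProbabilityMeasure ν]
    (K : ℕ → Kernel (E d) (E d)) [∀ n, IsMarkovKernel (K n)] (n : ℕ) :
    ((chainLaw ν K).map (Preorder.frestrictLe (n + 1))).map (splitLast d n) =
      (chainLaw ν K).map (Preorder.frestrictLe n) ⊗ₘ lastStep (K n) n := by
  rw [← map_chainLaw_succ, Measure.map_map (splitLast d n).measurable (by fun_prop)]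
  rfl

/-- The chain rule for the divergence of the backward paths. -/
lemma klDiv_reversedLaw (T : ℕ) (p : ReverseModel d) {n : ℕ} (hn : n + 1 ≤ T) :
    klDiv (reversedLaw q₀ β T n)
      ((chainLaw (multivariateGaussian 0 1) (fun k => p.kernel (T - k))).map
        (Preorder.frestrictLe n)) =
      terminalKL q₀ β T + ∑ k ∈ Finset.range n,
        ∫⁻ v, klDiv (exactReverse q₀ β (T - k) v) (p.kernel (T - k) v)
          ∂((forwardLaw q₀ β).map fun x => x (T - k)) := by
  set P := chainLaw (multivariateGaussian (0 : E d) 1) (fun k => p.kernel (T - k)) with hP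
  have hfin : ∀ n, IsProbabilityMeasure (P.map (Preorder.frestrictLe (π := fun _ => E d) n)) :=
    fun n => Measure.isProbabilityMeasure_map (by fun_prop)
  induction n with
  | zero =>
    let e := MeasurableEquiv.piUnique (δ' := Finset.Iic 0) (fun _ => E d)
    rw [← klDiv_map_equiv e, reversedLaw, Measure.map_map e.measurable
      (measurable_revPath d T 0),
      Measure.map_map e.measurable (by fun_prop), Finset.sum_range_zero, add_zero, terminalKL]
    congr 1
    exact map_chainLaw_zero _ _
  | succ n ih =>
    have ih := ih (by omega)
    rw [← klDiv_map_equiv (splitLast d n), reversedLaw_succ q₀ β (by omega),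
      map_chainLaw_splitLast, klDiv_compProd_eq_add, ih, klDiv_compProd_eq_lintegral,
      Finset.sum_range_succ, ← add_assoc]
    congr 1
    have hm := measurable_klDiv (exactReverse q₀ β (T - n)) (p.kernel (T - n))
    have hm' : Measurable fun y : Finset.Iic n → E d =>
        klDiv (lastStep (exactReverse q₀ β (T - n)) n y) (lastStep (p.kernel (T - n)) n y) :=
      hm.comp (measurable_pi_apply _)
    rw [reversedLaw, lintegral_map hm' (measurable_revPath d T n),
      lintegral_map hm (measurable_pi_apply (T - n))]
    rfl

/-- The divergence of the path laws splits into the terminal mismatch and the mean divergences of the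
reverse transitions. -/
lemma pathKL_eq {T : ℕ} (hT : 1 ≤ T) (p : ReverseModel d) :
    pathKL q₀ β T p = terminalKL q₀ β T + ∑ t ∈ Finset.Icc 2 T,
      ∫⁻ v, klDiv (exactReverse q₀ β t v) (p.kernel t v)
        ∂((forwardLaw q₀ β).map fun x => x t) := by
  have h := klDiv_reversedLaw q₀ β T p (n := T - 1) (by omega)
  set P := chainLaw (multivariateGaussian (0 : E d) 1) (fun k => p.kernel (T - k)) with hP
  have hfin : IsProbabilityMeasure (P.map (Preorder.frestrictLe (π := fun _ => E d) (T - 1))) :=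
    Measure.isProbabilityMeasure_map (by fun_prop)
  have h1 : (reversedLaw q₀ β T (T - 1)).map (timeReversal d hT) = forwardPathLaw q₀ β T := by
    rw [reversedLaw, Measure.map_map (timeReversal d hT).measurable
      (measurable_revPath d T (T - 1)), forwardPathLaw]
    congr 1
    funext x t
    have := Finset.mem_Icc.1 t.2
    change x (T - (T - t)) = x t
    congr 1
    omega
  have h2 : (P.map (Preorder.frestrictLe (T - 1))).map (timeReversal d hT) = p.pathLaw T := by
    rw [Measure.map_map (timeReversal d hT).measurable (by fun_prop), ReverseModel.pathLaw]
    rfl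
  rw [pathKL, ← h1, ← h2, klDiv_map_equiv, h]
  congr 1
  refine Finset.sum_bij' (fun k _ => T - k) (fun t _ => T - t) ?_ ?_ ?_ ?_ ?_ <;>
    intro k hk <;> simp only [Finset.mem_range, Finset.mem_Icc] at hk ⊢ <;> omega

end PathLaw

/-! ### The optimal reverse model -/

section Optimal

open InformationTheory

variable {d T : ℕ} (q₀ : Measure (E d)) [IsProbabilityMeasure q₀] {β : ℕ → ℝ}

lemma lintegral_posteriorGivenData (hβ : ∀ t ∈ Finset.Icc 1 T, β t ∈ Set.Ioo (0 : ℝ) 1) {t : ℕ}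
    (ht : t + 1 ≤ T) (η : Kernel (E d) (E d)) [IsMarkovKernel η] :
    ∫⁻ x, klDiv (posteriorGivenData q₀ β (t + 1) (x (t + 1), x 0)) (η (x (t + 1)))
        ∂(forwardLaw q₀ β) =
      ∫⁻ v, ∫⁻ x, klDiv
          (affineKernel (bridgeState β t • v) (bridgeData β t) (bridgeStd β t ^ 2) x) (η v)
        ∂(dataPosterior q₀ β (t + 1) v) ∂((forwardLaw q₀ β).map fun x => x (t + 1)) := by
  set K := bridgeKernel d (bridgeState β t) (bridgeData β t) (bridgeStd β t ^ 2) with hK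
  have hm : Measurable fun p : E d × E d => klDiv (K p) (η p.1) :=
    measurable_klDiv K (η.comap Prod.fst measurable_fst)
  have h := congrArg (fun m => ∫⁻ p, klDiv (K p) (η p.1) ∂m)
    (map_compProd_dataPosterior q₀ (β := β) (t + 1))
  beta_reduce at h
  rw [lintegral_map hm (by fun_prop), Measure.lintegral_compProd hm] at h
  refine Eq.trans (lintegral_congr_ae ?_) h.symm
  filter_upwards [posteriorGivenData_ae_eq q₀ hβ ht] with x hx
  rw [hx]
  rfl

/-- The loss at one step is the loss of the exact reverse kernel, plus the mean divergence from
the exact reverse kernel. -/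
lemma lintegral_posteriorGivenData_eq_add (hβ : ∀ t ∈ Finset.Icc 1 T, β t ∈ Set.Ioo (0 : ℝ) 1)
    {t : ℕ} (ht : t + 1 ≤ T) (η : Kernel (E d) (E d)) [IsMarkovKernel η] :
    ∫⁻ x, klDiv (posteriorGivenData q₀ β (t + 1) (x (t + 1), x 0)) (η (x (t + 1)))
        ∂(forwardLaw q₀ β) =
      ∫⁻ x, klDiv (posteriorGivenData q₀ β (t + 1) (x (t + 1), x 0))
        (exactReverse q₀ β (t + 1) (x (t + 1))) ∂(forwardLaw q₀ β) +
      ∫⁻ v, klDiv (exactReverse q₀ β (t + 1) v) (η v)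
        ∂((forwardLaw q₀ β).map fun x => x (t + 1)) := by
  rw [lintegral_posteriorGivenData q₀ hβ ht, lintegral_posteriorGivenData q₀ hβ ht,
    ← lintegral_add_right _ (measurable_klDiv _ _)]
  refine lintegral_congr_ae ?_
  filter_upwards [exactReverse_ae_eq q₀ hβ ht] with v hv
  rw [hv]
  exact lintegral_klDiv_eq_add _ _ _

/-- The excess of the loss over its lower bound is the mean divergence of the exact reverse kernels
from the model. -/
lemma loss_eq_add (hβ : ∀ t ∈ Finset.Icc 1 T, β t ∈ Set.Ioo (0 : ℝ) 1) (p : ReverseModel d) :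
    p.loss q₀ β T = exactLoss q₀ β T + ∑ t ∈ Finset.Icc 2 T,
      ∫⁻ v, klDiv (exactReverse q₀ β t v) (p.kernel t v)
        ∂((forwardLaw q₀ β).map fun x => x t) := by
  rw [ReverseModel.loss, exactLoss, ← Finset.sum_add_distrib]
  refine Finset.sum_congr rfl fun t ht => ?_
  rw [Finset.mem_Icc] at ht
  obtain ⟨t, rfl⟩ : ∃ s, t = s + 1 := ⟨t - 1, by omega⟩
  exact lintegral_posteriorGivenData_eq_add q₀ hβ ht.2 _

open scoped Classical in
/-- Moving the points outside the ball of radius `D` to the origin. -/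
noncomputable def clip (D : ℝ) (x : E d) : E d := if ‖x‖ ≤ D then x else 0

lemma measurable_clip (D : ℝ) : Measurable (clip D : E d → E d) :=
  Measurable.ite (measurableSet_le (by fun_prop) measurable_const) measurable_id measurable_const

lemma norm_clip_le {D : ℝ} (hD : 0 ≤ D) (x : E d) : ‖clip D x‖ ≤ D := by
  unfold clip
  split_ifs with h
  · exact h
  · simpa using hD

/-- The law of `x_0` given `x_t`, modified on a null set so that it is always carried by the ball
of radius `D`. -/
noncomputable def clippedPosterior (β : ℕ → ℝ) (D : ℝ) (t : ℕ) : Kernel (E d) (E d) :=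
  (dataPosterior q₀ β t).map (clip D)

instance (D : ℝ) (t : ℕ) : IsMarkovKernel (clippedPosterior q₀ β D t) :=
  Kernel.IsMarkovKernel.map _ (measurable_clip D)

lemma ae_clippedPosterior {D : ℝ} (hD : 0 ≤ D) (t : ℕ) (v : E d) :
    ∀ᵐ x ∂(clippedPosterior q₀ β D t v), ‖x‖ ≤ D := by
  rw [clippedPosterior, Kernel.map_apply _ (measurable_clip D),
    ae_map_iff (measurable_clip D).aemeasurable (measurableSet_le (by fun_prop) measurable_const)]
  exact ae_of_all _ (norm_clip_le hD)

lemma clippedPosterior_ae_eq {D : ℝ} (hD : ∀ᵐ x ∂q₀, ‖x‖ ≤ D) (t : ℕ) :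
    ∀ᵐ v ∂((forwardLaw q₀ β).map fun x => x t),
      clippedPosterior q₀ β D t v = dataPosterior q₀ β t v := by
  filter_upwards [ae_dataPosterior q₀ hD t] with v hv
  rw [clippedPosterior, Kernel.map_apply _ (measurable_clip D)]
  have : (clip D : E d → E d) =ᵐ[dataPosterior q₀ β t v] id := by
    filter_upwards [hv] with x hx
    simp [clip, hx]
  rw [Measure.map_congr this, Measure.map_id]

lemma measurable_meanVec (κ : Kernel (E d) (E d)) [IsMarkovKernel κ] :
    Measurable fun v => meanVec (κ v) := by
  refine (WithLp.measurable_toLp 2 _).comp (measurable_pi_lambda _ fun i => ?_)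
  exact ((measurable_coord i).stronglyMeasurable.integral_kernel (κ := κ)).measurable

lemma measurable_covMat (κ : Kernel (E d) (E d)) [IsMarkovKernel κ] (i j : Fin d) :
    Measurable fun v => covMat (κ v) i j := by
  have h := measurable_meanVec κ
  have hf : Measurable fun p : E d × E d =>
      (p.2 i - meanVec (κ p.1) i) * (p.2 j - meanVec (κ p.1) j) := by
    have hk : ∀ k, Measurable fun p : E d × E d => meanVec (κ p.1) k := fun k =>
      (measurable_coord k).comp (h.comp measurable_fst)
    exact (((measurable_coord i).comp measurable_snd).sub (hk i)).mul
      (((measurable_coord j).comp measurable_snd).sub (hk j))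
  exact (hf.stronglyMeasurable.integral_kernel_prod_right' (κ := κ)).measurable

/-- The reverse model whose mean and covariance at `1 ≤ t ≤ T` are those of the exact reverse kernel,
up to null sets. -/
noncomputable def momentModel (β : ℕ → ℝ) {D : ℝ} (hD : 0 ≤ D) : ReverseModel d where
  mean v t := bridgeState β (t - 1) • v +
    bridgeData β (t - 1) • meanVec (clippedPosterior q₀ β D t v)
  cov v t := bridgeStd β (t - 1) ^ 2 • 1 +
    bridgeData β (t - 1) ^ 2 • covMat (clippedPosterior q₀ β D t v)
  measurable_mean t := by
    have := measurable_meanVec (clippedPosterior q₀ β D t)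
    fun_prop
  measurable_cov t i j := by
    have := measurable_covMat (clippedPosterior q₀ β D t) i j
    simp only [Matrix.add_apply, Matrix.smul_apply, smul_eq_mul]
    fun_prop
  posSemidef_cov v t := posSemidef_momentMatch (sq_nonneg _) _ (ae_clippedPosterior q₀ hD t v)

lemma momentModel_ae_eq {D : ℝ} (hD : ∀ᵐ x ∂q₀, ‖x‖ ≤ D) (hD0 : 0 ≤ D) (t : ℕ) :
    ∀ᵐ v ∂((forwardLaw q₀ β).map fun x => x (t + 1)),
      (momentModel q₀ β hD0).kernel (t + 1) v = momentMatch (bridgeState β t • v) (bridgeData β t)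
        (bridgeStd β t ^ 2) (dataPosterior q₀ β (t + 1) v) := by
  filter_upwards [clippedPosterior_ae_eq q₀ hD (t + 1)] with v hv
  rw [← hv]
  rfl

lemma isOptimal_momentModel (hβ : ∀ t ∈ Finset.Icc 1 T, β t ∈ Set.Ioo (0 : ℝ) 1) {D : ℝ}
    (hD : ∀ᵐ x ∂q₀, ‖x‖ ≤ D) (hD0 : 0 ≤ D) : (momentModel q₀ β hD0).IsOptimal q₀ β T := by
  intro p
  refine Finset.sum_le_sum fun t ht => ?_
  rw [Finset.mem_Icc] at ht
  obtain ⟨t, rfl⟩ : ∃ s, t = s + 2 := ⟨t - 2, by omega⟩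
  rw [lintegral_posteriorGivenData q₀ hβ (t := t + 1) ht.2,
    lintegral_posteriorGivenData q₀ hβ (t := t + 1) ht.2]
  refine lintegral_mono_ae ?_
  filter_upwards [momentModel_ae_eq q₀ (β := β) hD hD0 (t + 1), ae_dataPosterior q₀ hD (t + 1 + 1)]
    with v hv hv'
  rw [hv]
  exact lintegral_klDiv_momentMatch_le _ (bridgeData_nonneg hβ ht.2) (bridgeStd_pos hβ ht.2) hv' _
    (p.posSemidef_cov _ _)

lemma loss_momentModel_ne_top (hβ : ∀ t ∈ Finset.Icc 1 T, β t ∈ Set.Ioo (0 : ℝ) 1) {D : ℝ}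
    (hD : ∀ᵐ x ∂q₀, ‖x‖ ≤ D) (hD0 : 0 ≤ D) : (momentModel q₀ β hD0).loss q₀ β T ≠ ∞ := by
  refine ENNReal.sum_ne_top.2 fun t ht => ?_
  rw [Finset.mem_Icc] at ht
  obtain ⟨t, rfl⟩ : ∃ s, t = s + 2 := ⟨t - 2, by omega⟩
  rw [lintegral_posteriorGivenData q₀ hβ (t := t + 1) ht.2]
  have : IsProbabilityMeasure ((forwardLaw q₀ β).map fun x => x (t + 1 + 1)) :=
    Measure.isProbabilityMeasure_map (measurable_pi_apply _).aemeasurable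
  refine ne_top_of_le_ne_top (b := ENNReal.ofReal
    ((bridgeData β (t + 1) / bridgeStd β (t + 1) * D) ^ 2 / 2)) ENNReal.ofReal_ne_top ?_
  refine (lintegral_mono_ae (g := fun _ => ENNReal.ofReal
    ((bridgeData β (t + 1) / bridgeStd β (t + 1) * D) ^ 2 / 2)) ?_).trans (by simp)
  filter_upwards [momentModel_ae_eq q₀ (β := β) hD hD0 (t + 1), ae_dataPosterior q₀ hD (t + 1 + 1)]
    with v hv hv'
  rw [hv]
  exact lintegral_klDiv_momentMatch_le_ofReal _ (bridgeData_nonneg hβ ht.2) (bridgeStd_pos hβ ht.2)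
    hv'

lemma lintegral_klDiv_exactReverse_le (hβ : ∀ t ∈ Finset.Icc 1 T, β t ∈ Set.Ioo (0 : ℝ) 1) {D : ℝ}
    (hD : ∀ᵐ x ∂q₀, ‖x‖ ≤ D) (hD0 : 0 ≤ D) {t : ℕ} (ht : t + 2 ≤ T) :
    ∫⁻ v, klDiv (exactReverse q₀ β (t + 2) v) ((momentModel q₀ β hD0).kernel (t + 2) v)
      ∂((forwardLaw q₀ β).map fun x => x (t + 2)) ≤
      ENNReal.ofReal (snrStep β (t + 1) ^ 3 * D ^ 6 / 2) := by
  have : IsProbabilityMeasure ((forwardLaw q₀ β).map fun x => x (t + 1 + 1)) :=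
    Measure.isProbabilityMeasure_map (measurable_pi_apply _).aemeasurable
  refine (lintegral_mono_ae (g := fun _ => ENNReal.ofReal (snrStep β (t + 1) ^ 3 * D ^ 6 / 2))
    ?_).trans (by simp)
  filter_upwards [momentModel_ae_eq q₀ (β := β) hD hD0 (t + 1), ae_dataPosterior q₀ hD (t + 1 + 1),
    exactReverse_ae_eq q₀ hβ (t := t + 1) ht] with v hv hv' hv''
  rw [hv, hv'']
  refine (klDiv_momentMatch_le _ (bridgeData_nonneg hβ ht) (bridgeStd_pos hβ ht) hv').trans_eq ?_
  rw [← sq_bridgeData_div_bridgeStd hβ ht]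
  congr 1
  ring

lemma sum_lintegral_klDiv_exactReverse_le (hT : 1 ≤ T)
    (hβ : ∀ t ∈ Finset.Icc 1 T, β t ∈ Set.Ioo (0 : ℝ) 1) {D : ℝ}
    (hD : ∀ᵐ x ∂q₀, ‖x‖ ≤ D) (hD0 : 0 ≤ D) {C : ℝ} (hC : 0 < C)
    (hγ : ∀ t ∈ Finset.Ico 1 T, snrStep β t ≤ C / (T : ℝ)) :
    ∑ t ∈ Finset.Icc 2 T,
      ∫⁻ v, klDiv (exactReverse q₀ β t v) ((momentModel q₀ β hD0).kernel t v)
        ∂((forwardLaw q₀ β).map fun x => x t) ≤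
      ENNReal.ofReal (C ^ 3 * D ^ 6 / (2 * (T : ℝ) ^ 2)) := by
  have hT0 : (0 : ℝ) < T := by exact_mod_cast hT
  calc _ ≤ ∑ t ∈ Finset.Icc 2 T, ENNReal.ofReal ((C / T) ^ 3 * D ^ 6 / 2) := by
        refine Finset.sum_le_sum fun t ht => ?_
        rw [Finset.mem_Icc] at ht
        obtain ⟨t, rfl⟩ : ∃ s, t = s + 2 := ⟨t - 2, by omega⟩
        refine (lintegral_klDiv_exactReverse_le q₀ hβ hD hD0 ht.2).trans
          (ENNReal.ofReal_le_ofReal ?_)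
        have h0 : 0 ≤ snrStep β (t + 1) := by
          rw [← sq_bridgeData_div_bridgeStd hβ ht.2]; positivity
        have h1 := hγ (t + 1) (Finset.mem_Ico.2 ⟨by omega, by omega⟩)
        gcongr
    _ = ENNReal.ofReal ((T - 1 : ℕ) * ((C / T) ^ 3 * D ^ 6 / 2)) := by
        rw [Finset.sum_const, Nat.card_Icc, nsmul_eq_mul, ENNReal.ofReal_mul (by positivity),
          ENNReal.ofReal_natCast]
        congr 2
    _ ≤ _ := by
        refine ENNReal.ofReal_le_ofReal ?_
        have h : ((T - 1 : ℕ) : ℝ) ≤ T := by exact_mod_cast Nat.sub_le T 1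
        calc ((T - 1 : ℕ) : ℝ) * ((C / T) ^ 3 * D ^ 6 / 2) ≤ T * ((C / T) ^ 3 * D ^ 6 / 2) := by
              gcongr
          _ = _ := by field_simp

end Optimal

end DDPM

theorem theorem1 {d T : ℕ} (hT : 1 ≤ T) (q₀ : Measure (DDPM.E d)) [IsProbabilityMeasure q₀]
    (D : ℝ) (hD : ∀ᵐ x ∂q₀, ‖x‖ ≤ D)
    (β : ℕ → ℝ) (hβ : ∀ t ∈ Finset.Icc 1 T, β t ∈ Set.Ioo (0 : ℝ) 1)
    (C : ℝ) (hC : 0 < C) (hγ : ∀ t ∈ Finset.Ico 1 T, DDPM.snrStep β t ≤ C / (T : ℝ)) :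
    (∃ p : DDPM.ReverseModel d, p.IsOptimal q₀ β T) ∧
    ∀ p : DDPM.ReverseModel d, p.IsOptimal q₀ β T →
      (DDPM.pathKL q₀ β T p ≠ ∞ ∧ DDPM.terminalKL q₀ β T ≠ ∞ ∧
        p.loss q₀ β T ≠ ∞ ∧ DDPM.exactLoss q₀ β T ≠ ∞) ∧
      (DDPM.pathKL q₀ β T p).toReal - (DDPM.terminalKL q₀ β T).toReal =
        (p.loss q₀ β T).toReal - (DDPM.exactLoss q₀ β T).toReal ∧
      (p.loss q₀ β T).toReal - (DDPM.exactLoss q₀ β T).toReal ≤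
        C ^ 3 * D ^ 6 / (2 * (T : ℝ) ^ 2) := by
  have hD0 : 0 ≤ D := by
    obtain ⟨x, hx⟩ := hD.exists
    exact (norm_nonneg x).trans hx
  refine ⟨⟨_, DDPM.isOptimal_momentModel q₀ hβ hD hD0⟩, fun p hp => ?_⟩
  have hle := hp (DDPM.momentModel q₀ β hD0)
  have hterm := DDPM.terminalKL_ne_top q₀ hβ hT hD
  have hloss := ne_top_of_le_ne_top (DDPM.loss_momentModel_ne_top q₀ hβ hD hD0) hle
  have hpath := DDPM.pathKL_eq q₀ β hT p
  have hbound := DDPM.sum_lintegral_klDiv_exactReverse_le q₀ hT hβ hD hD0 hC hγ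
  have hp' := hloss
  rw [DDPM.loss_eq_add q₀ hβ p] at hp' hle
  rw [DDPM.loss_eq_add q₀ hβ] at hle
  obtain ⟨hexact, hgap⟩ := ENNReal.add_ne_top.1 hp'
  have hgap_le := ((ENNReal.add_le_add_iff_left hexact).1 hle).trans hbound
  have hdiff : (p.loss q₀ β T).toReal - (DDPM.exactLoss q₀ β T).toReal = ENNReal.toReal
      (∑ t ∈ Finset.Icc 2 T, ∫⁻ v, InformationTheory.klDiv (DDPM.exactReverse q₀ β t v)
        (p.kernel t v) ∂((DDPM.forwardLaw q₀ β).map fun x => x t)) := by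
    rw [DDPM.loss_eq_add q₀ hβ p, ENNReal.toReal_add hexact hgap, add_sub_cancel_left]
  refine ⟨⟨?_, hterm, hloss, hexact⟩, ?_, ?_⟩
  · rw [hpath]
    exact ENNReal.add_ne_top.2 ⟨hterm, hgap⟩
  · rw [hdiff, hpath, ENNReal.toReal_add hterm hgap, add_sub_cancel_left]
  · rw [hdiff]
    exact ENNReal.toReal_le_of_le_ofReal (by positivity) hgap_le
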